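/- For $n\ge 1$ let $\mathbb{T}_n^2$ be the two-dimensional discrete torus with vertex set $V(\mathbb{T}_n^2)=\{-n+1,\dots,n\}^2$, in which two vertices are adjacent if they are equal in one coordinate and differ by exactly one modulo $2n$ in the other; let $E(\mathbb{T}_n^2)$ be its set of (undirected) edges and $\mathbf 0=(0,0)$. Let $U:\mathbb{R}\to(-\infty,\infty]$ be a potential, that is, a measurable function with $U(x)=U(-x)$, satisfying $\inf_x U(x)>-\infty$ and $0<\int e^{-U(x)}\,dx<\infty$. Let $\mu_n$ be the probability measure on functions $\varphi:V(\mathbb{T}_n^2)\to\mathbb{R}$ given by $$d\mu_n(\varphi)=\frac1{Z_n}\exp\Big(-\sum_{(v,w)\in E(\mathbb{T}_n^2)}U(\varphi_v-\varphi_w)\Big)\,\delta_0(d\varphi_{\mathbf 0})\prod_{v\ne\mathbf 0}d\varphi_v ,$$ where $Z_n$ is the normalization constant. For $0<\delta<1$ and $0<L<\infty$ we say that $U$ has $(\delta,L)$-controlled gradients on $\mathbb{T}_n^2$ if there is $K>L$ with $U(x)<\infty$ for all $|x|<K$, and $$\mu_n\big(|\varphi_v-\varphi_w|\ge L\text{ for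 every edge }(v,w)\in\{e_1,\dots,e_k\}\big)\le\delta^k\quad\text{for all }k\ge1\text{ and distinct }e_1,\dots,e_k\in E(\mathbb{T}_n^2).$$ Suppose that the restriction of $U$ to $[-1,1]$ is real-valued and twice continuously differentiable. Then there is a constant $c(U)>0$, depending only on $U$, such that for every $n\ge2$ for which there exists $0<\varepsilon\le\frac12$ such that $U$ has $(1/8,1-\varepsilon)$-controlled gradients on $\mathbb{T}_n^2$, if $\varphi$ is sampled from $\mu_n$ then $$\mathbb{P}\Big(\max_{v\in V(\mathbb{T}_n^2)}|\varphi_v|\ge c(U)\log n\Big)\ge\frac12 .$$ -/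

import Mathlib

open MeasureTheory
open scoped ENNReal

/-- The vertices of the two-dimensional discrete torus of side length `2n`. The representatives of
the residues modulo `2n` are `-n+1, …, n`, so this is the vertex set `{-n+1, …, n}²` with
arithmetic modulo `2n`. -/
abbrev TorusVertex (n : ℕ) : Type := ZMod (2 * n) × ZMod (2 * n)

/-- The two-dimensional discrete torus: two vertices are adjacent if they are equal in one
coordinate and differ by exactly one modulo `2n` in the other coordinate. -/
def torus (n : ℕ) : SimpleGraph (TorusVertex n) where
  Adj v w := (v.1 = w.1 ∧ (v.2 - w.2 = 1 ∨ w.2 - v.2 = 1)) ∨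
    (v.2 = w.2 ∧ (v.1 - w.1 = 1 ∨ w.1 - v.1 = 1))
  symm := ⟨fun v w h => by
    rcases h with ⟨h1, h2⟩ | ⟨h1, h2⟩
    · exact Or.inl ⟨h1.symm, h2.symm⟩
    · exact Or.inr ⟨h1.symm, h2.symm⟩⟩
  loopless := ⟨fun v h => by
    have h1 : (1 : ZMod (2 * n)) ≠ 0 := fun h0 => by
      have h2 : 2 * n ∣ 1 := (ZMod.natCast_eq_zero_iff 1 (2 * n)).1 (by exact_mod_cast h0)
      have := Nat.dvd_one.1 h2
      omega
    simp only [sub_self] at h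
    rcases h with ⟨_, h | h⟩ | ⟨_, h | h⟩ <;> exact h1 h.symm⟩

instance torusAdjDecidable (n : ℕ) : DecidableRel (torus n).Adj := fun v w =>
  inferInstanceAs (Decidable ((v.1 = w.1 ∧ (v.2 - w.2 = 1 ∨ w.2 - v.2 = 1)) ∨
    (v.2 = w.2 ∧ (v.1 - w.1 = 1 ∨ w.1 - v.1 = 1))))

/-- A potential: a measurable even function `ℝ → (-∞, ∞]`. -/
structure Potential where
  /-- The underlying function. -/
  toFun : ℝ → EReal
  measurable_toFun : Measurable toFun
  ne_bot : ∀ x, toFun x ≠ ⊥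
  even : ∀ x, toFun (-x) = toFun x

namespace Potential

instance : CoeFun Potential (fun _ => ℝ → EReal) := ⟨Potential.toFun⟩

/-- `inf U > -∞` and `0 < ∫ exp(-U(x)) dx < ∞`. -/
def IsAdmissible (U : Potential) : Prop :=
  (∃ m : ℝ, ∀ x, (m : EReal) ≤ U x) ∧
    0 < ∫⁻ x : ℝ, EReal.exp (-U x) ∧ ∫⁻ x : ℝ, EReal.exp (-U x) < ∞

/-- The restriction of `U` to `[-1,1]` is (real-valued and) twice continuously differentiable. -/
def IsC2OnUnit (U : Potential) : Prop :=
  (∀ x ∈ Set.Icc (-1 : ℝ) 1, U x ≠ ⊤) ∧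
    ContDiffOn ℝ 2 (fun x => (U x).toReal) (Set.Icc (-1 : ℝ) 1)

/-- The value `U(φ_v - φ_w)` on the edge `{v, w}`; it does not depend on the orientation of the
edge since `U` is even. -/
def edgeEnergy (U : Potential) {V : Type*} (φ : V → ℝ) : Sym2 V → EReal :=
  Sym2.lift ⟨fun v w => U (φ v - φ w), fun v w => by
    change U (φ v - φ w) = U (φ w - φ v)
    rw [← U.even, neg_sub]⟩

variable (U : Potential) (n : ℕ) [NeZero n]

/-- The unnormalized density `exp(-∑_{(v,w) ∈ E} U(φ_v - φ_w))`, where each (undirected) edge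
occurs once. -/
noncomputable def weight (φ : TorusVertex n → ℝ) : ℝ≥0∞ :=
  EReal.exp (-∑ e ∈ (torus n).edgeFinset, U.edgeEnergy φ e)

end Potential

/-- The measure `δ₀(dφ_0) ∏_{v ≠ 0} dφ_v`. -/
noncomputable def pinnedLebesgue (n : ℕ) [NeZero n] : Measure (TorusVertex n → ℝ) :=
  Measure.pi fun v => if v = 0 then Measure.dirac 0 else volume

namespace Potential

variable (U : Potential) (n : ℕ) [NeZero n]

/-- The normalization constant. -/
noncomputable def partitionFunction : ℝ≥0∞ :=
  ∫⁻ φ, U.weight n φ ∂pinnedLebesgue n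

/-- The random surface measure on the torus with potential `U`, normalized at the vertex `0`. -/
noncomputable def surfaceMeasure : Measure (TorusVertex n → ℝ) :=
  (U.partitionFunction n)⁻¹ • (pinnedLebesgue n).withDensity (U.weight n)

end Potential

/-- `|φ_v - φ_w|` on the edge `{v, w}`. -/
def absGradient {V : Type*} (φ : V → ℝ) : Sym2 V → ℝ :=
  Sym2.lift ⟨fun v w => |φ v - φ w|, fun v w => abs_sub_comm (φ v) (φ w)⟩

/-- The edges `(v, w)` of the torus with `|φ_v - φ_w| ≥ L`. -/
def steepEdges (n : ℕ) (φ : TorusVertex n → ℝ) (L : ℝ) : Set (Sym2 (TorusVertex n)) :=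
  {e | e ∈ (torus n).edgeSet ∧ L ≤ absGradient φ e}

/-- `U` has `(δ, L)`-controlled gradients on the torus: `U` is finite on `(-K, K)` for some
`K > L`, and any `k ≥ 1` distinct edges are all steep with probability at most `δ ^ k`. -/
def Potential.HasControlledGradients (U : Potential) (n : ℕ) [NeZero n] (δ L : ℝ) : Prop :=
  (∃ K : ℝ, L < K ∧ ∀ x : ℝ, |x| < K → U x < ⊤) ∧
    ∀ S : Finset (Sym2 (TorusVertex n)), S.Nonempty → S ⊆ (torus n).edgeFinset →
      U.surfaceMeasure n {φ | (S : Set (Sym2 (TorusVertex n))) ⊆ steepEdges n φ L} ≤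
        ENNReal.ofReal (δ ^ S.card)

/-- `max_v |φ_v|`. -/
noncomputable def maxHeight (n : ℕ) [NeZero n] (φ : TorusVertex n → ℝ) : ℝ :=
  Finset.univ.sup' Finset.univ_nonempty fun v => |φ v|

/-- The unit vector in the first (`false`) or second (`true`) coordinate direction. -/
def dirVec (n : ℕ) (b : Bool) : TorusVertex n := if b then (0, 1) else (1, 0)

/-- The edges of the torus, indexed by their initial vertex and direction. -/
abbrev DirEdge (n : ℕ) : Type := TorusVertex n × Bool

/-- The gradient of a height function along a directed edge. -/
def edgeGrad {n : ℕ} (φ : TorusVertex n → ℝ) (d : DirEdge n) : ℝ :=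
  φ d.1 - φ (d.1 + dirVec n d.2)

/-- The undirected edge underlying a directed one. -/
def DirEdge.toSym2 {n : ℕ} (d : DirEdge n) : Sym2 (TorusVertex n) :=
  s(d.1, d.1 + dirVec n d.2)

lemma ZMod.one_ne_zero_two_mul (n : ℕ) : (1 : ZMod (2 * n)) ≠ 0 := fun h0 => by
  have h2 : 2 * n ∣ 1 := (ZMod.natCast_eq_zero_iff 1 (2 * n)).1 (by exact_mod_cast h0)
  have := Nat.dvd_one.1 h2
  omega

lemma ZMod.two_ne_zero_two_mul {n : ℕ} (hn : 2 ≤ n) : (1 : ZMod (2 * n)) + 1 ≠ 0 := fun h0 => by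
  have h2 : 2 * n ∣ 2 := (ZMod.natCast_eq_zero_iff 2 (2 * n)).1 (by push_cast; rw [← h0]; ring)
  have := Nat.le_of_dvd (by norm_num) h2
  omega

lemma absGradient_toSym2 {n : ℕ} (φ : TorusVertex n → ℝ) (d : DirEdge n) :
    absGradient φ d.toSym2 = |edgeGrad φ d| := rfl

lemma torus_adj_iff {n : ℕ} {v w : TorusVertex n} :
    (torus n).Adj v w ↔ ∃ b, w = v + dirVec n b ∨ v = w + dirVec n b := by
  obtain ⟨v1, v2⟩ := v
  obtain ⟨w1, w2⟩ := w
  simp only [torus, dirVec, Bool.exists_bool, Prod.ext_iff]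
  constructor
  · rintro (⟨h1, h2 | h2⟩ | ⟨h1, h2 | h2⟩)
    · right; right; simp [h1, ← h2]
    · right; left; simp [h1, ← h2]
    · left; right; simp [h1, ← h2]
    · left; left; simp [h1, ← h2]
  · rintro ((h | h) | (h | h)) <;> simp at h <;> simp [h]

lemma DirEdge.toSym2_mem {n : ℕ} (d : DirEdge n) : d.toSym2 ∈ (torus n).edgeSet :=
  torus_adj_iff.2 ⟨d.2, Or.inl rfl⟩

lemma DirEdge.toSym2_injective {n : ℕ} (hn : 2 ≤ n) :
    Function.Injective (DirEdge.toSym2 (n := n)) := by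
  have h1 := ZMod.one_ne_zero_two_mul n
  have h2 := ZMod.two_ne_zero_two_mul hn
  rintro ⟨v, a⟩ ⟨w, b⟩ h
  simp only [DirEdge.toSym2, Sym2.eq_iff] at h
  rcases h with ⟨rfl, h⟩ | ⟨h, h'⟩
  · rw [add_right_inj] at h
    cases a <;> cases b <;> simp_all [dirVec]
  · rw [h, add_assoc] at h'
    cases a <;> cases b <;> simp_all [dirVec]

lemma DirEdge.image_toSym2 {n : ℕ} [NeZero n] :
    (Finset.univ : Finset (DirEdge n)).image DirEdge.toSym2 = (torus n).edgeFinset := by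
  ext e
  simp only [Finset.mem_image, Finset.mem_univ, true_and, SimpleGraph.mem_edgeFinset]
  constructor
  · rintro ⟨d, rfl⟩
    exact d.toSym2_mem
  · induction e with
    | _ v w =>
      intro h
      obtain ⟨b, h | h⟩ := torus_adj_iff.1 h
      · exact ⟨(v, b), by rw [show w = v + dirVec n b from h]; rfl⟩
      · exact ⟨(w, b), by rw [show v = w + dirVec n b from h, Sym2.eq_swap]; rfl⟩

namespace Potential

/-- The Boltzmann factor `exp(-U)`. -/
noncomputable def boltzmann (U : Potential) (x : ℝ) : ℝ≥0∞ := EReal.exp (-U x)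

variable (U : Potential)

lemma boltzmann_neg (x : ℝ) : U.boltzmann (-x) = U.boltzmann x := by
  simp [boltzmann, U.even]

lemma measurable_boltzmann : Measurable U.boltzmann := by
  have h : U.boltzmann = fun x => (EReal.exp (U x))⁻¹ := by
    funext x; simp [boltzmann, EReal.exp_neg]
  rw [h]
  exact (EReal.measurable_exp.comp U.measurable_toFun).inv

lemma boltzmann_ne_top (x : ℝ) : U.boltzmann x ≠ ∞ := by
  simp [boltzmann, U.ne_bot x]

lemma exp_neg_sum {ι : Type*} (s : Finset ι) (f : ι → EReal) (hf : ∀ i ∈ s, f i ≠ ⊥) :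
    EReal.exp (-∑ i ∈ s, f i) = ∏ i ∈ s, EReal.exp (-f i) := by
  classical
  induction s using Finset.induction_on with
  | empty => simp
  | insert i s hi ih =>
    rw [Finset.sum_insert hi, Finset.prod_insert hi,
      ← ih fun j hj => hf j (Finset.mem_insert_of_mem hj), EReal.exp_neg, EReal.exp_add,
      ENNReal.mul_inv, ← EReal.exp_neg, ← EReal.exp_neg]
    · left; simpa using hf i (Finset.mem_insert_self _ _)
    · right
      rw [ne_eq, EReal.exp_eq_zero_iff]
      have : ∀ j ∈ s, f j ≠ ⊥ := fun j hj => hf j (Finset.mem_insert_of_mem hj)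
      clear ih hf hi
      induction s using Finset.induction_on with
      | empty => simp
      | insert j s hj ih =>
        rw [Finset.sum_insert hj]
        simp only [EReal.add_eq_bot_iff, not_or]
        exact ⟨this j (Finset.mem_insert_self _ _),
          ih fun k hk => this k (Finset.mem_insert_of_mem hk)⟩

lemma weight_eq_prod {n : ℕ} [NeZero n] (hn : 2 ≤ n) (φ : TorusVertex n → ℝ) :
    U.weight n φ = ∏ d : DirEdge n, U.boltzmann (edgeGrad φ d) := by
  rw [weight, ← DirEdge.image_toSym2, Finset.sum_image (DirEdge.toSym2_injective hn).injOn]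
  exact exp_neg_sum _ _ fun d _ => U.ne_bot _

end Potential

/-- Lebesgue measure on height functions whose height at `o` lies in `[0,1)`. -/
noncomputable def rootedLebesgue {V : Type*} [Fintype V] (o : V) : Measure (V → ℝ) :=
  volume.restrict {φ | φ o ∈ Set.Ico (0 : ℝ) 1}

/-- Invariance under the addition of constants. -/
def ShiftInvariant {V α : Type*} (F : (V → ℝ) → α) : Prop :=
  ∀ φ t, F (fun v => φ v + t) = F φ

lemma measurableSet_root {V : Type*} (o : V) : MeasurableSet {φ : V → ℝ | φ o ∈ Set.Ico (0 : ℝ) 1} :=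
  measurableSet_Ico.preimage (measurable_pi_apply o)

section Unpin

variable {V : Type*} [Fintype V] {F : (V → ℝ) → ℝ≥0∞}

lemma lmarginal_erase_shiftInvariant [DecidableEq V] (hF : ShiftInvariant F) (o : V) (x : V → ℝ) (t : ℝ) :
    (∫⋯∫⁻_Finset.univ.erase o, F ∂(fun _ => (volume : Measure ℝ))) (Function.update x o t) =
      (∫⋯∫⁻_Finset.univ.erase o, F ∂(fun _ => (volume : Measure ℝ))) (Function.update x o 0) := by
  unfold lmarginal
  rw [← lintegral_add_right_eq_self _ (fun _ => t)]
  refine lintegral_congr fun y => ?_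
  refine Eq.trans ?_ (hF _ t)
  congr 1
  funext v
  by_cases hv : v = o
  · subst hv; simp [Function.updateFinset]
  · simp [Function.updateFinset, hv]

lemma lintegral_dirac_pi_eq [DecidableEq V] (hFm : Measurable F) (hF : ShiftInvariant F) (o : V) :
    ∫⁻ φ, F φ ∂(Measure.pi fun v => if v = o then Measure.dirac (0 : ℝ) else volume) =
      ∫⁻ φ, F φ ∂(rootedLebesgue o) := by
  classical
  have : ∀ v, SigmaFinite (if v = o then Measure.dirac (0 : ℝ) else volume) := by
    intro v; split_ifs <;> infer_instance
  have hset := measurableSet_root o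
  rw [rootedLebesgue, ← lintegral_indicator hset, volume_pi]
  have hind : Measurable ({φ : V → ℝ | φ o ∈ Set.Ico (0 : ℝ) 1}.indicator F) := hFm.indicator hset
  rw [lintegral_eq_lmarginal_univ (fun _ => (0 : ℝ)), lintegral_eq_lmarginal_univ (fun _ => (0 : ℝ)),
    lmarginal_erase _ hFm (Finset.mem_univ o), lmarginal_erase _ hind (Finset.mem_univ o)]
  have h1 : ∀ x, (∫⋯∫⁻_Finset.univ.erase o, F
      ∂(fun v => if v = o then Measure.dirac (0 : ℝ) else volume)) x =
      (∫⋯∫⁻_Finset.univ.erase o, F ∂(fun _ => (volume : Measure ℝ))) x := by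
    intro x
    unfold lmarginal
    congr 2
    funext i
    simp [Finset.ne_of_mem_erase i.2]
  have h2 : ∀ t : ℝ, (∫⋯∫⁻_Finset.univ.erase o,
      {φ : V → ℝ | φ o ∈ Set.Ico (0 : ℝ) 1}.indicator F ∂(fun _ => (volume : Measure ℝ)))
        (Function.update (fun _ => 0) o t) = (Set.Ico (0 : ℝ) 1).indicator (fun _ =>
        (∫⋯∫⁻_Finset.univ.erase o, F ∂(fun _ => (volume : Measure ℝ)))
          (Function.update (fun _ => 0) o 0)) t := by
    intro t
    rw [← lmarginal_erase_shiftInvariant hF o _ t]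
    unfold lmarginal
    by_cases ht : t ∈ Set.Ico (0 : ℝ) 1
    · rw [Set.indicator_of_mem ht]
      refine lintegral_congr fun y => ?_
      rw [Set.indicator_of_mem]
      simpa [Function.updateFinset] using ht
    · rw [Set.indicator_of_notMem ht]
      rw [lintegral_eq_zero_iff' , Filter.EventuallyEq]
      · refine Filter.Eventually.of_forall fun y => ?_
        rw [Set.indicator_of_notMem]
        · rfl
        · simpa [Function.updateFinset] using ht
      · exact (hind.comp measurable_updateFinset).aemeasurable
  simp only [h1, h2]
  rw [if_pos trivial, lintegral_dirac, lintegral_indicator measurableSet_Ico]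
  simp

lemma lintegral_rootedLebesgue_le (hFm : Measurable F) (hF : ShiftInvariant F) (o u : V) :
    ∫⁻ φ, F φ ∂(rootedLebesgue o) ≤ ∫⁻ φ, F φ ∂(rootedLebesgue u) := by
  have ho := measurableSet_root o
  have hu := measurableSet_root u
  have hsum : ∀ x : ℝ, ∑' k : ℤ, (Set.Ico (0 : ℝ) 1).indicator (fun _ => (1 : ℝ≥0∞)) (x + k) = 1 := by
    intro x
    rw [tsum_eq_single (-⌊x⌋)]
    · rw [Set.indicator_of_mem]
      constructor
      · push_cast; linarith [Int.floor_le x]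
      · push_cast; linarith [Int.lt_floor_add_one x]
    · intro k hk
      rw [Set.indicator_of_notMem]
      rintro ⟨h1, h2⟩
      apply hk
      have : ⌊x⌋ = -k := Int.floor_eq_iff.2 ⟨by push_cast; linarith, by push_cast; linarith⟩
      omega
  set g : ℝ → ℝ≥0∞ := (Set.Ico (0 : ℝ) 1).indicator (fun _ => (1 : ℝ≥0∞)) with hg
  have hgm : Measurable g := measurable_const.indicator measurableSet_Ico
  have hr : ∀ w : V, ∫⁻ φ, F φ ∂(rootedLebesgue w) = ∫⁻ φ, F φ * g (φ w) := by
    intro w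
    rw [rootedLebesgue, ← lintegral_indicator (measurableSet_root w)]
    refine lintegral_congr fun φ => ?_
    by_cases h : φ w ∈ Set.Ico (0 : ℝ) 1
    · rw [Set.indicator_of_mem (by exact h), hg, Set.indicator_of_mem h, mul_one]
    · rw [Set.indicator_of_notMem (by exact h), hg, Set.indicator_of_notMem h, mul_zero]
  rw [hr, hr]
  calc ∫⁻ φ, F φ * g (φ o) = ∫⁻ φ, ∑' k : ℤ, F φ * g (φ o) * g (φ u + k) := by
        refine lintegral_congr fun φ => ?_
        rw [ENNReal.tsum_mul_left, hsum, mul_one]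
    _ = ∑' k : ℤ, ∫⁻ φ, F φ * g (φ o) * g (φ u + k) := by
        refine lintegral_tsum fun k => ?_
        fun_prop
    _ = ∑' k : ℤ, ∫⁻ φ, F φ * g (φ o - k) * g (φ u) := by
        congr 1
        funext k
        rw [← lintegral_add_right_eq_self _ (fun _ => -(k : ℝ))]
        refine lintegral_congr fun φ => ?_
        have := hF φ (-(k : ℝ))
        change F (fun v => φ v + -(k : ℝ)) * g (φ o + -(k : ℝ)) * g (φ u + -(k : ℝ) + k) = _
        rw [this]
        simp [sub_eq_add_neg]
    _ = ∫⁻ φ, ∑' k : ℤ, F φ * g (φ o - k) * g (φ u) := by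
        refine (lintegral_tsum fun k => ?_).symm
        fun_prop
    _ = ∫⁻ φ, F φ * g (φ u) := by
        refine lintegral_congr fun φ => ?_
        rw [ENNReal.tsum_mul_right, ENNReal.tsum_mul_left, ← (Equiv.neg ℤ).tsum_eq]
        simp only [Equiv.neg_apply, Int.cast_neg, sub_neg_eq_add, hsum, mul_one]
    _ ≤ _ := le_rfl

lemma lintegral_rootedLebesgue_eq (hFm : Measurable F) (hF : ShiftInvariant F) (o u : V) :
    ∫⁻ φ, F φ ∂(rootedLebesgue o) = ∫⁻ φ, F φ ∂(rootedLebesgue u) :=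
  le_antisymm (lintegral_rootedLebesgue_le hFm hF o u) (lintegral_rootedLebesgue_le hFm hF u o)

lemma lintegral_rootedLebesgue_comp (hFm : Measurable F) (hF : ShiftInvariant F) (o : V)
    (α : Equiv.Perm V) :
    ∫⁻ φ, F (φ ∘ α) ∂(rootedLebesgue o) = ∫⁻ φ, F φ ∂(rootedLebesgue o) := by
  have hmp : MeasurePreserving (MeasurableEquiv.piCongrLeft (fun _ : V => ℝ) α.symm)
      volume volume := volume_measurePreserving_piCongrLeft (fun _ => ℝ) α.symm
  have hcoe : ∀ φ : V → ℝ, MeasurableEquiv.piCongrLeft (fun _ : V => ℝ) α.symm φ = φ ∘ α := by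
    intro φ; funext v
    rw [MeasurableEquiv.coe_piCongrLeft, Equiv.piCongrLeft_apply]
    simp
  rw [lintegral_rootedLebesgue_eq hFm hF o (α.symm o), rootedLebesgue, rootedLebesgue,
    ← lintegral_indicator (measurableSet_root _), ← lintegral_indicator (measurableSet_root _),
    ← hmp.lintegral_comp_emb (MeasurableEquiv.measurableEmbedding _)
      ({φ | φ (α.symm o) ∈ Set.Ico 0 1}.indicator F)]
  refine lintegral_congr fun φ => ?_
  rw [hcoe]
  simp [Set.indicator]

end Unpin

lemma sq_lintegral_mul_mul_le {α : Type*} [MeasurableSpace α] (μ : Measure α) {f h g : α → ℝ≥0∞}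
    (hf : Measurable f) (hh : Measurable h) (hg : Measurable g) :
    (∫⁻ a, f a * h a * g a ∂μ) ^ 2 ≤ (∫⁻ a, f a * f a * g a ∂μ) * ∫⁻ a, h a * h a * g a ∂μ := by
  have key := ENNReal.lintegral_mul_le_Lp_mul_Lq (μ.withDensity g) Real.HolderConjugate.two_two
    hf.aemeasurable hh.aemeasurable
  have conv : ∀ k : α → ℝ≥0∞, Measurable k →
      ∫⁻ a, k a ∂(μ.withDensity g) = ∫⁻ a, k a * g a ∂μ := by
    intro k hk
    rw [lintegral_withDensity_eq_lintegral_mul _ hg hk]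
    simp [mul_comm]
  rw [conv _ (hf.mul hh), conv _ (hf.pow_const _), conv _ (hh.pow_const _)] at key
  simp only [Pi.mul_apply, ENNReal.rpow_ofNat, sq] at key
  calc _ ≤ ((∫⁻ a, f a * f a * g a ∂μ) ^ (1 / 2 : ℝ) *
        (∫⁻ a, h a * h a * g a ∂μ) ^ (1 / 2 : ℝ)) ^ 2 := by gcongr
    _ = _ := by
      rw [mul_pow, ← ENNReal.rpow_natCast, ← ENNReal.rpow_natCast, ← ENNReal.rpow_mul,
        ← ENNReal.rpow_mul]
      norm_num

section Reflection

variable {A B V : Type*}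

/-- Splitting a height function along a decomposition of the vertices into a set and two copies of
another one. -/
noncomputable def piSplit (e : A ⊕ (B ⊕ B) ≃ V) :
    (V → ℝ) ≃ᵐ (A → ℝ) × ((B → ℝ) × (B → ℝ)) :=
  (MeasurableEquiv.piCongrLeft (fun _ : A ⊕ (B ⊕ B) => ℝ) e.symm).trans
    ((MeasurableEquiv.sumPiEquivProdPi (fun _ : A ⊕ (B ⊕ B) => ℝ)).trans
      ((MeasurableEquiv.refl _).prodCongr (MeasurableEquiv.sumPiEquivProdPi (fun _ : B ⊕ B => ℝ))))

lemma measurePreserving_piSplit [Fintype A] [Fintype B] [Fintype V] (e : A ⊕ (B ⊕ B) ≃ V) :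
    MeasurePreserving (piSplit e) volume volume := by
  refine (volume_measurePreserving_piCongrLeft (fun _ : A ⊕ (B ⊕ B) => ℝ) e.symm).trans ?_
  refine (volume_measurePreserving_sumPiEquivProdPi (fun _ : A ⊕ (B ⊕ B) => ℝ)).trans ?_
  exact (MeasurePreserving.id _).prod
    (volume_measurePreserving_sumPiEquivProdPi (fun _ : B ⊕ B => ℝ))

lemma piSplit_symm_apply (e : A ⊕ (B ⊕ B) ≃ V) (a : A → ℝ) (b c : B → ℝ) (v : V) :
    (piSplit e).symm (a, (b, c)) v = Sum.elim a (Sum.elim b c) (e.symm v) := by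
  suffices h : (piSplit e).symm (a, (b, c)) = Sum.elim a (Sum.elim b c) ∘ e.symm by rw [h]; rfl
  rw [MeasurableEquiv.symm_apply_eq]
  have h : MeasurableEquiv.piCongrLeft (fun _ : A ⊕ (B ⊕ B) => ℝ) e.symm
      (Sum.elim a (Sum.elim b c) ∘ e.symm) = Sum.elim a (Sum.elim b c) := by
    funext x
    rw [MeasurableEquiv.coe_piCongrLeft, Equiv.piCongrLeft_apply]
    simp
  simp only [piSplit, MeasurableEquiv.trans_apply, h]
  rfl

/-- Reflection positivity of product measures: a form of the Cauchy–Schwarz inequality. -/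
lemma sq_lintegral_reflection_le [Fintype V] {θ : V → V} (hθ : ∀ v, θ (θ v) = v) (pl : V → Prop)
    (hpl : ∀ v, θ v = v ∨ pl v ∨ pl (θ v)) (hpl' : ∀ v, pl v → ¬ pl (θ v))
    {F H G : (V → ℝ) → ℝ≥0∞} (hFm : Measurable F) (hHm : Measurable H) (hGm : Measurable G)
    (hF : ∀ φ φ' : V → ℝ, (∀ v, θ v = v ∨ pl v → φ v = φ' v) → F φ = F φ')
    (hH : ∀ φ φ' : V → ℝ, (∀ v, θ v = v ∨ pl (θ v) → φ v = φ' v) → H φ = H φ')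
    (hG : ∀ φ φ' : V → ℝ, (∀ v, θ v = v → φ v = φ' v) → G φ = G φ') :
    (∫⁻ φ, F φ * H φ * G φ) ^ 2 ≤
      (∫⁻ φ, F φ * F (φ ∘ θ) * G φ) * ∫⁻ φ, H φ * H (φ ∘ θ) * G φ := by
  classical
  let A := {v : V // θ v = v}
  let B := {v : V // pl v}
  let j : A ⊕ (B ⊕ B) → V := Sum.elim (fun a => a) (Sum.elim (fun b => b) (fun b => θ b))
  have hj : Function.Bijective j := by
    constructor
    · rintro (⟨a, ha⟩ | ⟨b, hb⟩ | ⟨c, hc⟩) (⟨a', ha'⟩ | ⟨b', hb'⟩ | ⟨c', hc'⟩) h <;>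
        simp only [j, Sum.elim_inl, Sum.elim_inr] at h
      · simp [h]
      · subst h; exact absurd (ha.symm ▸ hb') (hpl' _ hb')
      · subst h; rw [hθ] at ha; exact absurd (ha ▸ hc') (hpl' _ hc')
      · subst h; exact absurd (ha'.symm ▸ hb) (hpl' _ hb)
      · simp [h]
      · subst h; exact absurd hb (hpl' _ hc')
      · subst h; rw [hθ] at ha'; exact absurd (ha' ▸ hc) (hpl' _ hc)
      · subst h; exact absurd hb' (hpl' _ hc)
      · have := congrArg θ h
        rw [hθ, hθ] at this
        simp [this]
    · intro v
      rcases hpl v with h | h | h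
      · exact ⟨Sum.inl ⟨v, h⟩, rfl⟩
      · exact ⟨Sum.inr (Sum.inl ⟨v, h⟩), rfl⟩
      · exact ⟨Sum.inr (Sum.inr ⟨θ v, h⟩), hθ v⟩
  let e : A ⊕ (B ⊕ B) ≃ V := Equiv.ofBijective j hj
  let S := (piSplit e).symm
  have hS : ∀ a b c x, S (a, (b, c)) (j x) = Sum.elim a (Sum.elim b c) x := by
    intro a b c x
    rw [piSplit_symm_apply]
    congr 1
    exact e.symm_apply_apply x
  have hA : ∀ a b c (v : A), S (a, (b, c)) v = a v := fun a b c v => hS a b c (Sum.inl v)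
  have hB : ∀ a b c (v : B), S (a, (b, c)) v = b v := fun a b c v => hS a b c (Sum.inr (Sum.inl v))
  have hC : ∀ a b c (v : B), S (a, (b, c)) (θ v) = c v :=
    fun a b c v => hS a b c (Sum.inr (Sum.inr v))
  have hswap : ∀ a b c, S (a, (b, c)) ∘ θ = S (a, (c, b)) := by
    intro a b c
    funext v
    simp only [Function.comp]
    rcases hpl v with h | h | h
    · rw [h]; exact (hA a b c ⟨v, h⟩).trans (hA a c b ⟨v, h⟩).symm
    · exact (hC a b c ⟨v, h⟩).trans (hB a c b ⟨v, h⟩).symm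
    · have := hC a c b ⟨θ v, h⟩
      simp only [hθ] at this
      exact (hB a b c ⟨θ v, h⟩).trans this.symm
  have eF : ∀ a b c c', F (S (a, (b, c))) = F (S (a, (b, c'))) := by
    intro a b c c'
    refine hF _ _ fun v hv => ?_
    rcases hv with hv | hv
    · exact (hA a b c ⟨v, hv⟩).trans (hA a b c' ⟨v, hv⟩).symm
    · exact (hB a b c ⟨v, hv⟩).trans (hB a b c' ⟨v, hv⟩).symm
  have eH : ∀ a b b' c, H (S (a, (b, c))) = H (S (a, (b', c))) := by
    intro a b b' c
    refine hH _ _ fun v hv => ?_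
    rcases hv with hv | hv
    · exact (hA a b c ⟨v, hv⟩).trans (hA a b' c ⟨v, hv⟩).symm
    · have h1 := hC a b c ⟨θ v, hv⟩
      have h2 := hC a b' c ⟨θ v, hv⟩
      simp only [hθ] at h1 h2
      exact h1.trans h2.symm
  have eG : ∀ a b b' c c', G (S (a, (b, c))) = G (S (a, (b', c'))) := by
    intro a b b' c c'
    exact hG _ _ fun v hv => (hA a b c ⟨v, hv⟩).trans (hA a b' c' ⟨v, hv⟩).symm
  have hSm : Measurable S := (piSplit e).symm.measurable
  let f : (A → ℝ) → (B → ℝ) → ℝ≥0∞ := fun a b => F (S (a, (b, 0)))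
  let h : (A → ℝ) → (B → ℝ) → ℝ≥0∞ := fun a c => H (S (a, (0, c)))
  let g : (A → ℝ) → ℝ≥0∞ := fun a => G (S (a, (0, 0)))
  have hfm : Measurable (Function.uncurry f) := by
    change Measurable fun p : (A → ℝ) × (B → ℝ) => F (S (p.1, (p.2, 0)))
    fun_prop
  have hhm : Measurable (Function.uncurry h) := by
    change Measurable fun p : (A → ℝ) × (B → ℝ) => H (S (p.1, (0, p.2)))
    fun_prop
  have hgm : Measurable g := by
    change Measurable fun p : (A → ℝ) => G (S (p, (0, 0)))
    fun_prop
  have key : ∀ u w : (A → ℝ) → (B → ℝ) → ℝ≥0∞, Measurable (Function.uncurry u) →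
      Measurable (Function.uncurry w) → ∀ X : (V → ℝ) → ℝ≥0∞, Measurable X →
      (∀ a b c, X (S (a, (b, c))) = u a b * w a c * g a) →
      ∫⁻ φ, X φ = ∫⁻ a, (∫⁻ b, u a b) * (∫⁻ c, w a c) * g a := by
    intro u w hu hw X hX hXS
    rw [← (measurePreserving_piSplit e).symm.lintegral_comp hX, Measure.volume_eq_prod, lintegral_prod]
    · refine lintegral_congr fun a => ?_
      have hu' : Measurable (u a) := hu.of_uncurry_left
      have hw' : Measurable (w a) := hw.of_uncurry_left
      rw [Measure.volume_eq_prod, lintegral_prod]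
      · change ∫⁻ b, ∫⁻ c, X (S (a, (b, c))) = _
        simp only [hXS]
        simp_rw [mul_assoc]
        simp_rw [lintegral_const_mul _ (hw'.mul_const _), lintegral_mul_const _ hw']
        rw [lintegral_mul_const _ hu']
      · exact (hX.comp (hSm.comp (measurable_const.prodMk measurable_id))).aemeasurable
    · exact (hX.comp hSm).aemeasurable
  have hθm : Measurable fun φ : V → ℝ => φ ∘ θ :=
    measurable_pi_lambda _ fun v => measurable_pi_apply (θ v)
  rw [key f h hfm hhm (fun φ => F φ * H φ * G φ) ((hFm.mul hHm).mul hGm)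
      (fun a b c => by simp only [f, h, g]; rw [eF a b c 0, eH a b 0 c, eG a b 0 c 0]),
    key f f hfm hfm (fun φ => F φ * F (φ ∘ θ) * G φ) ((hFm.mul (hFm.comp hθm)).mul hGm)
      (fun a b c => by simp only [f, g, hswap]; rw [eF a b c 0, eF a c b 0, eG a b 0 c 0]),
    key h h hhm hhm (fun φ => H φ * H (φ ∘ θ) * G φ) ((hHm.mul (hHm.comp hθm)).mul hGm)
      (fun a b c => by
        simp only [h, g, hswap]
        rw [eH a b 0 c, eH a c 0 b, eG a b 0 c 0, mul_comm (H (S (a, (0, c))))])]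
  exact sq_lintegral_mul_mul_le _ hfm.lintegral_prod_right' hhm.lintegral_prod_right' hgm

end Reflection

/-- The integral of a product of functions of the gradients over height functions modulo
constants. -/
noncomputable def edgeIntegral (n : ℕ) [NeZero n] (q : DirEdge n → ℝ → ℝ≥0∞) : ℝ≥0∞ :=
  ∫⁻ φ, ∏ d, q d (edgeGrad φ d) ∂(rootedLebesgue (0 : TorusVertex n))

lemma measurable_edgeGrad {n : ℕ} (d : DirEdge n) :
    Measurable fun φ : TorusVertex n → ℝ => edgeGrad φ d :=
  (measurable_pi_apply _).sub (measurable_pi_apply _)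

lemma edgeGrad_add_const {n : ℕ} (φ : TorusVertex n → ℝ) (t : ℝ) (d : DirEdge n) :
    edgeGrad (fun v => φ v + t) d = edgeGrad φ d := by
  simp [edgeGrad]

section

variable {n : ℕ} [NeZero n] {q : DirEdge n → ℝ → ℝ≥0∞}

lemma measurable_prod_edgeGrad (hq : ∀ d, Measurable (q d)) :
    Measurable fun φ : TorusVertex n → ℝ => ∏ d, q d (edgeGrad φ d) :=
  Finset.measurable_fun_prod _ fun d _ => (hq d).comp (measurable_edgeGrad d)

lemma shiftInvariant_prod_edgeGrad (q : DirEdge n → ℝ → ℝ≥0∞) :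
    ShiftInvariant fun φ : TorusVertex n → ℝ => ∏ d, q d (edgeGrad φ d) := by
  intro φ t
  simp only [edgeGrad_add_const]

lemma edgeIntegral_translate (hq : ∀ d, Measurable (q d)) (t : TorusVertex n) :
    edgeIntegral n (fun d => q (d.1 + t, d.2)) = edgeIntegral n q := by
  rw [edgeIntegral, edgeIntegral, ← lintegral_rootedLebesgue_comp
    (measurable_prod_edgeGrad fun d => hq _) (shiftInvariant_prod_edgeGrad _) 0 (Equiv.addRight t)]
  refine lintegral_congr fun φ => ?_
  rw [← ((Equiv.addRight t).prodCongr (Equiv.refl Bool)).prod_comp fun d => q d (edgeGrad φ d)]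
  refine Finset.prod_congr rfl fun d _ => ?_
  obtain ⟨v, b⟩ := d
  simp [edgeGrad, add_right_comm]

lemma edgeIntegral_transpose (hq : ∀ d, Measurable (q d)) :
    edgeIntegral n (fun d => q (d.1.swap, !d.2)) = edgeIntegral n q := by
  rw [edgeIntegral, edgeIntegral, ← lintegral_rootedLebesgue_comp
    (measurable_prod_edgeGrad fun d => hq _) (shiftInvariant_prod_edgeGrad _) 0
      (Equiv.prodComm _ _)]
  refine lintegral_congr fun φ => ?_
  rw [← ((Equiv.prodComm _ _).prodCongr Equiv.boolNot).prod_comp fun d => q d (edgeGrad φ d)]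
  refine Finset.prod_congr rfl fun d _ => ?_
  obtain ⟨⟨x, y⟩, b⟩ := d
  cases b <;> simp [edgeGrad, dirVec]

/-- The reflection of the torus in the lines `x = 0` and `x = n`. -/
def reflVertex (v : TorusVertex n) : TorusVertex n := (-v.1, v.2)

/-- The action of the reflection on edges. -/
def reflEdge (d : DirEdge n) : DirEdge n :=
  if d.2 then ((-d.1.1, d.1.2), true) else ((-1 - d.1.1, d.1.2), false)

/-- The edges on the positive side of the reflection lines. -/
def posEdge (d : DirEdge n) : Prop :=
  if d.2 then 0 < d.1.1.val ∧ d.1.1.val < n else d.1.1.val < n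

instance : DecidablePred (posEdge (n := n)) := fun d => by
  unfold posEdge; infer_instance

lemma reflEdge_reflEdge (d : DirEdge n) : reflEdge (reflEdge d) = d := by
  obtain ⟨⟨x, y⟩, b⟩ := d
  cases b <;> simp [reflEdge]

lemma ZMod.val_neg_one_sub (x : ZMod (2 * n)) : (-1 - x).val = 2 * n - 1 - x.val := by
  have hx := ZMod.val_lt x
  have h : (-1 - x) = ((2 * n - 1 - x.val : ℕ) : ZMod (2 * n)) := by
    rw [Nat.sub_sub, Nat.cast_sub (by omega)]
    have : ((2 * n : ℕ) : ZMod (2 * n)) = 0 := ZMod.natCast_self _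
    rw [this, Nat.cast_add, ZMod.natCast_zmod_val]
    push_cast
    ring
  rw [h, ZMod.val_natCast_of_lt (by omega)]

lemma ZMod.neg_eq_self_iff_val (x : ZMod (2 * n)) : -x = x ↔ x.val = 0 ∨ x.val = n := by
  have hx := ZMod.val_lt x
  have hn := NeZero.ne n
  rw [← (ZMod.val_injective (2 * n)).eq_iff, ZMod.neg_val]
  split_ifs with h
  · simp [h]
  · have : x.val ≠ 0 := by rwa [ne_eq, ZMod.val_eq_zero]
    omega

lemma ZMod.val_add_one_two_mul (x : ZMod (2 * n)) :
    (x + 1).val = if x.val + 1 = 2 * n then 0 else x.val + 1 := by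
  have hx := ZMod.val_lt x
  have h : x + 1 = ((x.val + 1 : ℕ) : ZMod (2 * n)) := by
    rw [Nat.cast_add, ZMod.natCast_zmod_val]; simp
  rw [h, ZMod.val_natCast]
  split_ifs with h1
  · rw [h1, Nat.mod_self]
  · exact Nat.mod_eq_of_lt (by omega)

lemma reflEdge_cases (d : DirEdge n) :
    (reflEdge d = d ∧ ¬ posEdge d ∧ ¬ posEdge (reflEdge d)) ∨
      (reflEdge d ≠ d ∧ posEdge d ∧ ¬ posEdge (reflEdge d)) ∨
      (reflEdge d ≠ d ∧ ¬ posEdge d ∧ posEdge (reflEdge d)) := by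
  obtain ⟨⟨x, y⟩, b⟩ := d
  have hx := ZMod.val_lt x
  have hn := NeZero.ne n
  cases b
  · have h1 := ZMod.val_neg_one_sub x
    have h2 : -1 - x ≠ x := by
      intro h; rw [h] at h1; omega
    simp only [reflEdge, posEdge, Bool.false_eq_true, if_false, h1, ne_eq, Prod.mk.injEq, h2,
      false_and, not_false_eq_true, true_and, false_or]
    omega
  · have h1 := ZMod.neg_eq_self_iff_val x
    have h2 := ZMod.neg_val x
    simp only [reflEdge, posEdge, if_true, Prod.mk.injEq, and_true, ne_eq, h1, h2]
    split_ifs with h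
    · subst h; simp
    · have : x.val ≠ 0 := by rwa [ne_eq, ZMod.val_eq_zero]
      omega

lemma edgeGrad_comp_reflVertex (φ : TorusVertex n → ℝ) (d : DirEdge n) :
    edgeGrad (φ ∘ reflVertex) d = edgeGrad φ (reflEdge d) ∨
      edgeGrad (φ ∘ reflVertex) d = - edgeGrad φ (reflEdge d) := by
  obtain ⟨⟨x, y⟩, b⟩ := d
  cases b
  · right
    simp [edgeGrad, reflVertex, reflEdge, dirVec, sub_eq_add_neg, add_comm]
  · left
    simp [edgeGrad, reflVertex, reflEdge, dirVec]

/-- The vertices strictly on the positive side of the reflection lines. -/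
def posVertex (v : TorusVertex n) : Prop := 0 < v.1.val ∧ v.1.val < n

lemma reflVertex_eq_self_iff (v : TorusVertex n) :
    reflVertex v = v ↔ v.1.val = 0 ∨ v.1.val = n := by
  rw [← ZMod.neg_eq_self_iff_val]
  simp [reflVertex, Prod.ext_iff]

lemma posVertex_reflVertex_iff (v : TorusVertex n) : posVertex (reflVertex v) ↔ n < v.1.val := by
  have hv := ZMod.val_lt v.1
  simp only [posVertex, reflVertex, ZMod.neg_val]
  split_ifs with h
  · simp [h]
  · omega

lemma posEdge.endpoints {d : DirEdge n} (hd : posEdge d) :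
    (reflVertex d.1 = d.1 ∨ posVertex d.1) ∧
      (reflVertex (d.1 + dirVec n d.2) = d.1 + dirVec n d.2 ∨ posVertex (d.1 + dirVec n d.2)) := by
  obtain ⟨⟨x, y⟩, b⟩ := d
  have hx := ZMod.val_lt x
  cases b
  · have h1 := ZMod.val_add_one_two_mul x
    simp only [posEdge, Bool.false_eq_true, if_false] at hd
    simp only [reflVertex_eq_self_iff, posVertex, dirVec, Bool.false_eq_true, if_false,
      Prod.mk_add_mk, h1]
    split_ifs <;> omega
  · simp only [posEdge, if_true] at hd
    simp only [reflVertex_eq_self_iff, posVertex, dirVec, if_true, Prod.mk_add_mk, add_zero]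
    omega

lemma posEdge.endpoints_reflEdge {d : DirEdge n} (hd : posEdge (reflEdge d)) :
    (reflVertex d.1 = d.1 ∨ posVertex (reflVertex d.1)) ∧
      (reflVertex (d.1 + dirVec n d.2) = d.1 + dirVec n d.2 ∨
        posVertex (reflVertex (d.1 + dirVec n d.2))) := by
  obtain ⟨⟨x, y⟩, b⟩ := d
  have hx := ZMod.val_lt x
  cases b
  · have h1 := ZMod.val_add_one_two_mul x
    simp only [posEdge, reflEdge, Bool.false_eq_true, if_false, ZMod.val_neg_one_sub] at hd
    simp only [reflVertex_eq_self_iff, posVertex_reflVertex_iff, dirVec, Bool.false_eq_true,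
      if_false, Prod.mk_add_mk, h1]
    split_ifs <;> omega
  · have h3 := posVertex_reflVertex_iff (x, y)
    simp only [posVertex, reflVertex] at h3
    simp only [posEdge, reflEdge, if_true, h3] at hd
    simp only [reflVertex_eq_self_iff, posVertex_reflVertex_iff, dirVec, if_true, Prod.mk_add_mk,
      add_zero]
    omega

lemma reflVertex_endpoints {d : DirEdge n} (hd : reflEdge d = d) :
    reflVertex d.1 = d.1 ∧ reflVertex (d.1 + dirVec n d.2) = d.1 + dirVec n d.2 := by
  obtain ⟨⟨x, y⟩, b⟩ := d
  have hx := ZMod.val_lt x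
  cases b
  · have h1 := ZMod.val_neg_one_sub x
    simp only [reflEdge, Bool.false_eq_true, if_false, Prod.mk.injEq, and_true] at hd
    rw [hd] at h1
    omega
  · simp only [reflEdge, if_true, Prod.mk.injEq, and_true] at hd
    simp [reflVertex, dirVec, hd]

lemma prod_ite_posEdge (a b c : DirEdge n → ℝ≥0∞) :
    (∏ d, if posEdge d then a d else 1) * (∏ d, if posEdge (reflEdge d) then b d else 1) *
      (∏ d, if reflEdge d = d then c d else 1) =
    ∏ d, if posEdge d then a d else if posEdge (reflEdge d) then b d else c d := by
  rw [← Finset.prod_mul_distrib, ← Finset.prod_mul_distrib]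
  refine Finset.prod_congr rfl fun d _ => ?_
  rcases reflEdge_cases d with ⟨h1, h2, h3⟩ | ⟨h1, h2, h3⟩ | ⟨h1, h2, h3⟩
  · rw [if_neg h2, if_neg h3, if_pos h1, if_neg h2, if_neg h3, one_mul, one_mul]
  · rw [if_pos h2, if_neg h3, if_neg h1, if_pos h2, mul_one, mul_one]
  · rw [if_neg h2, if_pos h3, if_neg h1, if_neg h2, if_pos h3, one_mul, mul_one]

/-- Reflection positivity: the square of an edge integral is bounded by the product of those
obtained by reflecting either half of the torus onto the other. -/
lemma sq_edgeIntegral_le (hq : ∀ d, Measurable (q d)) (heven : ∀ d x, q d (-x) = q d x) :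
    edgeIntegral n q ^ 2 ≤
      edgeIntegral n (fun d => if posEdge (reflEdge d) then q (reflEdge d) else q d) *
      edgeIntegral n (fun d => if posEdge d then q (reflEdge d) else q d) := by
  let I : (TorusVertex n → ℝ) → ℝ≥0∞ :=
    {φ : TorusVertex n → ℝ | φ 0 ∈ Set.Ico (0 : ℝ) 1}.indicator 1
  have hI : Measurable I := measurable_one.indicator (measurableSet_root _)
  have hint : ∀ q' : DirEdge n → ℝ → ℝ≥0∞,
      edgeIntegral n q' = ∫⁻ φ, (∏ d, q' d (edgeGrad φ d)) * I φ := by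
    intro q'
    rw [edgeIntegral, rootedLebesgue, ← lintegral_indicator (measurableSet_root _)]
    refine lintegral_congr fun φ => ?_
    simp [I, Set.indicator]
  have hm : ∀ (P : DirEdge n → Prop) [DecidablePred P], Measurable fun φ : TorusVertex n → ℝ =>
      ∏ d, if P d then q d (edgeGrad φ d) else 1 := by
    intro P _
    refine Finset.measurable_fun_prod _ fun d _ => ?_
    split_ifs
    · exact (hq d).comp (measurable_edgeGrad d)
    · exact measurable_const
  have hdep : ∀ (P : DirEdge n → Prop) [DecidablePred P] (Q : TorusVertex n → Prop),
      (∀ d, P d → Q d.1 ∧ Q (d.1 + dirVec n d.2)) → ∀ φ φ' : TorusVertex n → ℝ,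
      (∀ v, Q v → φ v = φ' v) → (∏ d, if P d then q d (edgeGrad φ d) else 1) =
        ∏ d, if P d then q d (edgeGrad φ' d) else 1 := by
    intro P _ Q hPQ φ φ' h
    refine Finset.prod_congr rfl fun d _ => ?_
    split_ifs with hd
    · rw [edgeGrad, edgeGrad, h _ (hPQ d hd).1, h _ (hPQ d hd).2]
    · rfl
  have hθ : ∀ v : TorusVertex n, reflVertex (reflVertex v) = v := by simp [reflVertex]
  have hrq : ∀ (φ : TorusVertex n → ℝ) d,
      q d (edgeGrad (φ ∘ reflVertex) d) = q d (edgeGrad φ (reflEdge d)) := by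
    intro φ d
    rcases edgeGrad_comp_reflVertex φ d with h | h <;> rw [h]
    rw [heven]
  let r : Equiv.Perm (DirEdge n) := Function.Involutive.toPerm reflEdge reflEdge_reflEdge
  have hprod : ∀ (P : DirEdge n → Prop) [DecidablePred P] (φ : TorusVertex n → ℝ),
      (∏ d, if P d then q d (edgeGrad (φ ∘ reflVertex) d) else 1) =
        ∏ d, if P (reflEdge d) then q (reflEdge d) (edgeGrad φ d) else 1 := by
    intro P _ φ
    rw [← Equiv.prod_comp r]
    refine Finset.prod_congr rfl fun d _ => ?_
    change (if P (reflEdge d) then q (reflEdge d) (edgeGrad (φ ∘ reflVertex) (reflEdge d)) else 1)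
      = _
    rw [hrq, reflEdge_reflEdge]
  have main := sq_lintegral_reflection_le hθ posVertex
    (fun v => by
      rw [reflVertex_eq_self_iff, posVertex_reflVertex_iff]
      have := ZMod.val_lt v.1
      simp only [posVertex]; omega)
    (fun v h => by rw [posVertex_reflVertex_iff]; exact not_lt.2 h.2.le)
    (F := fun φ => ∏ d, if posEdge d then q d (edgeGrad φ d) else 1)
    (H := fun φ => ∏ d, if posEdge (reflEdge d) then q d (edgeGrad φ d) else 1)
    (G := fun φ => (∏ d, if reflEdge d = d then q d (edgeGrad φ d) else 1) * I φ)
    (hm _) (hm _) ((hm _).mul hI)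
    (hdep _ _ fun d hd => hd.endpoints)
    (hdep _ _ fun d hd => hd.endpoints_reflEdge)
    (by
      intro φ φ' h
      have h0 : I φ = I φ' := by
        have h0 := h 0 ((reflVertex_eq_self_iff 0).2 (Or.inl (by simp)))
        simp [I, Set.indicator, h0]
      rw [h0, hdep (fun d => reflEdge d = d) _ (fun d hd => reflVertex_endpoints hd) φ φ' h])
  rw [hint, hint, hint]
  refine le_of_eq_of_le ?_ (main.trans_eq ?_)
  · congr 1
    refine lintegral_congr fun φ => ?_
    rw [← mul_assoc, prod_ite_posEdge]
    congr 1
    refine Finset.prod_congr rfl fun d _ => ?_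
    split_ifs <;> rfl
  · congr 1
    · refine lintegral_congr fun φ => ?_
      rw [← mul_assoc, hprod, prod_ite_posEdge]
      congr 1
      refine Finset.prod_congr rfl fun d _ => ?_
      rcases reflEdge_cases d with ⟨h1, h2, h3⟩ | ⟨h1, h2, h3⟩ | ⟨h1, h2, h3⟩ <;> simp [h2, h3]
    · refine lintegral_congr fun φ => ?_
      rw [← mul_assoc, hprod, mul_comm (∏ d, if posEdge (reflEdge d) then _ else _)]
      simp only [reflEdge_reflEdge]
      rw [prod_ite_posEdge]
      congr 1
      refine Finset.prod_congr rfl fun d _ => ?_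
      rcases reflEdge_cases d with ⟨h1, h2, h3⟩ | ⟨h1, h2, h3⟩ | ⟨h1, h2, h3⟩ <;> simp [h2, h3]

end

section Chessboard

lemma ZMod.val_neg_natCast {n k : ℕ} (h0 : 0 < k) (hk : k < 2 * n) :
    (-(k : ZMod (2 * n))).val = 2 * n - k := by
  have h : -(k : ZMod (2 * n)) = ((2 * n - k : ℕ) : ZMod (2 * n)) := by
    rw [Nat.cast_sub hk.le, ZMod.natCast_self, zero_sub]
  rw [h, ZMod.val_natCast_of_lt (by omega)]

variable {n : ℕ} [NeZero n]

/-- The translate of a set of edges by `-t`. -/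
def translateEdges (t : TorusVertex n) (S : Finset (DirEdge n)) : Finset (DirEdge n) :=
  Finset.univ.filter fun d => (d.1 + t, d.2) ∈ S

/-- The image of a set of edges under the exchange of the coordinates. -/
def transposeEdges (S : Finset (DirEdge n)) : Finset (DirEdge n) :=
  Finset.univ.filter fun d => (d.1.swap, !d.2) ∈ S

/-- The positive half of a set of edges together with its mirror image. -/
def posDouble (S : Finset (DirEdge n)) : Finset (DirEdge n) :=
  Finset.univ.filter fun d => if posEdge (reflEdge d) then reflEdge d ∈ S else d ∈ S

/-- The negative half of a set of edges together with its mirror image. -/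
def negDouble (S : Finset (DirEdge n)) : Finset (DirEdge n) :=
  Finset.univ.filter fun d => if posEdge d then reflEdge d ∈ S else d ∈ S

@[simp] lemma mem_translateEdges {t : TorusVertex n} {S : Finset (DirEdge n)} {d : DirEdge n} :
    d ∈ translateEdges t S ↔ (d.1 + t, d.2) ∈ S := by simp [translateEdges]

@[simp] lemma mem_transposeEdges {S : Finset (DirEdge n)} {d : DirEdge n} :
    d ∈ transposeEdges S ↔ (d.1.swap, !d.2) ∈ S := by simp [transposeEdges]

lemma mem_posDouble {S : Finset (DirEdge n)} {d : DirEdge n} :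
    d ∈ posDouble S ↔ if posEdge (reflEdge d) then reflEdge d ∈ S else d ∈ S := by
  simp [posDouble]

lemma mem_negDouble {S : Finset (DirEdge n)} {d : DirEdge n} :
    d ∈ negDouble S ↔ if posEdge d then reflEdge d ∈ S else d ∈ S := by
  simp [negDouble]

lemma card_translateEdges (t : TorusVertex n) (S : Finset (DirEdge n)) :
    (translateEdges t S).card = S.card :=
  Finset.card_equiv ((Equiv.addRight t).prodCongr (Equiv.refl Bool)) fun ⟨v, b⟩ => by simp

lemma card_transposeEdges (S : Finset (DirEdge n)) : (transposeEdges S).card = S.card :=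
  Finset.card_equiv ((Equiv.prodComm _ _).prodCongr Equiv.boolNot) fun ⟨v, b⟩ => by simp

lemma card_posDouble_add_card_negDouble (S : Finset (DirEdge n)) :
    (posDouble S).card + (negDouble S).card = 2 * S.card := by
  have hS : S.card = ∑ d : DirEdge n, if d ∈ S then 1 else 0 := by simp
  have hS' : S.card = ∑ d : DirEdge n, if reflEdge d ∈ S then 1 else 0 := by
    rw [hS]
    exact (Equiv.sum_comp (Function.Involutive.toPerm reflEdge reflEdge_reflEdge)
      fun d => if d ∈ S then 1 else 0).symm
  rw [two_mul]
  nth_rewrite 2 [hS']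
  rw [hS, posDouble, negDouble, Finset.card_filter, Finset.card_filter, ← Finset.sum_add_distrib,
    ← Finset.sum_add_distrib]
  refine Finset.sum_congr rfl fun d _ => ?_
  rcases reflEdge_cases d with ⟨h1, h2, h3⟩ | ⟨h1, h2, h3⟩ | ⟨h1, h2, h3⟩
  · simp only [h2, if_false, h1]
  · simp only [h2, h3, if_true, if_false]
  · simp only [h2, h3, if_true, if_false, add_comm]

/-- Functions of sets of edges which satisfy the conclusion of reflection positivity and have the
symmetries of the torus. -/
structure IsReflectionPositive (p : Finset (DirEdge n) → ℝ) : Prop where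
  nonneg : ∀ S, 0 ≤ p S
  translate : ∀ t S, p (translateEdges t S) = p S
  transpose : ∀ S, p (transposeEdges S) = p S
  sq_le : ∀ S, p S ^ 2 ≤ p (posDouble S) * p (negDouble S)

namespace IsReflectionPositive

variable {p : Finset (DirEdge n) → ℝ} {M : ℝ} {S : Finset (DirEdge n)}

lemma negDouble_extremal (hp : IsReflectionPositive p) (hM : 0 < M) (hpM : ∀ S, p S ≤ M ^ S.card)
    (hS : M ^ S.card ≤ p S) : M ^ (negDouble S).card ≤ p (negDouble S) := by
  have h1 : M ^ (posDouble S).card * M ^ (negDouble S).card ≤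
      M ^ (posDouble S).card * p (negDouble S) := by
    rw [← pow_add, card_posDouble_add_card_negDouble, mul_comm, pow_mul]
    calc (M ^ S.card) ^ 2 ≤ p S ^ 2 := by gcongr
      _ ≤ _ := hp.sq_le S
      _ ≤ _ := mul_le_mul_of_nonneg_right (hpM _) (hp.nonneg _)
  exact le_of_mul_le_mul_left h1 (by positivity)

lemma translate_extremal (hp : IsReflectionPositive p) (hS : M ^ S.card ≤ p S)
    (t : TorusVertex n) : M ^ (translateEdges t S).card ≤ p (translateEdges t S) := by
  rwa [card_translateEdges, hp.translate]

lemma transpose_extremal (hp : IsReflectionPositive p) (hS : M ^ S.card ≤ p S) :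
    M ^ (transposeEdges S).card ≤ p (transposeEdges S) := by
  rwa [card_transposeEdges, hp.transpose]

lemma exists_double_run (hp : IsReflectionPositive p) (hM : 0 < M)
    (hpM : ∀ S, p S ≤ M ^ S.card) (hS : M ^ S.card ≤ p S) {k : ℕ} (hk : k ≤ n)
    (hrun : ∀ a : ℕ, a < k → (((a : ZMod (2 * n)), (0 : ZMod (2 * n))), false) ∈ S) :
    ∃ S', M ^ S'.card ≤ p S' ∧ ∀ a : ℕ, a < 2 * k → (((a : ZMod (2 * n)), (0 : ZMod (2 * n))), false) ∈ S' := by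
  have h1 := hp.negDouble_extremal hM hpM (hp.translate_extremal hS ((k : ZMod (2 * n)), (0 : ZMod (2 * n))))
  refine ⟨_, hp.translate_extremal h1 (-((k : ZMod (2 * n)), (0 : ZMod (2 * n)))), fun a ha => ?_⟩
  rw [mem_translateEdges, mem_negDouble]
  have hn := NeZero.ne n
  rcases lt_or_ge a k with hak | hak
  · have e : ((a : ZMod (2 * n)), (0 : ZMod (2 * n))) + -((k : ZMod (2 * n)), 0) =
        (-((k - a : ℕ) : ZMod (2 * n)), 0) := by
      rw [Nat.cast_sub hak.le]; simp [sub_eq_add_neg]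
    simp only [e]
    have hv := ZMod.val_neg_natCast (n := n) (k := k - a) (by omega) (by omega)
    rw [if_neg]
    · rw [mem_translateEdges]
      convert hrun a hak using 2
      rw [Nat.cast_sub hak.le]; simp
    · simp only [posEdge, Bool.false_eq_true, if_false, hv]
      omega
  · have e : ((a : ZMod (2 * n)), (0 : ZMod (2 * n))) + -((k : ZMod (2 * n)), 0) =
        (((a - k : ℕ) : ZMod (2 * n)), 0) := by
      rw [Nat.cast_sub hak]; simp [sub_eq_add_neg]
    simp only [e]
    have hv := ZMod.val_natCast_of_lt (n := 2 * n) (a := a - k) (by omega)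
    rw [if_pos]
    · have e' : (-1 - ((a - k : ℕ) : ZMod (2 * n))) + k = ((2 * k - 1 - a : ℕ) : ZMod (2 * n)) := by
        rw [Nat.sub_sub, Nat.cast_sub (m := 1 + a) (by omega), Nat.cast_sub hak]
        push_cast
        ring
      have := hrun (2 * k - 1 - a) (by omega)
      rw [← e'] at this
      simpa only [reflEdge, mem_translateEdges, Bool.false_eq_true, if_false, Prod.mk_add_mk,
        add_zero] using this
    · simp only [posEdge, Bool.false_eq_true, if_false, hv]
      omega

lemma exists_double_columns (hp : IsReflectionPositive p) (hM : 0 < M)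
    (hpM : ∀ S, p S ≤ M ^ S.card) (hS : M ^ S.card ≤ p S) {k : ℕ} (hk : 2 * k ≤ n + 1)
    (hk0 : 0 < k)
    (hrun : ∀ a < k, ∀ y, ((((2 * a : ℕ) : ZMod (2 * n)), y), true) ∈ S) :
    ∃ S', M ^ S'.card ≤ p S' ∧ ∀ a < 2 * k, ∀ y, ((((2 * a : ℕ) : ZMod (2 * n)), y), true) ∈ S' := by
  have h1 := hp.negDouble_extremal hM hpM (hp.translate_extremal hS (((2 * k - 1 : ℕ) : ZMod (2 * n)), (0 : ZMod (2 * n))))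
  refine ⟨_, hp.translate_extremal h1 (-(((2 * k - 1 : ℕ) : ZMod (2 * n)), (0 : ZMod (2 * n)))), fun a ha y => ?_⟩
  rw [mem_translateEdges, mem_negDouble]
  have hn := NeZero.ne n
  have hT : ∀ i < k, ((-((2 * (k - i) - 1 : ℕ) : ZMod (2 * n)), y), true) ∈
      translateEdges (((2 * k - 1 : ℕ) : ZMod (2 * n)), (0 : ZMod (2 * n))) S := by
    intro i hi
    rw [mem_translateEdges]
    convert hrun i hi y using 2
    simp only [Prod.mk_add_mk, add_zero, Prod.mk.injEq, and_true]
    rw [show 2 * (k - i) - 1 = 2 * k - 1 - 2 * i by omega, Nat.cast_sub (by omega)]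
    ring
  rcases lt_or_ge a k with hak | hak
  · have e : (((2 * a : ℕ) : ZMod (2 * n)), y) + -(((2 * k - 1 : ℕ) : ZMod (2 * n)), 0) =
        (-((2 * (k - a) - 1 : ℕ) : ZMod (2 * n)), y) := by
      rw [show 2 * (k - a) - 1 = 2 * k - 1 - 2 * a by omega,
        Nat.cast_sub (m := 2 * a) (by omega)]
      simp only [Prod.neg_mk, Prod.mk_add_mk, neg_zero, add_zero, Prod.mk.injEq, and_true]
      ring
    simp only [e]
    have hv := ZMod.val_neg_natCast (n := n) (k := 2 * (k - a) - 1) (by omega) (by omega)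
    rw [if_neg]
    · exact hT a hak
    · simp only [posEdge, if_true, hv]
      omega
  · have e : (((2 * a : ℕ) : ZMod (2 * n)), y) + -(((2 * k - 1 : ℕ) : ZMod (2 * n)), 0) =
        (((2 * (k - (2 * k - 1 - a)) - 1 : ℕ) : ZMod (2 * n)), y) := by
      rw [show 2 * (k - (2 * k - 1 - a)) - 1 = 2 * a - (2 * k - 1) by omega,
        Nat.cast_sub (m := 2 * k - 1) (by omega)]
      simp only [Prod.neg_mk, Prod.mk_add_mk, neg_zero, add_zero, Prod.mk.injEq, and_true]
      ring
    have hb := hT (2 * k - 1 - a) (by omega)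
    simp only [e]
    set b := 2 * (k - (2 * k - 1 - a)) - 1 with hbdef
    have hv := ZMod.val_natCast_of_lt (n := 2 * n) (a := b) (by omega)
    split_ifs with h
    · simpa [reflEdge] using hb
    · simp only [posEdge, if_true, hv] at h
      have hbn : b = n := by omega
      convert hb using 3
      rw [eq_comm, ZMod.neg_eq_self_iff_val, hv]
      exact Or.inr hbn

/-- An extremal nonempty set of edges leads to one which contains every second row. -/
lemma exists_extremal_rows (hp : IsReflectionPositive p) (hM : 0 < M)
    (hpM : ∀ S, p S ≤ M ^ S.card) (hS : M ^ S.card ≤ p S) (hne : S.Nonempty) :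
    ∃ S', M ^ S'.card ≤ p S' ∧ ∀ x, ∀ a < n, ((x, ((2 * a : ℕ) : ZMod (2 * n))), false) ∈ S' := by
  have hn := NeZero.ne n
  have start : ∃ S', M ^ S'.card ≤ p S' ∧ ∀ a : ℕ, a < 1 → (((a : ZMod (2 * n)), (0 : ZMod (2 * n))), false) ∈ S' := by
    obtain ⟨⟨v, b⟩, hd⟩ := hne
    cases b
    · refine ⟨_, hp.translate_extremal hS v, fun a ha => ?_⟩
      rw [Nat.lt_one_iff.1 ha, Nat.cast_zero, Prod.mk_zero_zero, mem_translateEdges, zero_add]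
      simpa using hd
    · refine ⟨_, hp.translate_extremal (hp.transpose_extremal hS) v.swap, fun a ha => ?_⟩
      rw [Nat.lt_one_iff.1 ha, Nat.cast_zero, Prod.mk_zero_zero, mem_translateEdges, zero_add]
      simpa using hd
  have run : ∀ k, 1 ≤ k → k ≤ n →
      ∃ S', M ^ S'.card ≤ p S' ∧ ∀ a : ℕ, a < k → (((a : ZMod (2 * n)), (0 : ZMod (2 * n))), false) ∈ S' := by
    intro k hk
    induction k, hk using Nat.le_induction with
    | base => exact fun _ => start
    | succ k hk ih =>
      intro hkn
      obtain ⟨S', h1, h2⟩ := ih (by omega)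
      obtain ⟨S'', h3, h4⟩ := hp.exists_double_run hM hpM h1 (by omega) h2
      exact ⟨S'', h3, fun a ha => h4 a (by omega)⟩
  have columns : ∀ k, 1 ≤ k → 2 * k ≤ n + 1 →
      ∃ S', M ^ S'.card ≤ p S' ∧ ∀ a < k, ∀ y, ((((2 * a : ℕ) : ZMod (2 * n)), y), true) ∈ S' := by
    intro k hk
    induction k, hk using Nat.le_induction with
    | base =>
      intro _
      obtain ⟨S', h1, h2⟩ := run n (by omega) le_rfl
      obtain ⟨S'', h3, h4⟩ := hp.exists_double_run hM hpM h1 le_rfl h2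
      refine ⟨_, hp.transpose_extremal h3, fun a ha y => ?_⟩
      rw [Nat.lt_one_iff.1 ha, mem_transposeEdges]
      have := h4 y.val (ZMod.val_lt y)
      simpa using this
    | succ k hk ih =>
      intro hkn
      obtain ⟨S', h1, h2⟩ := ih (by omega)
      obtain ⟨S'', h3, h4⟩ := hp.exists_double_columns hM hpM h1 (by omega) (by omega) h2
      exact ⟨S'', h3, fun a ha => h4 a (by omega)⟩
  obtain ⟨S', h1, h2⟩ := columns ((n + 1) / 2) (by omega) (by omega)
  obtain ⟨S'', h3, h4⟩ := hp.exists_double_columns hM hpM h1 (by omega) (by omega) h2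
  refine ⟨_, hp.transpose_extremal h3, fun x a ha => ?_⟩
  rw [mem_transposeEdges]
  exact h4 a (by omega) x

/-- The chessboard estimate: a bound for the sets that contain every second row implies one for
all sets of edges. -/
lemma le_pow_card (hp : IsReflectionPositive p) (h0 : p ∅ ≤ 1) {η : ℝ} (hη : 0 ≤ η)
    (hrows : ∀ S, (∀ x, ∀ a < n, ((x, ((2 * a : ℕ) : ZMod (2 * n))), false) ∈ S) →
      p S ≤ η ^ S.card) (S : Finset (DirEdge n)) : p S ≤ η ^ S.card := by
  rcases S.eq_empty_or_nonempty with rfl | hS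
  · simpa using h0
  obtain ⟨S₀, hS₀, hmax⟩ := (Finset.univ.filter fun S : Finset (DirEdge n) =>
    S.Nonempty).exists_max_image (fun S => p S ^ (1 / (S.card : ℝ))) ⟨S, by simpa using hS⟩
  simp only [Finset.mem_filter, Finset.mem_univ, true_and] at hS₀ hmax
  set M := p S₀ ^ (1 / (S₀.card : ℝ)) with hM
  have hM0 : 0 ≤ M := Real.rpow_nonneg (hp.nonneg _) _
  have hroot : ∀ T : Finset (DirEdge n), T.Nonempty → (p T ^ (1 / (T.card : ℝ))) ^ T.card = p T := by
    intro T hT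
    rw [← Real.rpow_natCast, ← Real.rpow_mul (hp.nonneg _), one_div_mul_cancel, Real.rpow_one]
    exact_mod_cast hT.card_pos.ne'
  have hpM : ∀ T, p T ≤ M ^ T.card := by
    intro T
    rcases T.eq_empty_or_nonempty with rfl | hT
    · simpa using h0
    · rw [← hroot T hT]
      exact pow_le_pow_left₀ (Real.rpow_nonneg (hp.nonneg _) _) (hmax T hT) _
  suffices h : M ≤ η from (hpM S).trans (pow_le_pow_left₀ hM0 h _)
  rcases hM0.eq_or_lt with h | hpos
  · rw [← h]; exact hη
  obtain ⟨S', h1, h2⟩ := hp.exists_extremal_rows hpos hpM (hroot S₀ hS₀).le hS₀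
  have h3 := h1.trans (hrows S' h2)
  refine le_of_pow_le_pow_left₀ (n := S'.card) ?_ hη h3
  exact (Finset.card_pos.2 ⟨_, h2 0 0 (NeZero.pos n)⟩).ne'

end IsReflectionPositive

end Chessboard

section Triangular

variable {V : Type*} [Fintype V] [DecidableEq V]

/-- The determinant of a matrix which is triangular with respect to a rank function. -/
lemma Matrix.det_of_rank (M : Matrix V V ℝ) (r : V → ℕ)
    (h : ∀ v u, u ≠ v → M v u ≠ 0 → r u < r v) : M.det = ∏ v, M v v := by
  have hb : M.transpose.BlockTriangular r := by
    intro i j hij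
    by_contra h0
    have hne : i ≠ j := by rintro rfl; exact lt_irrefl _ hij
    exact absurd (h j i hne h0) (not_lt.2 hij.le)
  rw [← Matrix.det_transpose, hb.det]
  have hblock : ∀ a, (M.transpose.toSquareBlock r a).det =
      ∏ v ∈ Finset.univ.filter (fun v => r v = a), M v v := by
    intro a
    have hd : M.transpose.toSquareBlock r a = Matrix.diagonal fun i : {v // r v = a} => M i i := by
      ext i j
      rcases eq_or_ne i j with rfl | hij
      · simp [Matrix.toSquareBlock_def]
      · rw [Matrix.diagonal_apply_ne _ hij]
        by_contra h0
        have := h j i (fun h => hij (Subtype.ext h)) h0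
        rw [i.2, j.2] at this
        exact lt_irrefl _ this
    rw [hd, Matrix.det_diagonal]
    exact (Finset.prod_subtype _ (by simp) fun v => M v v).symm
  simp only [hblock]
  exact Finset.prod_fiberwise_of_maps_to (fun v _ => Finset.mem_image_of_mem r (Finset.mem_univ v)) _

lemma lintegral_prod_apply (f : V → ℝ → ℝ≥0∞) (hf : ∀ v, Measurable (f v)) :
    ∫⁻ φ : V → ℝ, ∏ v, f v (φ v) = ∏ v, ∫⁻ x, f v x := by
  have key : ∀ (s : Finset V) (x : V → ℝ),
      (∫⋯∫⁻_s, (fun φ => ∏ v ∈ s, f v (φ v)) ∂(fun _ => (volume : Measure ℝ))) x =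
        ∏ v ∈ s, ∫⁻ x, f v x := by
    intro s
    induction s using Finset.induction_on with
    | empty => simp
    | insert i s hi ih =>
      intro x
      rw [lmarginal_insert _ _ hi, Finset.prod_insert hi]
      · have : ∀ t : ℝ, (∫⋯∫⁻_s, (fun φ => ∏ v ∈ insert i s, f v (φ v))
            ∂(fun _ => (volume : Measure ℝ))) (Function.update x i t) =
            f i t * ∏ v ∈ s, ∫⁻ x, f v x := by
          intro t
          rw [← ih (Function.update x i t), lmarginal, lmarginal, ← lintegral_const_mul]
          · refine lintegral_congr fun y => ?_
            rw [Finset.prod_insert hi]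
            simp [Function.updateFinset, hi]
          · exact (Finset.measurable_fun_prod _ fun v _ =>
              (hf v).comp (measurable_pi_apply v)).comp measurable_updateFinset
        simp only [this]
        rw [lintegral_mul_const _ (hf i)]
      · exact Finset.measurable_fun_prod _ fun v _ => (hf v).comp (measurable_pi_apply v)
  rw [volume_pi, lintegral_eq_lmarginal_univ (fun _ => (0 : ℝ))]
  exact key Finset.univ _

/-- Integration of a product over the edges of a rooted tree. -/
lemma lintegral_tree (o : V) (par : V → V) (r : V → ℕ) (hr : ∀ v, v ≠ o → r (par v) < r v)
    (f : V → ℝ → ℝ≥0∞) (hf : ∀ v, Measurable (f v)) :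
    ∫⁻ φ : V → ℝ, ∏ v, f v (if v = o then φ v else φ v - φ (par v)) = ∏ v, ∫⁻ x, f v x := by
  let M : Matrix V V ℝ := fun v u =>
    (if u = v then 1 else 0) - if v ≠ o ∧ u = par v then 1 else 0
  have hpar : ∀ v, v ≠ o → par v ≠ v := by
    intro v hv h
    have := hr v hv
    rw [h] at this
    exact lt_irrefl _ this
  have hdet : M.det = 1 := by
    rw [Matrix.det_of_rank M r]
    · refine Finset.prod_eq_one fun v _ => ?_
      have : ¬ (v ≠ o ∧ v = par v) := fun h => hpar v h.1 h.2.symm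
      simp only [M, if_neg this, if_true, sub_zero]
    · intro v u huv h0
      simp only [M, if_neg huv] at h0
      by_cases h : v ≠ o ∧ u = par v
      · rw [h.2]; exact hr v h.1
      · simp [h] at h0
  have hmap := Real.map_matrix_volume_pi_eq_smul_volume_pi (M := M) (by rw [hdet]; norm_num)
  rw [hdet] at hmap
  simp only [inv_one, abs_one, ENNReal.ofReal_one, one_smul] at hmap
  rw [← lintegral_prod_apply f hf]
  conv_rhs => rw [← hmap]
  have hm : Measurable fun φ : V → ℝ => ∏ v, f v (φ v) :=
    Finset.measurable_fun_prod _ fun v _ => (hf v).comp (measurable_pi_apply v)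
  rw [lintegral_map hm (LinearMap.continuous_of_finiteDimensional _).measurable]
  refine lintegral_congr fun φ => Finset.prod_congr rfl fun v _ => ?_
  congr 1
  rw [Matrix.toLin'_apply, Matrix.mulVec, dotProduct]
  simp only [M, sub_mul, ite_mul, one_mul, zero_mul, Finset.sum_sub_distrib, Finset.sum_ite_eq',
    Finset.mem_univ, if_true]
  by_cases hv : v = o
  · simp [hv]
  · simp [hv]

end Triangular

section TorusTree

variable {n : ℕ} [NeZero n]

/-- The edge of a spanning tree of the torus which joins a vertex to its parent. -/
def treeEdge (v : TorusVertex n) : DirEdge n :=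
  if v.1 ≠ 0 then ((v.1 - 1, v.2), false) else ((v.1, v.2 - 1), true)

lemma ZMod.val_sub_one_lt {x : ZMod (2 * n)} (hx : x ≠ 0) : (x - 1).val < x.val := by
  have h := ZMod.val_add_one_two_mul (x - 1)
  rw [sub_add_cancel] at h
  have h0 : x.val ≠ 0 := by rwa [ne_eq, ZMod.val_eq_zero]
  split_ifs at h <;> omega

lemma treeEdge_add_dirVec (v : TorusVertex n) :
    (treeEdge v).1 + dirVec n (treeEdge v).2 = v := by
  unfold treeEdge
  split_ifs <;> simp [dirVec]

lemma treeEdge_rank {v : TorusVertex n} (hv : v ≠ 0) :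
    (treeEdge v).1.1.val + (treeEdge v).1.2.val < v.1.val + v.2.val := by
  unfold treeEdge
  split_ifs with h
  · have := ZMod.val_sub_one_lt h
    simp only
    omega
  · have h2 : v.2 ≠ 0 := by
      intro h2
      exact hv (Prod.ext (not_not.1 h) h2)
    have := ZMod.val_sub_one_lt h2
    simp only
    omega

lemma treeEdge_injective : Function.Injective (treeEdge (n := n)) := by
  intro v w h
  rw [← treeEdge_add_dirVec v, h, treeEdge_add_dirVec]

lemma edgeGrad_treeEdge (φ : TorusVertex n → ℝ) (v : TorusVertex n) :
    edgeGrad φ (treeEdge v) = -(φ v - φ (treeEdge v).1) := by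
  rw [edgeGrad, treeEdge_add_dirVec]; ring

lemma card_torusVertex : Fintype.card (TorusVertex n) = 4 * n ^ 2 := by
  rw [Fintype.card_prod, ZMod.card]; ring

lemma edgeIntegral_le {q : DirEdge n → ℝ → ℝ≥0∞} (hq : ∀ d, Measurable (q d))
    (heven : ∀ d x, q d (-x) = q d x) {W : ℝ≥0∞} (hW : 1 ≤ W) (hqW : ∀ d x, q d x ≤ W) :
    edgeIntegral n q ≤
      W ^ (8 * n ^ 2) * ∏ v ∈ Finset.univ.erase 0, ∫⁻ x, q (treeEdge v) x := by
  let f : TorusVertex n → ℝ → ℝ≥0∞ := fun v =>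
    if v = 0 then (Set.Ico (0 : ℝ) 1).indicator 1 else q (treeEdge v)
  have hf : ∀ v, Measurable (f v) := by
    intro v
    simp only [f]
    split_ifs
    · exact measurable_one.indicator measurableSet_Ico
    · exact hq _
  have hW0 : ∀ k l : ℕ, k ≤ l → W ^ k ≤ W ^ l := fun k l h => pow_le_pow_right₀ hW h
  have hpt : ∀ φ : TorusVertex n → ℝ, {φ : TorusVertex n → ℝ | φ 0 ∈ Set.Ico (0 : ℝ) 1}.indicator
      (fun φ => ∏ d, q d (edgeGrad φ d)) φ ≤ W ^ (8 * n ^ 2) *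
        ∏ v, f v (if v = 0 then φ v else φ v - φ (treeEdge v).1) := by
    intro φ
    by_cases h0 : φ 0 ∈ Set.Ico (0 : ℝ) 1
    · rw [Set.indicator_of_mem (by exact h0), ← Finset.mul_prod_erase _
        (fun v => f v (if v = 0 then φ v else φ v - φ (treeEdge v).1)) (Finset.mem_univ 0)]
      have h1 : f 0 (if (0 : TorusVertex n) = 0 then φ 0 else φ 0 - φ (treeEdge 0).1) = 1 := by
        simp only [f, if_true]
        rw [Set.indicator_of_mem h0]; rfl
      have h2 : ∏ v ∈ Finset.univ.erase 0, f v (if v = 0 then φ v else φ v - φ (treeEdge v).1) =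
          ∏ d ∈ (Finset.univ.erase 0).image treeEdge, q d (edgeGrad φ d) := by
        rw [Finset.prod_image treeEdge_injective.injOn]
        refine Finset.prod_congr rfl fun v hv => ?_
        have hv0 := Finset.ne_of_mem_erase hv
        simp only [f, if_neg hv0]
        rw [edgeGrad_treeEdge, heven]
      rw [h1, h2, one_mul, ← Finset.prod_sdiff (Finset.subset_univ
        ((Finset.univ.erase 0).image treeEdge))]
      refine mul_le_mul_left (le_trans (Finset.prod_le_pow_card _ _ _ fun d _ => hqW d _) ?_) _
      refine hW0 _ _ ((Finset.card_le_univ _).trans ?_)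
      rw [Fintype.card_prod, card_torusVertex, Fintype.card_bool]
      omega
    · rw [Set.indicator_of_notMem (by exact h0)]
      exact zero_le
  rw [edgeIntegral, rootedLebesgue, ← lintegral_indicator (measurableSet_root _)]
  refine (lintegral_mono hpt).trans ?_
  rw [lintegral_const_mul, lintegral_tree 0 (fun v => (treeEdge v).1)
    (fun v => v.1.val + v.2.val) (fun v hv => treeEdge_rank hv) f hf,
    ← Finset.mul_prod_erase _ _ (Finset.mem_univ 0)]
  · have h1 : ∫⁻ x, f 0 x = 1 := by
      simp only [f, if_true]
      rw [lintegral_indicator measurableSet_Ico]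
      simp
    rw [h1, one_mul]
    refine le_of_eq ?_
    congr 1
    refine Finset.prod_congr rfl fun v hv => ?_
    simp only [f, if_neg (Finset.ne_of_mem_erase hv)]
  · refine Finset.measurable_fun_prod _ fun v _ => (hf v).comp ?_
    split_ifs
    · exact measurable_pi_apply _
    · exact (measurable_pi_apply _).sub (measurable_pi_apply _)

lemma le_edgeIntegral {q : DirEdge n → ℝ → ℝ≥0∞} {w : ℝ≥0∞}
    (hqw : ∀ d x, |x| ≤ 1 / 2 → w ≤ q d x) :
    w ^ (8 * n ^ 2) * (2⁻¹ : ℝ≥0∞) ^ (4 * n ^ 2) ≤ edgeIntegral n q := by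
  let B : Set (TorusVertex n → ℝ) := Set.univ.pi fun _ => Set.Ico (0 : ℝ) (1 / 2)
  have hB : MeasurableSet B := MeasurableSet.univ_pi fun _ => measurableSet_Ico
  have hvol : volume B = (2⁻¹ : ℝ≥0∞) ^ (4 * n ^ 2) := by
    rw [volume_pi_pi]
    simp only [Real.volume_Ico, Finset.prod_const, Finset.card_univ, card_torusVertex]
    congr 1
    rw [sub_zero, one_div, ENNReal.ofReal_inv_of_pos (by norm_num)]
    simp
  rw [edgeIntegral, rootedLebesgue, ← lintegral_indicator (measurableSet_root _), ← hvol,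
    ← lintegral_indicator_const hB]
  refine lintegral_mono fun φ => ?_
  by_cases h : φ ∈ B
  · have h' : ∀ v, 0 ≤ φ v ∧ φ v < 1 / 2 := fun v => h v (Set.mem_univ v)
    rw [Set.indicator_of_mem h, Set.indicator_of_mem (by
      exact ⟨(h' 0).1, by linarith [(h' 0).2]⟩)]
    have : w ^ (8 * n ^ 2) = ∏ _d : DirEdge n, w := by
      rw [Finset.prod_const, Finset.card_univ, Fintype.card_prod, card_torusVertex,
        Fintype.card_bool]
      congr 1; omega
    rw [this]
    refine Finset.prod_le_prod' fun d _ => hqw d _ ?_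
    rw [edgeGrad, abs_le]
    constructor <;> linarith [(h' d.1).1, (h' d.1).2, (h' (d.1 + dirVec n d.2)).1,
      (h' (d.1 + dirVec n d.2)).2]
  · rw [Set.indicator_of_notMem h]
    exact zero_le

end TorusTree

namespace Potential

variable {U : Potential}

lemma IsAdmissible.exists_boltzmann_le (hU : U.IsAdmissible) :
    ∃ W : ℝ≥0∞, 1 ≤ W ∧ W ≠ ∞ ∧ ∀ x, U.boltzmann x ≤ W := by
  obtain ⟨⟨m, hm⟩, -⟩ := hU
  refine ⟨max 1 (ENNReal.ofReal (Real.exp (-m))), le_max_left _ _, by simp, fun x => ?_⟩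
  refine le_trans ?_ (le_max_right _ _)
  rw [← EReal.exp_coe, boltzmann, EReal.exp_le_exp_iff]
  simpa using EReal.neg_le_neg_iff.2 (hm x)

lemma IsC2OnUnit.exists_le_boltzmann (hC2 : U.IsC2OnUnit) :
    ∃ w : ℝ≥0∞, w ≠ 0 ∧ w ≠ ∞ ∧ ∀ x, |x| ≤ 1 → w ≤ U.boltzmann x := by
  obtain ⟨h1, h2⟩ := hC2
  obtain ⟨B, hB⟩ := isCompact_Icc.bddAbove_image h2.continuousOn
  refine ⟨ENNReal.ofReal (Real.exp (-B)), by simp [Real.exp_pos], by simp, fun x hx => ?_⟩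
  have hx' : x ∈ Set.Icc (-1 : ℝ) 1 := abs_le.1 hx
  rw [← EReal.exp_coe, boltzmann, EReal.exp_le_exp_iff, EReal.coe_neg, EReal.neg_le_neg_iff,
    ← EReal.coe_toReal (h1 x hx') (U.ne_bot x)]
  exact_mod_cast hB ⟨x, hx', rfl⟩

variable {n : ℕ} [NeZero n]

lemma measurable_weight (U : Potential) (hn : 2 ≤ n) : Measurable (U.weight n) := by
  have h : U.weight n = fun φ => ∏ d : DirEdge n, U.boltzmann (edgeGrad φ d) := by
    funext φ; exact U.weight_eq_prod hn φ
  rw [h]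
  exact measurable_prod_edgeGrad fun _ => U.measurable_boltzmann

lemma shiftInvariant_weight (U : Potential) (hn : 2 ≤ n) : ShiftInvariant (U.weight n) := by
  intro φ t
  simp only [U.weight_eq_prod hn, edgeGrad_add_const]

lemma weight_ne_top (U : Potential) (hn : 2 ≤ n) (φ : TorusVertex n → ℝ) : U.weight n φ ≠ ∞ := by
  rw [U.weight_eq_prod hn]
  exact ENNReal.prod_ne_top fun d _ => U.boltzmann_ne_top _

lemma lintegral_pinnedLebesgue {F : (TorusVertex n → ℝ) → ℝ≥0∞} (hF : Measurable F)
    (hF' : ShiftInvariant F) :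
    ∫⁻ φ, F φ ∂(pinnedLebesgue n) = ∫⁻ φ, F φ ∂(rootedLebesgue (0 : TorusVertex n)) :=
  lintegral_dirac_pi_eq hF hF' 0

lemma partitionFunction_eq (U : Potential) (hn : 2 ≤ n) :
    U.partitionFunction n = edgeIntegral n fun _ => U.boltzmann := by
  rw [partitionFunction, lintegral_pinnedLebesgue (U.measurable_weight hn)
    (U.shiftInvariant_weight hn), edgeIntegral]
  exact lintegral_congr fun φ => U.weight_eq_prod hn φ

lemma partitionFunction_ne_top (hU : U.IsAdmissible) (hn : 2 ≤ n) :
    U.partitionFunction n ≠ ∞ := by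
  obtain ⟨W, hW1, hW, hUW⟩ := hU.exists_boltzmann_le
  rw [partitionFunction_eq U hn]
  refine ne_top_of_le_ne_top ?_ (edgeIntegral_le (fun _ => U.measurable_boltzmann)
    (fun _ => U.boltzmann_neg) hW1 fun _ => hUW)
  exact ENNReal.mul_ne_top (ENNReal.pow_ne_top hW)
    (ENNReal.prod_ne_top fun v _ => hU.2.2.ne)

lemma partitionFunction_ne_zero (hC2 : U.IsC2OnUnit) (hn : 2 ≤ n) :
    U.partitionFunction n ≠ 0 := by
  obtain ⟨w, hw0, -, hw⟩ := hC2.exists_le_boltzmann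
  rw [partitionFunction_eq U hn]
  refine (lt_of_lt_of_le ?_ (le_edgeIntegral fun _ x hx => hw x (by linarith))).ne'
  refine ENNReal.mul_pos (pow_ne_zero _ hw0) (pow_ne_zero _ ?_)
  simp

lemma isProbabilityMeasure_surfaceMeasure (hU : U.IsAdmissible) (hC2 : U.IsC2OnUnit)
    (hn : 2 ≤ n) : IsProbabilityMeasure (U.surfaceMeasure n) := by
  constructor
  rw [surfaceMeasure, Measure.smul_apply, withDensity_apply _ MeasurableSet.univ,
    Measure.restrict_univ, smul_eq_mul]
  exact ENNReal.inv_mul_cancel (partitionFunction_ne_zero hC2 hn) (partitionFunction_ne_top hU hn)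

lemma surfaceMeasure_apply (U : Potential) (hn : 2 ≤ n) {X : Set (TorusVertex n → ℝ)}
    (hX : MeasurableSet X) (hX' : ShiftInvariant fun φ => φ ∈ X) :
    U.surfaceMeasure n X = (U.partitionFunction n)⁻¹ *
      ∫⁻ φ in X, U.weight n φ ∂(rootedLebesgue (0 : TorusVertex n)) := by
  rw [surfaceMeasure, Measure.smul_apply, withDensity_apply _ hX, smul_eq_mul,
    ← lintegral_indicator hX, ← lintegral_indicator hX,
    lintegral_pinnedLebesgue ((U.measurable_weight hn).indicator hX)]
  intro φ t
  have h1 : (fun v => φ v + t) ∈ X ↔ φ ∈ X := iff_of_eq (hX' φ t)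
  by_cases h : φ ∈ X
  · rw [Set.indicator_of_mem h, Set.indicator_of_mem (h1.2 h), U.shiftInvariant_weight hn φ t]
  · rw [Set.indicator_of_notMem h, Set.indicator_of_notMem (fun h' => h (h1.1 h'))]

/-- The Boltzmann factors in which the gradients on a set of edges are restricted to
`a ≤ |x| ≤ 1`. -/
noncomputable def windowFactor (U : Potential) (a : ℝ) (S : Finset (DirEdge n)) (d : DirEdge n) :
    ℝ → ℝ≥0∞ :=
  if d ∈ S then {x | a ≤ |x| ∧ |x| ≤ 1}.indicator U.boltzmann else U.boltzmann

lemma measurableSet_window (a : ℝ) : MeasurableSet {x : ℝ | a ≤ |x| ∧ |x| ≤ 1} :=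
  (measurableSet_le measurable_const continuous_abs.measurable).inter
    (measurableSet_le continuous_abs.measurable measurable_const)

lemma measurable_windowFactor (U : Potential) (a : ℝ) (S : Finset (DirEdge n)) (d : DirEdge n) :
    Measurable (U.windowFactor a S d) := by
  unfold windowFactor
  split_ifs
  · exact U.measurable_boltzmann.indicator (measurableSet_window a)
  · exact U.measurable_boltzmann

lemma windowFactor_neg (U : Potential) (a : ℝ) (S : Finset (DirEdge n)) (d : DirEdge n) (x : ℝ) :
    U.windowFactor a S d (-x) = U.windowFactor a S d x := by
  unfold windowFactor
  split_ifs
  · simp [Set.indicator, U.boltzmann_neg]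
  · exact U.boltzmann_neg x

lemma windowFactor_le (U : Potential) (a : ℝ) (S : Finset (DirEdge n)) (d : DirEdge n) (x : ℝ) :
    U.windowFactor a S d x ≤ U.boltzmann x := by
  unfold windowFactor
  split_ifs
  · exact Set.indicator_le_self _ _ _
  · exact le_rfl

lemma edgeIntegral_windowFactor_ne_top (hU : U.IsAdmissible) (hn : 2 ≤ n) (a : ℝ)
    (S : Finset (DirEdge n)) : edgeIntegral n (U.windowFactor a S) ≠ ∞ := by
  refine ne_top_of_le_ne_top (partitionFunction_ne_top hU hn) ?_
  rw [partitionFunction_eq U hn]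
  exact lintegral_mono fun φ => Finset.prod_le_prod' fun d _ => U.windowFactor_le a S d _

lemma isReflectionPositive_window (hU : U.IsAdmissible) (hn : 2 ≤ n) (a : ℝ) :
    IsReflectionPositive fun S : Finset (DirEdge n) =>
      (edgeIntegral n (U.windowFactor a S) / U.partitionFunction n).toReal where
  nonneg S := ENNReal.toReal_nonneg
  translate t S := by
    rw [← edgeIntegral_translate (U.measurable_windowFactor a S) t]
    congr 3
    funext d
    simp [windowFactor]
  transpose S := by
    rw [← edgeIntegral_transpose (U.measurable_windowFactor a S)]
    congr 3
    funext d
    simp [windowFactor]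
  sq_le S := by
    have h := sq_edgeIntegral_le (U.measurable_windowFactor a S) (U.windowFactor_neg a S)
    have h1 : (fun d => if posEdge (reflEdge d) then U.windowFactor a S (reflEdge d)
        else U.windowFactor a S d) = U.windowFactor a (posDouble S) := by
      funext d
      simp only [windowFactor, mem_posDouble]
      split_ifs <;> simp_all
    have h2 : (fun d => if posEdge d then U.windowFactor a S (reflEdge d)
        else U.windowFactor a S d) = U.windowFactor a (negDouble S) := by
      funext d
      simp only [windowFactor, mem_negDouble]
      split_ifs <;> simp_all
    rw [h1, h2] at h
    have h' := ENNReal.toReal_mono (ENNReal.mul_ne_top (edgeIntegral_windowFactor_ne_top hU hn a _)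
      (edgeIntegral_windowFactor_ne_top hU hn a _)) h
    rw [ENNReal.toReal_pow, ENNReal.toReal_mul] at h'
    simp only [ENNReal.toReal_div]
    rw [div_pow, div_mul_div_comm, ← sq]
    gcongr

lemma surfaceMeasure_window (U : Potential) (hn : 2 ≤ n) (a : ℝ) (S : Finset (DirEdge n)) :
    U.surfaceMeasure n {φ | ∀ d ∈ S, a ≤ |edgeGrad φ d| ∧ |edgeGrad φ d| ≤ 1} =
      edgeIntegral n (U.windowFactor a S) / U.partitionFunction n := by
  have hX : MeasurableSet {φ : TorusVertex n → ℝ |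
      ∀ d ∈ S, a ≤ |edgeGrad φ d| ∧ |edgeGrad φ d| ≤ 1} := by
    have : {φ : TorusVertex n → ℝ | ∀ d ∈ S, a ≤ |edgeGrad φ d| ∧ |edgeGrad φ d| ≤ 1} =
        ⋂ d ∈ S, (fun φ => edgeGrad φ d) ⁻¹' {x : ℝ | a ≤ |x| ∧ |x| ≤ 1} := by
      ext φ; simp
    rw [this]
    exact S.measurableSet_biInter fun d _ => measurable_edgeGrad d (measurableSet_window a)
  rw [U.surfaceMeasure_apply hn hX, div_eq_mul_inv, mul_comm, edgeIntegral,
    ← lintegral_indicator hX]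
  · congr 1
    refine lintegral_congr fun φ => ?_
    by_cases h : ∀ d ∈ S, a ≤ |edgeGrad φ d| ∧ |edgeGrad φ d| ≤ 1
    · rw [Set.indicator_of_mem (by exact h), U.weight_eq_prod hn]
      refine Finset.prod_congr rfl fun d _ => ?_
      unfold windowFactor
      split_ifs with hd
      · rw [Set.indicator_of_mem (by exact h d hd)]
      · rfl
    · rw [Set.indicator_of_notMem (by exact h)]
      push Not at h
      obtain ⟨d, hd, h⟩ := h
      rw [eq_comm, Finset.prod_eq_zero_iff]
      refine ⟨d, Finset.mem_univ _, ?_⟩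
      rw [windowFactor, if_pos hd, Set.indicator_of_notMem]
      exact fun h' => absurd h'.2 (not_le.2 (h h'.1))
  · intro φ t
    simp only [Set.mem_ofPred_eq, edgeGrad_add_const]

lemma lintegral_window_le {W : ℝ≥0∞} (hUW : ∀ x, U.boltzmann x ≤ W) (ε : ℝ) :
    ∫⁻ x, {x | 1 - ε ≤ |x| ∧ |x| ≤ 1}.indicator U.boltzmann x ≤ W * ENNReal.ofReal (2 * ε) := by
  rw [lintegral_indicator (measurableSet_window _)]
  refine (lintegral_mono fun x => hUW x).trans ?_
  rw [setLIntegral_const]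
  gcongr
  refine (measure_mono (t := Set.Icc (-1) (-1 + ε) ∪ Set.Icc (1 - ε) 1) ?_).trans
    ((measure_union_le _ _).trans ?_)
  · rintro x ⟨h1, h2⟩
    rcases abs_cases x with ⟨h, _⟩ | ⟨h, _⟩ <;> rw [h] at h1 h2
    · exact Or.inr ⟨h1, h2⟩
    · exact Or.inl ⟨by linarith, by linarith⟩
  · rw [Real.volume_Icc, Real.volume_Icc]
    rcases le_or_gt 0 ε with h | h
    · rw [← ENNReal.ofReal_add (by linarith) (by linarith)]
      refine ENNReal.ofReal_le_ofReal (by linarith)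
    · rw [ENNReal.ofReal_of_nonpos (by linarith), ENNReal.ofReal_of_nonpos (by linarith)]
      simp

/-- Exponential bounds for the probability that the gradients on a set of edges are slightly
below one in absolute value. -/
lemma exists_window_bound (hU : U.IsAdmissible) (hC2 : U.IsC2OnUnit) {η : ℝ} (hη : 0 < η)
    (hη1 : η ≤ 1) :
    ∃ ε : ℝ, 0 < ε ∧ ε < 1 ∧ ∀ (n : ℕ) [NeZero n], 2 ≤ n → ∀ S : Finset (DirEdge n),
      U.surfaceMeasure n {φ | ∀ d ∈ S, 1 - ε ≤ |edgeGrad φ d| ∧ |edgeGrad φ d| ≤ 1} ≤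
        ENNReal.ofReal (η ^ S.card) := by
  obtain ⟨W, hW1, hW, hUW⟩ := hU.exists_boltzmann_le
  obtain ⟨w, hw0, hwt, hUw⟩ := hC2.exists_le_boltzmann
  set K : ℝ≥0∞ := max 1 (∫⁻ x, U.boltzmann x) with hK
  have hK1 : 1 ≤ K := le_max_left _ _
  have hKt : K ≠ ∞ := (max_lt ENNReal.one_lt_top hU.2.2).ne
  set X : ℝ≥0∞ := W ^ 8 * K ^ 4 * W with hXdef
  have hXt : X ≠ ∞ := ENNReal.mul_ne_top (ENNReal.mul_ne_top (ENNReal.pow_ne_top hW)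
    (ENNReal.pow_ne_top hKt)) hW
  have hX1 : 1 ≤ X := one_le_mul (one_le_mul (one_le_pow₀ hW1) (one_le_pow₀ hK1)) hW1
  set ρ : ℝ≥0∞ := ENNReal.ofReal η ^ 8 * (w ^ 8 * (2⁻¹ : ℝ≥0∞) ^ 4) with hρ
  have hρ0 : ρ ≠ 0 := by
    refine mul_ne_zero (pow_ne_zero _ ?_) (mul_ne_zero (pow_ne_zero _ hw0) (pow_ne_zero _ ?_))
    · simpa using hη
    · simp
  have hρt : ρ ≠ ∞ := ENNReal.mul_ne_top (ENNReal.pow_ne_top ENNReal.ofReal_ne_top)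
    (ENNReal.mul_ne_top (ENNReal.pow_ne_top hwt) (ENNReal.pow_ne_top (by simp)))
  have hρr : 0 < ρ.toReal := ENNReal.toReal_pos hρ0 hρt
  have hXr : 0 < X.toReal := ENNReal.toReal_pos (zero_lt_one.trans_le hX1).ne' hXt
  set ε : ℝ := min (1 / 2) (ρ.toReal / (2 * X.toReal)) with hε
  have hε0 : 0 < ε := lt_min (by norm_num) (by positivity)
  have hεX : X * ENNReal.ofReal (2 * ε) ≤ ρ := by
    rw [← ENNReal.ofReal_toReal hXt, ← ENNReal.ofReal_mul hXr.le, ← ENNReal.ofReal_toReal hρt]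
    refine ENNReal.ofReal_le_ofReal ?_
    have : ε ≤ ρ.toReal / (2 * X.toReal) := min_le_right _ _
    rw [le_div_iff₀ (by positivity)] at this
    linarith
  refine ⟨ε, hε0, (min_le_left _ _).trans_lt (by norm_num), ?_⟩
  intro n _ hn S
  have hZ0 := partitionFunction_ne_zero hC2 hn
  have hZt := partitionFunction_ne_top hU hn
  have hRP := isReflectionPositive_window hU hn (1 - ε)
  have hfin : ∀ T, edgeIntegral n (U.windowFactor (1 - ε) T) / U.partitionFunction n ≠ ∞ :=
    fun T => ENNReal.div_ne_top (edgeIntegral_windowFactor_ne_top hU hn _ T) hZ0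
  rw [U.surfaceMeasure_window hn, ← ENNReal.ofReal_toReal (hfin S)]
  refine ENNReal.ofReal_le_ofReal (hRP.le_pow_card ?_ hη.le ?_ S)
  · have : edgeIntegral n (U.windowFactor (1 - ε) ∅) = U.partitionFunction n := by
      rw [partitionFunction_eq U hn]
      congr 1
    simp only [this, ENNReal.div_self hZ0 hZt, ENNReal.toReal_one, le_refl]
  · intro T hT
    have hcard : T.card ≤ 8 * n ^ 2 := by
      refine (Finset.card_le_univ T).trans (le_of_eq ?_)
      rw [Fintype.card_prod, card_torusVertex, Fintype.card_bool]
      ring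
    refine le_trans ?_ (pow_le_pow_of_le_one hη.le hη1 hcard)
    refine ENNReal.toReal_le_of_le_ofReal (by positivity) ?_
    rw [ENNReal.div_le_iff hZ0 hZt, ENNReal.ofReal_pow hη.le]
    let g : Fin n × Fin n → TorusVertex n := fun i => ((i.1 + 1 : ℕ), (2 * i.2 : ℕ))
    have hval1 : ∀ i : Fin n × Fin n, (g i).1.val = i.1 + 1 := fun i =>
      ZMod.val_natCast_of_lt (by have := i.1.2; omega)
    have hval2 : ∀ i : Fin n × Fin n, (g i).2.val = 2 * i.2 := fun i =>
      ZMod.val_natCast_of_lt (by have := i.2.2; omega)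
    have hg1 : ∀ i, (g i).1 ≠ 0 := by
      intro i h
      have := hval1 i
      rw [h, ZMod.val_zero] at this
      omega
    have hginj : Function.Injective g := by
      intro i j h
      have h1 := hval1 i
      have h2 := hval2 i
      rw [h] at h1 h2
      rw [hval1] at h1
      rw [hval2] at h2
      exact Prod.ext (Fin.ext (by omega)) (Fin.ext (by omega))
    let R : Finset (TorusVertex n) := Finset.univ.image g
    have hRcard : R.card = n ^ 2 := by
      rw [Finset.card_image_of_injective _ hginj, Finset.card_univ, Fintype.card_prod,
        Fintype.card_fin, sq]
    have hRsub : R ⊆ Finset.univ.erase 0 := by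
      intro v hv
      obtain ⟨i, -, rfl⟩ := Finset.mem_image.1 hv
      exact Finset.mem_erase.2 ⟨fun h => hg1 i (by rw [h]; rfl), Finset.mem_univ _⟩
    have hR : ∏ v ∈ R, ∫⁻ x, U.windowFactor (1 - ε) T (treeEdge v) x ≤
        (W * ENNReal.ofReal (2 * ε)) ^ (n ^ 2) := by
      rw [← hRcard]
      refine Finset.prod_le_pow_card _ _ _ fun v hv => ?_
      obtain ⟨i, -, rfl⟩ := Finset.mem_image.1 hv
      have hmem : treeEdge (g i) ∈ T := by
        rw [treeEdge, if_pos (hg1 i)]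
        exact hT _ _ i.2.2
      simp only [windowFactor, if_pos hmem]
      exact lintegral_window_le hUW ε
    have hR' : ∏ v ∈ (Finset.univ.erase 0) \ R, ∫⁻ x, U.windowFactor (1 - ε) T (treeEdge v) x ≤
        K ^ (4 * n ^ 2) := by
      refine (Finset.prod_le_pow_card _ _ K fun v _ => ?_).trans
        (pow_le_pow_right₀ hK1 ((Finset.card_le_univ _).trans_eq card_torusVertex))
      exact (lintegral_mono fun x => U.windowFactor_le _ _ _ x).trans (le_max_right _ _)
    have hup := edgeIntegral_le (U.measurable_windowFactor (1 - ε) T)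
      (U.windowFactor_neg (1 - ε) T) hW1 fun d x => (U.windowFactor_le _ _ d x).trans (hUW x)
    rw [← Finset.prod_sdiff hRsub] at hup
    have hlow := le_edgeIntegral (n := n) (q := fun _ => U.boltzmann) (w := w)
      fun _ x hx => hUw x (by linarith)
    rw [← partitionFunction_eq U hn] at hlow
    calc _ ≤ _ := hup
      _ ≤ W ^ (8 * n ^ 2) * (K ^ (4 * n ^ 2) * (W * ENNReal.ofReal (2 * ε)) ^ (n ^ 2)) := by
        gcongr
      _ = (X * ENNReal.ofReal (2 * ε)) ^ (n ^ 2) := by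
        rw [hXdef, pow_mul, pow_mul, ← mul_pow, ← mul_pow]
        congr 1
        ring
      _ ≤ ρ ^ (n ^ 2) := by gcongr
      _ = ENNReal.ofReal η ^ (8 * n ^ 2) * (w ^ (8 * n ^ 2) * (2⁻¹ : ℝ≥0∞) ^ (4 * n ^ 2)) := by
        rw [hρ, pow_mul, pow_mul w, pow_mul (2⁻¹ : ℝ≥0∞), ← mul_pow, ← mul_pow]
      _ ≤ _ := by gcongr

end Potential

lemma min_pow_le {i j : ℕ} :
    min ((1 / 8 : ℝ) ^ i) (((1 / 50 : ℝ) ^ 6) ^ j) ≤ (9 / 50) ^ i * (1 / 50) ^ j := by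
  by_contra h
  rw [not_le, lt_min_iff] at h
  obtain ⟨h1, h2⟩ := h
  have h3 : ((9 / 50 : ℝ) ^ i * (1 / 50) ^ j) ^ 6 <
      ((1 / 8 : ℝ) ^ i) ^ 5 * ((1 / 50 : ℝ) ^ 6) ^ j := by
    rw [pow_succ]
    exact mul_lt_mul'' (pow_lt_pow_left₀ h1 (by positivity) (by norm_num)) h2
      (by positivity) (by positivity)
  have h4 : ((1 / 8 : ℝ) ^ i) ^ 5 ≤ ((9 / 50 : ℝ) ^ i) ^ 6 := by
    rw [← pow_mul, ← pow_mul, mul_comm i, mul_comm i, pow_mul, pow_mul]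
    exact pow_le_pow_left₀ (by positivity) (by norm_num) _
  rw [mul_pow, ← pow_mul (1 / 50 : ℝ) j, mul_comm j, pow_mul (1 / 50 : ℝ)] at h3
  have h5 : (0 : ℝ) ≤ ((1 / 50 : ℝ) ^ 6) ^ j := by positivity
  nlinarith

namespace Potential

variable {U : Potential}

lemma HasControlledGradients.measure_le {n : ℕ} [NeZero n] {δ L : ℝ}
    (h : U.HasControlledGradients n δ L) (hn : 2 ≤ n) {S : Finset (DirEdge n)}
    (hS : S.Nonempty) :
    U.surfaceMeasure n {φ | ∀ d ∈ S, L ≤ |edgeGrad φ d|} ≤ ENNReal.ofReal (δ ^ S.card) := by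
  have := h.2 (S.image DirEdge.toSym2) (hS.image _)
    (by rw [← DirEdge.image_toSym2]; exact Finset.image_subset_image (Finset.subset_univ _))
  rw [Finset.card_image_of_injective _ (DirEdge.toSym2_injective hn)] at this
  refine le_trans (measure_mono fun φ hφ => ?_) this
  intro e he
  obtain ⟨d, hd, rfl⟩ := Finset.mem_image.1 (Finset.mem_coe.1 he)
  exact ⟨d.toSym2_mem, hφ d hd⟩

/-- Exponential bounds for the probability of steep gradients, with a threshold that depends only
on the potential. -/
lemma exists_steep_bound (hU : U.IsAdmissible) (hC2 : U.IsC2OnUnit) :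
    ∃ ε : ℝ, 0 < ε ∧ ε < 1 ∧ ∀ (n : ℕ) [NeZero n], 2 ≤ n →
      (∃ ε' : ℝ, 0 < ε' ∧ ε' ≤ 1 / 2 ∧ U.HasControlledGradients n (1 / 8) (1 - ε')) →
      ∀ S : Finset (DirEdge n), U.surfaceMeasure n {φ | ∀ d ∈ S, 1 - ε ≤ |edgeGrad φ d|} ≤
        ENNReal.ofReal ((1 / 5) ^ S.card) := by
  obtain ⟨ε, hε0, hε1, hε⟩ := exists_window_bound hU hC2 (η := (1 / 50) ^ 6) (by norm_num)
    (by norm_num)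
  refine ⟨ε, hε0, hε1, ?_⟩
  rintro n _ hn ⟨ε', hε'0, -, hctrl⟩ S
  have := isProbabilityMeasure_surfaceMeasure hU hC2 hn
  have hsub : {φ : TorusVertex n → ℝ | ∀ d ∈ S, 1 - ε ≤ |edgeGrad φ d|} ⊆
      ⋃ T ∈ S.powerset, ({φ | ∀ d ∈ T, 1 - ε' ≤ |edgeGrad φ d|} ∩
        {φ | ∀ d ∈ S \ T, 1 - ε ≤ |edgeGrad φ d| ∧ |edgeGrad φ d| ≤ 1}) := by
    intro φ hφ
    simp only [Set.mem_iUnion]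
    refine ⟨S.filter fun d => 1 - ε' ≤ |edgeGrad φ d|, Finset.mem_powerset.2 (Finset.filter_subset _ _),
      fun d hd => (Finset.mem_filter.1 hd).2, fun d hd => ?_⟩
    obtain ⟨h1, h2⟩ := Finset.mem_sdiff.1 hd
    refine ⟨hφ d h1, ?_⟩
    by_contra h3
    exact h2 (Finset.mem_filter.2 ⟨h1, by linarith⟩)
  refine (measure_mono hsub).trans ((measure_biUnion_finset_le _ _).trans ?_)
  calc _ ≤ ∑ T ∈ S.powerset,
        ENNReal.ofReal ((9 / 50) ^ T.card * (1 / 50) ^ (S.card - T.card)) := by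
        refine Finset.sum_le_sum fun T hT => ?_
        have hTS := Finset.mem_powerset.1 hT
        refine le_trans ?_ (ENNReal.ofReal_le_ofReal min_pow_le)
        rw [ENNReal.ofReal_min]
        refine le_min ((measure_mono Set.inter_subset_left).trans ?_)
          ((measure_mono Set.inter_subset_right).trans ?_)
        · rcases T.eq_empty_or_nonempty with rfl | hne
          · simp
          · exact hctrl.measure_le hn hne
        · rw [← Finset.card_sdiff_of_subset hTS]
          exact hε n hn (S \ T)
    _ = ENNReal.ofReal (∑ T ∈ S.powerset, (9 / 50) ^ T.card * (1 / 50) ^ (S.card - T.card)) :=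
        (ENNReal.ofReal_sum_of_nonneg fun T _ => by positivity).symm
    _ = _ := by
        rw [Finset.sum_pow_mul_eq_add_pow]
        norm_num

end Potential

section Walks

variable {n : ℕ}

/-- The unit step in the direction `b.1` with orientation `b.2`. -/
def stepVec (n : ℕ) (b : Bool × Bool) : TorusVertex n := if b.2 then dirVec n b.1 else -dirVec n b.1

/-- The vertices of the walk with initial vertex `v` and steps `σ`. -/
def walkVertex {ℓ : ℕ} (v : TorusVertex n) (σ : Fin ℓ → Bool × Bool) (i : ℕ) : TorusVertex n :=
  v + ∑ j ∈ Finset.range i, if h : j < ℓ then stepVec n (σ ⟨j, h⟩) else 0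

/-- The edges of the walk with initial vertex `v` and steps `σ`. -/
def walkEdge {ℓ : ℕ} (v : TorusVertex n) (σ : Fin ℓ → Bool × Bool) (i : Fin ℓ) : DirEdge n :=
  (if (σ i).2 then walkVertex v σ i else walkVertex v σ (i + 1), (σ i).1)

lemma walkVertex_succ {ℓ : ℕ} (v : TorusVertex n) (σ : Fin ℓ → Bool × Bool) (i : Fin ℓ) :
    walkVertex v σ (i + 1) = walkVertex v σ i + stepVec n (σ i) := by
  rw [walkVertex, Finset.sum_range_succ, dif_pos i.2, ← add_assoc]
  rfl

lemma toSym2_walkEdge {ℓ : ℕ} (v : TorusVertex n) (σ : Fin ℓ → Bool × Bool) (i : Fin ℓ) :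
    (walkEdge v σ i).toSym2 = s(walkVertex v σ i, walkVertex v σ (i + 1)) := by
  unfold walkEdge DirEdge.toSym2
  rw [walkVertex_succ, stepVec]
  split_ifs
  · rfl
  · simp [Sym2.eq_swap]

lemma exists_walk {ℓ : ℕ} (γ : ℕ → TorusVertex n) (hγ : ∀ i < ℓ, (torus n).Adj (γ i) (γ (i + 1))) :
    ∃ σ : Fin ℓ → Bool × Bool, ∀ i ≤ ℓ, walkVertex (γ 0) σ i = γ i := by
  have h : ∀ i : Fin ℓ, ∃ b, γ (i + 1) = γ i + stepVec n b := by
    intro i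
    obtain ⟨b, h | h⟩ := torus_adj_iff.1 (hγ i i.2)
    · exact ⟨(b, true), h⟩
    · exact ⟨(b, false), by rw [h]; simp [stepVec]⟩
  choose σ hσ using h
  refine ⟨σ, fun i => ?_⟩
  induction i with
  | zero => intro _; simp [walkVertex]
  | succ i ih =>
    intro hi
    have := walkVertex_succ (γ 0) σ ⟨i, hi⟩
    simp only at this
    rw [this, ih (by omega), ← hσ ⟨i, hi⟩]

/-- The height functions for which every walk of length `ℓ` without repeated edges has more than
`m` edges that are not steep. -/
def goodSet (n : ℕ) (ε : ℝ) (m ℓ : ℕ) : Set (TorusVertex n → ℝ) :=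
  {φ | ∀ (v : TorusVertex n) (σ : Fin ℓ → Bool × Bool), Function.Injective (walkEdge v σ) →
    ∀ T : Finset (Fin ℓ), ℓ ≤ T.card + m → ¬ ∀ i ∈ T, 1 - ε ≤ |edgeGrad φ (walkEdge v σ i)|}

lemma lt_card_of_mem_goodSet {ε : ℝ} {m ℓ : ℕ} {φ : TorusVertex n → ℝ} (hφ : φ ∈ goodSet n ε m ℓ)
    (γ : ℕ → TorusVertex n) (hγ : ∀ i < ℓ, (torus n).Adj (γ i) (γ (i + 1)))
    (hinj : Set.InjOn γ (Set.Iic ℓ)) :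
    m < ((Finset.range ℓ).filter fun i => |φ (γ i) - φ (γ (i + 1))| < 1 - ε).card := by
  obtain ⟨σ, hσ⟩ := exists_walk γ hγ
  have hsym : ∀ i : Fin ℓ, (walkEdge (γ 0) σ i).toSym2 = s(γ i, γ (i + 1)) := by
    intro i
    rw [toSym2_walkEdge, hσ i i.2.le, hσ (i + 1) i.2]
  have hgrad : ∀ i : Fin ℓ, |edgeGrad φ (walkEdge (γ 0) σ i)| = |φ (γ i) - φ (γ (i + 1))| := by
    intro i
    rw [← absGradient_toSym2, hsym]
    rfl
  have hedge : Function.Injective (walkEdge (γ 0) σ) := by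
    intro i j hij
    have h := congrArg DirEdge.toSym2 hij
    rw [hsym, hsym, Sym2.eq_iff] at h
    have hi := i.2
    have hj := j.2
    refine Fin.ext ?_
    rcases h with ⟨h, -⟩ | ⟨h1, h2⟩
    · exact hinj (Set.mem_Iic.2 hi.le) (Set.mem_Iic.2 hj.le) h
    · have h3 := hinj (Set.mem_Iic.2 hi.le) (Set.mem_Iic.2 (by omega)) h1
      have h4 := hinj (Set.mem_Iic.2 (by omega)) (Set.mem_Iic.2 hj.le) h2
      omega
  by_contra hlt
  refine hφ (γ 0) σ hedge (Finset.univ.filter fun i : Fin ℓ =>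
    1 - ε ≤ |φ (γ i) - φ (γ (i + 1))|) ?_ fun i hi => ?_
  · have h1 := Finset.card_filter_add_card_filter_not (s := (Finset.univ : Finset (Fin ℓ)))
      (fun i => 1 - ε ≤ |φ (γ i) - φ (γ (i + 1))|)
    have h2 : (Finset.univ.filter fun i : Fin ℓ => ¬ 1 - ε ≤ |φ (γ i) - φ (γ (i + 1))|).card =
        ((Finset.range ℓ).filter fun i => |φ (γ i) - φ (γ (i + 1))| < 1 - ε).card := by
      rw [← Finset.card_map Fin.valEmbedding]
      congr 1
      ext i
      simp only [Finset.mem_map, Finset.mem_filter, Finset.mem_univ, true_and, not_le,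
        Fin.valEmbedding_apply, Finset.mem_range]
      exact ⟨by rintro ⟨j, h, rfl⟩; exact ⟨j.2, h⟩, fun h => ⟨⟨i, h.1⟩, h.2, rfl⟩⟩
    rw [Finset.card_univ, Fintype.card_fin] at h1
    omega
  · rw [hgrad]
    exact (Finset.mem_filter.1 hi).2

lemma measurableSet_goodSet (n : ℕ) [NeZero n] (ε : ℝ) (m ℓ : ℕ) :
    MeasurableSet (goodSet n ε m ℓ) := by
  have h : ∀ (v : TorusVertex n) (σ : Fin ℓ → Bool × Bool) (T : Finset (Fin ℓ)),
      MeasurableSet {φ : TorusVertex n → ℝ | ∀ i ∈ T, 1 - ε ≤ |edgeGrad φ (walkEdge v σ i)|} := by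
    intro v σ T
    simp only [Set.ofPred_forall]
    exact MeasurableSet.iInter fun i => MeasurableSet.iInter fun _ =>
      measurableSet_le measurable_const (continuous_abs.measurable.comp (measurable_edgeGrad _))
  simp only [goodSet, Set.ofPred_forall]
  exact MeasurableSet.iInter fun v => MeasurableSet.iInter fun σ => MeasurableSet.iInter fun _ =>
    MeasurableSet.iInter fun T => MeasurableSet.iInter fun _ => (h v σ T).compl

lemma shiftInvariant_goodSet (n : ℕ) (ε : ℝ) (m ℓ : ℕ) :
    ShiftInvariant fun φ => φ ∈ goodSet n ε m ℓ := by
  intro φ t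
  simp only [goodSet, Set.mem_ofPred_eq, edgeGrad_add_const]

lemma measure_compl_goodSet_le [NeZero n] (μ : Measure (TorusVertex n → ℝ)) {ε : ℝ}
    (hμ : ∀ S : Finset (DirEdge n), μ {φ | ∀ d ∈ S, 1 - ε ≤ |edgeGrad φ d|} ≤
      ENNReal.ofReal ((1 / 5) ^ S.card)) (m : ℕ) :
    μ (goodSet n ε m (50 * m))ᶜ ≤ ENNReal.ofReal (4 * n ^ 2 * (1 / 10) ^ m) := by
  set ℓ := 50 * m with hℓ
  let bad : TorusVertex n × (Fin ℓ → Bool × Bool) → Set (TorusVertex n → ℝ) := fun x =>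
    {φ | Function.Injective (walkEdge x.1 x.2) ∧ ∃ T : Finset (Fin ℓ), ℓ ≤ T.card + m ∧
      ∀ i ∈ T, 1 - ε ≤ |edgeGrad φ (walkEdge x.1 x.2 i)|}
  have hsub : (goodSet n ε m ℓ)ᶜ ⊆ ⋃ x ∈ (Finset.univ :
      Finset (TorusVertex n × (Fin ℓ → Bool × Bool))), bad x := by
    intro φ hφ
    simp only [goodSet, Set.mem_compl_iff, Set.mem_ofPred_eq] at hφ
    push Not at hφ
    obtain ⟨v, σ, h1, T, h2, h3⟩ := hφ
    exact Set.mem_biUnion (x := (v, σ)) (Finset.mem_coe.2 (Finset.mem_univ _)) ⟨h1, T, h2, h3⟩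
  have hbad : ∀ x, μ (bad x) ≤ ENNReal.ofReal (50 ^ m * (11 / 50) ^ ℓ) := by
    rintro ⟨v, σ⟩
    by_cases hinj : Function.Injective (walkEdge v σ)
    · have hsub' : bad (v, σ) ⊆ ⋃ T ∈ ((Finset.univ : Finset (Fin ℓ)).powerset.filter
          fun T => ℓ ≤ T.card + m), {φ | ∀ d ∈ T.image (walkEdge v σ), 1 - ε ≤ |edgeGrad φ d|} := by
        rintro φ ⟨-, T, h1, h2⟩
        refine Set.mem_biUnion (x := T) (by simpa using h1) ?_
        intro d hd
        obtain ⟨i, hi, rfl⟩ := Finset.mem_image.1 hd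
        exact h2 i hi
      refine (measure_mono hsub').trans ((measure_biUnion_finset_le _ _).trans ?_)
      calc _ ≤ ∑ T ∈ ((Finset.univ : Finset (Fin ℓ)).powerset.filter fun T => ℓ ≤ T.card + m),
            ENNReal.ofReal (50 ^ m * ((1 / 5) ^ T.card * (1 / 50) ^ (ℓ - T.card))) := by
            refine Finset.sum_le_sum fun T hT => (hμ _).trans (ENNReal.ofReal_le_ofReal ?_)
            rw [Finset.card_image_of_injective _ hinj]
            have h1 := (Finset.mem_filter.1 hT).2
            have h2 : (1 : ℝ) ≤ 50 ^ m * (1 / 50) ^ (ℓ - T.card) := by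
              calc (1 : ℝ) = 50 ^ m * (1 / 50) ^ m := by rw [← mul_pow]; norm_num
                _ ≤ _ := by
                  gcongr 50 ^ m * ?_
                  exact pow_le_pow_of_le_one (by norm_num) (by norm_num) (by omega)
            have h3 : (0 : ℝ) ≤ (1 / 5) ^ T.card := by positivity
            nlinarith
        _ ≤ ∑ T ∈ (Finset.univ : Finset (Fin ℓ)).powerset,
            ENNReal.ofReal (50 ^ m * ((1 / 5) ^ T.card * (1 / 50) ^ (ℓ - T.card))) :=
            Finset.sum_le_sum_of_subset (Finset.filter_subset _ _)
        _ = ENNReal.ofReal (50 ^ m * ∑ T ∈ (Finset.univ : Finset (Fin ℓ)).powerset,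
            (1 / 5) ^ T.card * (1 / 50) ^ (ℓ - T.card)) := by
            rw [← ENNReal.ofReal_sum_of_nonneg fun T _ => by positivity, Finset.mul_sum]
        _ = _ := by
            have := Finset.sum_pow_mul_eq_add_pow (1 / 5 : ℝ) (1 / 50) (Finset.univ : Finset (Fin ℓ))
            rw [Finset.card_univ, Fintype.card_fin] at this
            rw [this]
            norm_num
    · have : bad (v, σ) = ∅ := by
        ext φ
        simp [bad, hinj]
      rw [this]
      simp
  refine (measure_mono hsub).trans ((measure_biUnion_finset_le _ _).trans
    ((Finset.sum_le_card_nsmul _ _ _ fun x _ => hbad x).trans ?_))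
  rw [Finset.card_univ, Fintype.card_prod, card_torusVertex, Fintype.card_fun, Fintype.card_prod,
    Fintype.card_bool, Fintype.card_fin, nsmul_eq_mul, ← ENNReal.ofReal_natCast,
    ← ENNReal.ofReal_mul (by positivity)]
  refine ENNReal.ofReal_le_ofReal ?_
  push_cast
  have h1 : (2 * 2 : ℝ) ^ ℓ * (50 ^ m * (11 / 50) ^ ℓ) ≤ (1 / 10) ^ m := by
    calc (2 * 2 : ℝ) ^ ℓ * (50 ^ m * (11 / 50) ^ ℓ) = (50 * (22 / 25) ^ 50) ^ m := by
          rw [mul_left_comm, ← mul_pow, hℓ, pow_mul, ← mul_pow]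
          norm_num
      _ ≤ _ := pow_le_pow_left₀ (by positivity) (by norm_num) _
  calc _ = 4 * (n : ℝ) ^ 2 * ((2 * 2 : ℝ) ^ ℓ * (50 ^ m * (11 / 50) ^ ℓ)) := by ring
    _ ≤ _ := by gcongr

end Walks

/-- A continuously differentiable even function which vanishes outside `(-1,1)`. -/
noncomputable def profile (x : ℝ) : ℝ := (max 0 (1 - x ^ 2)) ^ 2

lemma hasDerivAt_sq_max_zero (y : ℝ) :
    HasDerivAt (fun y : ℝ => (max 0 y) ^ 2) (2 * max 0 y) y := by
  rcases lt_trichotomy y 0 with h | rfl | h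
  · rw [max_eq_left h.le, mul_zero]
    refine (hasDerivAt_const y (0 : ℝ)).congr_of_eventuallyEq ?_
    filter_upwards [gt_mem_nhds h] with z hz
    simp [max_eq_left hz.le]
  · simp only [max_self, mul_zero]
    rw [hasDerivAt_iff_isLittleO]
    simp only [max_self, sub_zero, smul_zero]
    have h1 : (fun y : ℝ => (max 0 y) ^ 2 - 0 ^ 2) =O[nhds 0] fun y => y ^ 2 := by
      refine Asymptotics.IsBigO.of_bound 1 (Filter.Eventually.of_forall fun z => ?_)
      rw [zero_pow two_ne_zero, sub_zero, one_mul, Real.norm_eq_abs, Real.norm_eq_abs, abs_of_nonneg (by positivity),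
        abs_of_nonneg (by positivity)]
      rcases max_cases 0 z with ⟨h, _⟩ | ⟨h, _⟩
      · rw [h]; nlinarith
      · rw [h]
    refine h1.trans_isLittleO ?_
    simpa using Asymptotics.isLittleO_pow_pow (𝕜 := ℝ) (m := 1) (n := 2) (by norm_num)
  · rw [max_eq_right h.le]
    have : HasDerivAt (fun y : ℝ => y ^ 2) (2 * y) y := by simpa using hasDerivAt_pow 2 y
    refine this.congr_of_eventuallyEq ?_
    filter_upwards [lt_mem_nhds h] with z hz
    rw [max_eq_right hz.le]

lemma hasDerivAt_profile (x : ℝ) : HasDerivAt profile (-4 * x * max 0 (1 - x ^ 2)) x := by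
  have h1 : HasDerivAt (fun x : ℝ => 1 - x ^ 2) (-(2 * x)) x := by
    simpa using (hasDerivAt_pow 2 x).const_sub 1
  have h2 : HasDerivAt profile (2 * max 0 (1 - x ^ 2) * -(2 * x)) x :=
    HasDerivAt.comp (h₂ := fun y : ℝ => (max 0 y) ^ 2) x (hasDerivAt_sq_max_zero (1 - x ^ 2)) h1
  exact h2.congr_deriv (by ring)

lemma abs_deriv_profile_le (x : ℝ) : |-4 * x * max 0 (1 - x ^ 2)| ≤ 4 := by
  rcases le_total (1 - x ^ 2) 0 with h | h
  · rw [max_eq_left h]; simp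
  · rw [max_eq_right h, abs_le]
    have h1 : |x| ≤ 1 := by rw [← sq_le_one_iff_abs_le_one]; linarith
    rw [abs_le] at h1
    constructor <;> nlinarith [sq_nonneg x]

lemma abs_profile_sub_le (x y : ℝ) : |profile x - profile y| ≤ 4 * |x - y| :=
  convex_univ.norm_image_sub_le_of_norm_hasDerivWithin_le
    (fun z _ => (hasDerivAt_profile z).hasDerivWithinAt) (fun z _ => abs_deriv_profile_le z)
    (Set.mem_univ y) (Set.mem_univ x)

lemma profile_nonneg (x : ℝ) : 0 ≤ profile x := sq_nonneg _

lemma profile_neg (x : ℝ) : profile (-x) = profile x := by simp [profile]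

lemma profile_le_one (x : ℝ) : profile x ≤ 1 := by
  unfold profile
  refine pow_le_one₀ (le_max_left _ _) (max_le zero_le_one ?_)
  nlinarith [sq_nonneg x]

lemma profile_eq_zero {x : ℝ} (hx : 1 ≤ |x|) : profile x = 0 := by
  unfold profile
  rw [max_eq_left, sq, mul_zero]
  have := (one_le_sq_iff_one_le_abs x).2 hx
  linarith

lemma profile_le {x : ℝ} (hx : |x| ≤ 1) : profile x ≤ 4 * (1 - |x|) := by
  have h : profile x = (1 - |x|) * ((1 - |x|) * (1 + |x|) ^ 2) := by
    unfold profile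
    rw [max_eq_right (by rw [← sq_abs]; nlinarith [abs_nonneg x]), ← sq_abs x]
    ring
  rw [h, mul_comm 4]
  refine mul_le_mul_of_nonneg_left ?_ (by linarith)
  nlinarith [abs_nonneg x, sq_nonneg |x|]

lemma sq_le_profile {x ε : ℝ} (hε : 0 ≤ ε) (hx : |x| ≤ 1 - ε) : ε ^ 2 ≤ profile x := by
  unfold profile
  refine pow_le_pow_left₀ hε (le_max_of_le_right ?_) 2
  rw [← sq_abs]
  nlinarith [abs_nonneg x]

section Shift

variable {V : Type*} (G : SimpleGraph V) [DecidableRel G.Adj] (lam tau : V → ℝ)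

/-- The length of an edge in the metric that governs the shift. -/
noncomputable def edgeLength (lam : V → ℝ) (φ : V → ℝ) (v w : V) : ℝ :=
  min (lam v) (lam w) * profile (φ v - φ w)

section EdgeLength

variable {lam}

lemma edgeLength_nonneg (hlam : ∀ v, 0 ≤ lam v) (φ : V → ℝ) (v w : V) :
    0 ≤ edgeLength lam φ v w :=
  mul_nonneg (le_min (hlam v) (hlam w)) (profile_nonneg _)

lemma edgeLength_comm (φ : V → ℝ) (v w : V) : edgeLength lam φ v w = edgeLength lam φ w v := by
  unfold edgeLength
  rw [min_comm, ← neg_sub (φ w), profile_neg]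

lemma edgeLength_le (hlam : ∀ v, 0 ≤ lam v) (φ : V → ℝ) (v w : V) :
    edgeLength lam φ v w ≤ min (lam v) (lam w) :=
  mul_le_of_le_one_right (le_min (hlam v) (hlam w)) (profile_le_one _)

lemma measurable_edgeLength (v w : V) : Measurable fun φ : V → ℝ => edgeLength lam φ v w := by
  have : Measurable profile := by
    unfold profile
    fun_prop
  unfold edgeLength
  exact (this.comp ((measurable_pi_apply v).sub (measurable_pi_apply w))).const_mul _

lemma abs_edgeLength_sub_le (hlam : ∀ v, 0 ≤ lam v) (hlam8 : ∀ v, lam v ≤ 1 / 8) {φ φ' : V → ℝ}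
    {v w : V} (hw : φ w = φ' w) :
    |edgeLength lam φ v w - edgeLength lam φ' v w| ≤ |φ v - φ' v| / 2 := by
  unfold edgeLength
  rw [← mul_sub, abs_mul, abs_of_nonneg (le_min (hlam v) (hlam w))]
  have h1 := abs_profile_sub_le (φ v - φ w) (φ' v - φ' w)
  have h2 : φ v - φ w - (φ' v - φ' w) = φ v - φ' v := by rw [hw]; ring
  rw [h2] at h1
  have h3 : min (lam v) (lam w) ≤ 1 / 8 := (min_le_left _ _).trans (hlam8 v)
  calc _ ≤ 1 / 8 * (4 * |φ v - φ' v|) := by gcongr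
    _ = _ := by ring

end EdgeLength

variable [Fintype V]

/-- The Bellman iteration for the largest function which is bounded by `tau` and by `edgeLength`
along edges. -/
noncomputable def bellman (φ : V → ℝ) : ℕ → V → ℝ
  | 0, v => tau v
  | j + 1, v => Finset.univ.inf' (@Finset.univ_nonempty V _ ⟨v⟩) fun w =>
      if G.Adj v w then min (bellman φ j v) (bellman φ j w + edgeLength lam φ v w)
      else bellman φ j v

/-- The amount by which a height function is shifted: the largest function which is bounded by
`tau` and whose increments along edges are bounded by `edgeLength`. -/
noncomputable def shift (φ : V → ℝ) (v : V) : ℝ := ⨅ j, bellman G lam tau φ j v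

/-- The height function obtained by adding a multiple of the shift. -/
noncomputable def shifted (a : ℝ) (φ : V → ℝ) (v : V) : ℝ := φ v + a * shift G lam tau φ v

variable {G lam tau}

lemma le_bellman {f : V → ℝ} {φ : V → ℝ} (hf : ∀ v, f v ≤ tau v)
    (hf' : ∀ v w, G.Adj v w → f v ≤ f w + edgeLength lam φ v w) (j : ℕ) (v : V) :
    f v ≤ bellman G lam tau φ j v := by
  induction j generalizing v with
  | zero => exact hf v
  | succ j ih =>
    rw [bellman, Finset.le_inf'_iff]
    intro w _
    split_ifs with h
    · exact le_min (ih v) ((hf' v w h).trans (by linarith [ih w]))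
    · exact ih v

lemma bellman_nonneg (hlam : ∀ v, 0 ≤ lam v) (htau : ∀ v, 0 ≤ tau v) (φ : V → ℝ) (j : ℕ) (v : V) :
    0 ≤ bellman G lam tau φ j v :=
  le_bellman (f := fun _ => 0) htau
    (fun v w _ => by simpa using edgeLength_nonneg hlam φ v w) j v

lemma bellman_succ_le {φ : V → ℝ} {v w : V} (h : G.Adj v w) (j : ℕ) :
    bellman G lam tau φ (j + 1) v ≤ bellman G lam tau φ j w + edgeLength lam φ v w := by
  rw [bellman]
  refine (Finset.inf'_le _ (Finset.mem_univ w)).trans ?_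
  rw [if_pos h]
  exact min_le_right _ _

lemma bddBelow_bellman (hlam : ∀ v, 0 ≤ lam v) (htau : ∀ v, 0 ≤ tau v) (φ : V → ℝ) (v : V) :
    BddBelow (Set.range fun j => bellman G lam tau φ j v) :=
  ⟨0, by rintro _ ⟨j, rfl⟩; exact bellman_nonneg hlam htau φ j v⟩

lemma shift_nonneg (hlam : ∀ v, 0 ≤ lam v) (htau : ∀ v, 0 ≤ tau v) (φ : V → ℝ) (v : V) :
    0 ≤ shift G lam tau φ v :=
  le_ciInf fun j => bellman_nonneg hlam htau φ j v

lemma shift_le (hlam : ∀ v, 0 ≤ lam v) (htau : ∀ v, 0 ≤ tau v) (φ : V → ℝ) (v : V) :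
    shift G lam tau φ v ≤ tau v :=
  ciInf_le (bddBelow_bellman hlam htau φ v) 0

lemma shift_le_add (hlam : ∀ v, 0 ≤ lam v) (htau : ∀ v, 0 ≤ tau v) (φ : V → ℝ) {v w : V}
    (h : G.Adj v w) : shift G lam tau φ v ≤ shift G lam tau φ w + edgeLength lam φ v w := by
  rw [← sub_le_iff_le_add]
  refine le_ciInf fun j => ?_
  rw [sub_le_iff_le_add]
  exact (ciInf_le (bddBelow_bellman hlam htau φ v) (j + 1)).trans (bellman_succ_le h j)

lemma abs_shift_sub_le (hlam : ∀ v, 0 ≤ lam v) (htau : ∀ v, 0 ≤ tau v) (φ : V → ℝ) {v w : V}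
    (h : G.Adj v w) :
    |shift G lam tau φ v - shift G lam tau φ w| ≤ edgeLength lam φ v w := by
  have h1 := shift_le_add hlam htau φ h
  have h2 := shift_le_add hlam htau φ h.symm
  rw [edgeLength_comm] at h2
  rw [abs_le]
  constructor <;> linarith

lemma le_shift {f : V → ℝ} {φ : V → ℝ} (hf : ∀ v, f v ≤ tau v)
    (hf' : ∀ v w, G.Adj v w → f v ≤ f w + edgeLength lam φ v w) (v : V) :
    f v ≤ shift G lam tau φ v :=
  le_ciInf fun j => le_bellman hf hf' j v

lemma measurable_shift (v : V) : Measurable fun φ : V → ℝ => shift G lam tau φ v := by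
  have h : ∀ j v, Measurable fun φ : V → ℝ => bellman G lam tau φ j v := by
    intro j
    induction j with
    | zero => exact fun v => measurable_const
    | succ j ih =>
      intro v
      simp only [bellman]
      have := Finset.inf'_induction (p := Measurable) (@Finset.univ_nonempty V _ ⟨v⟩)
        (fun w (φ : V → ℝ) => if G.Adj v w then
          min (bellman G lam tau φ j v) (bellman G lam tau φ j w + edgeLength lam φ v w)
          else bellman G lam tau φ j v) (fun _ h₁ _ h₂ => h₁.inf h₂) fun w _ => by
            by_cases hw : G.Adj v w
            · simp only [hw, if_true]
              exact (ih v).min ((ih w).add (measurable_edgeLength v w))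
            · simp only [hw, if_false]
              exact ih v
      convert this using 1
      funext φ
      simp
  exact Measurable.iInf fun j => h j v

lemma measurable_shifted (a : ℝ) : Measurable (shifted G lam tau a) :=
  measurable_pi_lambda _ fun v => (measurable_pi_apply v).add ((measurable_shift v).const_mul a)

/-- Maximality of the shift. -/
lemma exists_tight (hlam : ∀ v, 0 ≤ lam v) (htau : ∀ v, 0 ≤ tau v) (φ : V → ℝ) {W : Set V}
    (hW : W.Nonempty) : ∃ v ∈ W, shift G lam tau φ v = tau v ∨
      ∃ w, w ∉ W ∧ G.Adj v w ∧ shift G lam tau φ v = shift G lam tau φ w + edgeLength lam φ v w := by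
  classical
  by_contra hcon
  push Not at hcon
  set s := shift G lam tau φ with hs
  have h1 : ∀ v ∈ W, s v < tau v := fun v hv =>
    lt_of_le_of_ne (shift_le hlam htau φ v) (hcon v hv).1
  have h2 : ∀ v ∈ W, ∀ w, w ∉ W → G.Adj v w → s v < s w + edgeLength lam φ v w :=
    fun v hv w hw h => lt_of_le_of_ne (shift_le_add hlam htau φ h) ((hcon v hv).2 w hw h)
  have hlim : ∀ a b : ℝ, a < b → ∀ᶠ η in nhdsWithin (0 : ℝ) (Set.Ioi 0), a + η ≤ b := by
    intro a b hab
    refine eventually_nhdsWithin_of_eventually_nhds ?_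
    filter_upwards [gt_mem_nhds (sub_pos.2 hab)] with η hη
    linarith
  have h3 : ∀ᶠ η in nhdsWithin (0 : ℝ) (Set.Ioi 0), ∀ v, v ∈ W → s v + η ≤ tau v :=
    Filter.eventually_all.2 fun v => Filter.eventually_imp_distrib_left.2 fun hv => hlim _ _ (h1 v hv)
  have h4 : ∀ᶠ η in nhdsWithin (0 : ℝ) (Set.Ioi 0), ∀ v w, v ∈ W → w ∉ W → G.Adj v w →
      s v + η ≤ s w + edgeLength lam φ v w :=
    Filter.eventually_all.2 fun v => Filter.eventually_all.2 fun w =>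
      Filter.eventually_imp_distrib_left.2 fun hv => Filter.eventually_imp_distrib_left.2 fun hw =>
        Filter.eventually_imp_distrib_left.2 fun h => hlim _ _ (h2 v hv w hw h)
  obtain ⟨η, ⟨h3, h4⟩, hη⟩ := ((h3.and h4).and self_mem_nhdsWithin).exists
  have hη : 0 < η := hη
  obtain ⟨v, hv⟩ := hW
  have h5 := le_shift (G := G) (lam := lam) (tau := tau) (φ := φ)
    (f := fun v => if v ∈ W then s v + η else s v) (fun v => by
      split_ifs with hv
      · exact h3 v hv
      · exact shift_le hlam htau φ v) (fun v w hvw => by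
      have h6 : s v ≤ s w + edgeLength lam φ v w := shift_le_add hlam htau φ hvw
      split_ifs with hv hw hw
      · linarith
      · exact h4 v w hv hw hvw
      · linarith
      · exact h6) v
  simp only [hv, if_true, ← hs] at h5
  linarith

/-- Every vertex is a root or has a parent, with respect to which the shift is tight. -/
lemma exists_parent (hlam : ∀ v, 0 ≤ lam v) (htau : ∀ v, 0 ≤ tau v) (φ : V → ℝ) :
    ∃ (p : V → Option V) (r : V → ℕ), (∀ v w, p v = some w → G.Adj v w ∧ r w < r v) ∧
      ∀ v, shift G lam tau φ v = (p v).elim (tau v)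
        fun w => shift G lam tau φ w + edgeLength lam φ v w := by
  classical
  set s := shift G lam tau φ with hs
  let R : V → V → Prop := fun v w => G.Adj v w ∧ s v = s w + edgeLength lam φ v w
  let reach : ℕ → V → Prop := fun j => Nat.rec (fun v => s v = tau v)
    (fun _ P v => P v ∨ ∃ w, P w ∧ R v w) j
  have hreach : ∀ v, ∃ j, reach j v := by
    by_contra hcon
    push Not at hcon
    obtain ⟨v, hv, h | ⟨w, hw, h⟩⟩ := exists_tight (G := G) hlam htau φ (W := {v | ∀ j, ¬ reach j v}) hcon
    · exact hv 0 h
    · simp only [Set.mem_ofPred_eq, not_forall, not_not] at hw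
      obtain ⟨j, hj⟩ := hw
      exact hv (j + 1) (Or.inr ⟨w, hj, h⟩)
  let r : V → ℕ := fun v => @Nat.find (fun j => reach j v) (Classical.decPred _) (hreach v)
  have hex : ∀ v, ∃ o : Option V, (∀ w, o = some w → G.Adj v w ∧ r w < r v) ∧
      s v = o.elim (tau v) fun w => s w + edgeLength lam φ v w := by
    intro v
    have h1 : reach (r v) v := @Nat.find_spec (fun j => reach j v) (Classical.decPred _) (hreach v)
    rcases hr : r v with - | j
    · rw [hr] at h1
      exact ⟨none, by simp, h1⟩
    · rw [hr] at h1
      have h2 : ¬ reach j v := @Nat.find_min (fun j => reach j v) (Classical.decPred _) (hreach v) j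
        (show j < r v by omega)
      rcases h1 with h1 | ⟨w, h3, h4⟩
      · exact absurd h1 h2
      · refine ⟨some w, fun w' hw' => ?_, h4.2⟩
        obtain rfl := Option.some_injective _ hw'
        exact ⟨h4.1, Nat.lt_succ_of_le (@Nat.find_min' (fun j => reach j w) (Classical.decPred _) (hreach w) j h3)⟩
  choose p hp using hex
  exact ⟨p, r, fun v w h => (hp v).1 w h, fun v => (hp v).2⟩

lemma shift_eq_of_shifted_eq (hlam : ∀ v, 0 ≤ lam v) (hlam8 : ∀ v, lam v ≤ 1 / 8)
    (htau : ∀ v, 0 ≤ tau v) {a : ℝ} (ha : |a| ≤ 1) {φ φ' : V → ℝ}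
    (h : shifted G lam tau a φ = shifted G lam tau a φ') :
    shift G lam tau φ = shift G lam tau φ' := by
  classical
  by_contra hne
  set s := shift G lam tau φ with hs
  set s' := shift G lam tau φ' with hs'
  have hφ : ∀ v, φ v - φ' v = a * (s' v - s v) := by
    intro v
    have := congrFun h v
    simp only [shifted] at this
    linarith
  obtain ⟨v₀, hv₀⟩ : ∃ v, s v ≠ s' v := by
    by_contra hcon
    push Not at hcon
    exact hne (funext hcon)
  obtain ⟨v₁, hv₁, hmin⟩ := (Finset.univ.filter fun v => s v ≠ s' v).exists_min_image
    (fun v => min (s v) (s' v)) ⟨v₀, by simpa using hv₀⟩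
  simp only [Finset.mem_filter, Finset.mem_univ, true_and] at hv₁ hmin
  have key : ∀ (ψ ψ' : V → ℝ) (t t' : V → ℝ), t = shift G lam tau ψ → t' = shift G lam tau ψ' →
      (∀ v, |ψ v - ψ' v| ≤ |t v - t' v|) → (∀ v, t v = t' v → ψ v = ψ' v) → ∀ u, t u < t' u →
      ¬ ∀ v, t v ≠ t' v → t u ≤ min (t v) (t' v) := by
    intro ψ ψ' t t' ht ht' habs heq u hu hmin
    obtain ⟨v, ⟨hv1, hv2⟩, hv⟩ := exists_tight (G := G) hlam htau ψ (W := {v | t v = t u ∧ t v < t' v})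
      ⟨u, rfl, hu⟩
    rw [← ht] at hv
    rcases hv with hv | ⟨w, hw, hvw, hv⟩
    · have := shift_le (G := G) hlam htau ψ' v
      rw [← ht', ← hv] at this
      linarith
    · have hl := edgeLength_nonneg hlam ψ v w
      by_cases hw' : t w = t' w
      · have h1 := shift_le_add (tau := tau) hlam htau ψ' hvw
        rw [← ht'] at h1
        have h2 := abs_edgeLength_sub_le hlam hlam8 (v := v) (heq w hw')
        have h3 := habs v
        rw [abs_sub_comm (t v), abs_of_pos (sub_pos.2 hv2)] at h3
        have h4 := (abs_le.1 h2).1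
        linarith
      · have h1 := hmin w hw'
        refine hw ⟨le_antisymm (by linarith) (h1.trans (min_le_left _ _)), ?_⟩
        exact lt_of_le_of_ne (by linarith [h1.trans (min_le_right (t w) (t' w))]) hw'
  have habs : ∀ v, |φ v - φ' v| ≤ |s v - s' v| := by
    intro v
    rw [hφ, abs_mul, abs_sub_comm (s' v)]
    exact mul_le_of_le_one_left (abs_nonneg _) ha
  have heq : ∀ v, s v = s' v → φ v = φ' v := by
    intro v hv
    have := hφ v
    rw [hv] at this
    linarith
  rcases lt_or_gt_of_ne hv₁ with hlt | hlt
  · refine key φ φ' s s' hs hs' habs heq v₁ hlt fun v hv => ?_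
    rw [← min_eq_left hlt.le]
    exact hmin v hv
  · refine key φ' φ s' s hs' hs (fun v => by rw [abs_sub_comm, abs_sub_comm (s' v)]; exact habs v)
      (fun v hv => (heq v hv.symm).symm) v₁ hlt fun v hv => ?_
    rw [← min_eq_right hlt.le, min_comm (s' v)]
    exact hmin v hv.symm

lemma shifted_injective (hlam : ∀ v, 0 ≤ lam v) (hlam8 : ∀ v, lam v ≤ 1 / 8)
    (htau : ∀ v, 0 ≤ tau v) {a : ℝ} (ha : |a| ≤ 1) :
    Function.Injective (shifted G lam tau a) := by
  intro φ φ' h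
  have hs := shift_eq_of_shifted_eq hlam hlam8 htau ha h
  funext v
  have := congrFun h v
  simp only [shifted, hs] at this
  linarith

end Shift

section Transport

variable {V : Type*} [Fintype V] (G : SimpleGraph V) [DecidableRel G.Adj] (lam tau : V → ℝ)

/-- The height functions for which the shift is tight with respect to given parents. -/
def parentSet (p : V → Option V) : Set (V → ℝ) :=
  {φ | ∀ v, shift G lam tau φ v = (p v).elim (tau v)
    fun w => shift G lam tau φ w + edgeLength lam φ v w}

variable {G lam tau}

lemma measurableSet_parentSet (p : V → Option V) : MeasurableSet (parentSet G lam tau p) := by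
  simp only [parentSet, Set.ofPred_forall]
  refine MeasurableSet.iInter fun v => measurableSet_eq_fun (measurable_shift v) ?_
  cases p v with
  | none => exact measurable_const
  | some w => exact (measurable_shift w).add (measurable_edgeLength v w)

lemma hasFDerivAt_edgeLength (φ : V → ℝ) (v w : V) :
    HasFDerivAt (fun φ : V → ℝ => edgeLength lam φ v w)
      ((min (lam v) (lam w) * (-4 * (φ v - φ w) * max 0 (1 - (φ v - φ w) ^ 2))) •
        (ContinuousLinearMap.proj (R := ℝ) (φ := fun _ : V => ℝ) v -
          ContinuousLinearMap.proj (R := ℝ) (φ := fun _ : V => ℝ) w)) φ := by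
  have h1 : HasFDerivAt (fun φ : V → ℝ => φ v - φ w)
      (ContinuousLinearMap.proj (R := ℝ) (φ := fun _ : V => ℝ) v -
        ContinuousLinearMap.proj (R := ℝ) (φ := fun _ : V => ℝ) w) φ :=
    (hasFDerivAt_apply v φ).sub (hasFDerivAt_apply w φ)
  have h2 := (((hasDerivAt_profile (φ v - φ w)).comp_hasFDerivAt φ h1).const_mul
    (min (lam v) (lam w)))
  rw [smul_smul] at h2
  exact h2

lemma exists_hasFDerivWithinAt_shift [DecidableEq V] (hlam : ∀ v, 0 ≤ lam v)
    {p : V → Option V} {r : V → ℕ} (hp : ∀ v w, p v = some w → G.Adj v w ∧ r w < r v) {φ : V → ℝ}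
    (hφ : φ ∈ parentSet G lam tau p) (v : V) :
    ∃ L : (V → ℝ) →L[ℝ] ℝ,
      HasFDerivWithinAt (fun φ => shift G lam tau φ v) L (parentSet G lam tau p) φ ∧
      (∀ u, u ≠ v → L (Pi.single u 1) ≠ 0 → r u < r v) ∧ |L (Pi.single v 1)| ≤ 4 * lam v := by
  induction hr : r v using Nat.strong_induction_on generalizing v with
  | _ k ih =>
    cases hpv : p v with
    | none =>
      refine ⟨0, ?_, by simp, by simpa using hlam v⟩
      refine (hasFDerivWithinAt_const (tau v) φ _).congr (fun ψ hψ => ?_) ?_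
      · have := hψ v
        rw [hpv] at this
        exact this
      · have := hφ v
        rw [hpv] at this
        exact this
    | some w =>
      obtain ⟨hadj, hrw⟩ := hp v w hpv
      have hvw : v ≠ w := hadj.ne
      obtain ⟨L, hL, hLr, -⟩ := ih (r w) (hr ▸ hrw) w rfl
      have hder := hL.add (hasFDerivAt_edgeLength (lam := lam) φ v w).hasFDerivWithinAt
      refine ⟨_, hder.congr (fun ψ hψ => ?_) ?_, fun u hu hne => ?_, ?_⟩
      · have := hψ v
        rw [hpv] at this
        exact this
      · have := hφ v
        rw [hpv] at this
        exact this
      · subst hr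
        rcases eq_or_ne u w with rfl | huw
        · exact hrw
        · refine (hLr u huw ?_).trans hrw
          intro h0
          apply hne
          simp [h0, hu.symm, huw.symm]
      · have h0 : L (Pi.single v 1) = 0 := by
          by_contra h0
          exact absurd (hLr v hvw h0) (not_lt.2 hrw.le)
        simp only [add_apply, smul_apply, sub_apply, ContinuousLinearMap.proj_apply, Pi.single_eq_same,
          Pi.single_eq_of_ne hvw.symm, h0, sub_zero, zero_add, smul_eq_mul, mul_one]
        rw [abs_mul, mul_comm 4]
        refine mul_le_mul ?_ (abs_deriv_profile_le _) (abs_nonneg _) (hlam v)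
        rw [abs_of_nonneg (le_min (hlam v) (hlam w))]
        exact min_le_left _ _

lemma exists_hasFDerivWithinAt_shifted (hlam : ∀ v, 0 ≤ lam v) {p : V → Option V} {r : V → ℕ}
    (hp : ∀ v w, p v = some w → G.Adj v w ∧ r w < r v) {φ : V → ℝ}
    (hφ : φ ∈ parentSet G lam tau p) :
    ∃ b : V → ℝ, (∀ v, |b v| ≤ 4 * lam v) ∧ ∀ a : ℝ, ∃ T : (V → ℝ) →L[ℝ] (V → ℝ),
      HasFDerivWithinAt (shifted G lam tau a) T (parentSet G lam tau p) φ ∧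
        T.det = ∏ v, (1 + a * b v) := by
  classical
  choose L hL hLr hLb using exists_hasFDerivWithinAt_shift hlam hp hφ
  refine ⟨fun v => L v (Pi.single v 1), hLb, fun a => ?_⟩
  refine ⟨ContinuousLinearMap.pi fun v =>
    ContinuousLinearMap.proj (R := ℝ) (φ := fun _ : V => ℝ) v + a • L v, ?_, ?_⟩
  · rw [hasFDerivWithinAt_pi]
    exact fun v => (hasFDerivAt_apply v φ).hasFDerivWithinAt.add ((hL v).const_mul a)
  · rw [ContinuousLinearMap.det, ← LinearMap.det_toMatrix', Matrix.det_of_rank _ r]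
    · refine Finset.prod_congr rfl fun v _ => ?_
      simp [LinearMap.toMatrix'_apply]
    · intro v u huv h
      refine hLr v u huv fun h0 => h ?_
      simp [LinearMap.toMatrix'_apply, h0, huv.symm]

/-- A lower bound for integrals over sets that contain both shifts of a given set. -/
lemma lintegral_le_of_shifted (hlam : ∀ v, 0 ≤ lam v) (hlam8 : ∀ v, lam v ≤ 1 / 8)
    (htau : ∀ v, 0 ≤ tau v) {F : (V → ℝ) → ℝ≥0∞} (hF : Measurable F) (c : ℝ≥0∞)
    {A B B' : Set (V → ℝ)} (hA : MeasurableSet A)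
    (hB : ∀ φ ∈ A, shifted G lam tau 1 φ ∈ B) (hB' : ∀ φ ∈ A, shifted G lam tau (-1) φ ∈ B')
    (hc : ∀ φ ∈ A, ∀ b : V → ℝ, (∀ v, |b v| ≤ 4 * lam v) →
      c * F φ ≤ ENNReal.ofReal (∏ v, (1 + b v)) * F (shifted G lam tau 1 φ) +
        ENNReal.ofReal (∏ v, (1 - b v)) * F (shifted G lam tau (-1) φ)) :
    c * ∫⁻ φ in A, F φ ≤ (∫⁻ φ in B, F φ) + ∫⁻ φ in B', F φ := by
  classical
  let I := {p : V → Option V // ∃ r : V → ℕ, ∀ v w, p v = some w → G.Adj v w ∧ r w < r v}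
  let e : Fin (Fintype.card I) ≃ I := (Fintype.equivFin I).symm
  let Q : Fin (Fintype.card I) → Set (V → ℝ) := fun i => parentSet G lam tau (e i).1
  have hQm : ∀ i, MeasurableSet (Q i) := fun i => measurableSet_parentSet _
  have hQ : ⋃ i, Q i = Set.univ := by
    refine Set.eq_univ_of_forall fun φ => ?_
    obtain ⟨p, r, hp, hφ⟩ := exists_parent (G := G) hlam htau φ
    refine Set.mem_iUnion.2 ⟨e.symm ⟨p, r, hp⟩, ?_⟩
    simp only [Q, Equiv.apply_symm_apply]
    exact hφ
  let D : Fin (Fintype.card I) → Set (V → ℝ) := fun i => A ∩ disjointed Q i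
  have hDm : ∀ i, MeasurableSet (D i) := fun i => by
    refine hA.inter ?_
    rw [disjointed_apply, Finset.sup_set_eq_biUnion]
    exact (hQm i).diff (Finset.measurableSet_biUnion _ fun j _ => hQm j)
  have hDQ : ∀ i, D i ⊆ Q i := fun i => Set.inter_subset_right.trans (disjointed_subset Q i)
  have hDA : ∀ i, D i ⊆ A := fun i => Set.inter_subset_left
  have hDd : Pairwise (Function.onFun Disjoint D) := fun i j hij =>
    (disjoint_disjointed Q hij).mono Set.inter_subset_right Set.inter_subset_right
  have hDu : ⋃ i, D i = A := by
    rw [← Set.inter_iUnion, iUnion_disjointed, hQ, Set.inter_univ]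
  have hcv : ∀ (a : ℝ), |a| ≤ 1 → ∀ (X : Set (V → ℝ)), (∀ φ ∈ A, shifted G lam tau a φ ∈ X) →
      ∑ i, ∫⁻ φ in shifted G lam tau a '' D i, F φ ≤ ∫⁻ φ in X, F φ := by
    intro a ha X hX
    have hinj : Function.Injective (shifted G lam tau a) := shifted_injective hlam hlam8 htau ha
    rw [← tsum_fintype (L := .unconditional _), ← lintegral_iUnion]
    · refine lintegral_mono_set ?_
      rw [← Set.image_iUnion, hDu]
      exact Set.image_subset_iff.2 hX
    · exact fun i => (hDm i).image_of_measurable_injOn (measurable_shifted a) hinj.injOn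
    · intro i j hij
      exact (Set.disjoint_image_iff hinj).2 (hDd hij)
  have hpiece : ∀ i, c * ∫⁻ φ in D i, F φ ≤ (∫⁻ φ in shifted G lam tau 1 '' D i, F φ) +
      ∫⁻ φ in shifted G lam tau (-1) '' D i, F φ := by
    intro i
    obtain ⟨r, hr⟩ := (e i).2
    have hex : ∀ φ : V → ℝ, ∃ b : V → ℝ, φ ∈ D i → (∀ v, |b v| ≤ 4 * lam v) ∧
        ∀ a : ℝ, ∃ T : (V → ℝ) →L[ℝ] (V → ℝ),
        HasFDerivWithinAt (shifted G lam tau a) T (D i) φ ∧ T.det = ∏ v, (1 + a * b v) := by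
      intro φ
      by_cases hφ : φ ∈ D i
      · obtain ⟨b, hb, hT⟩ := exists_hasFDerivWithinAt_shifted hlam hr (hDQ i hφ)
        refine ⟨b, fun _ => ⟨hb, fun a => ?_⟩⟩
        obtain ⟨T, hT1, hT2⟩ := hT a
        exact ⟨T, hT1.mono (hDQ i), hT2⟩
      · exact ⟨0, fun h => absurd h hφ⟩
    choose b hb using hex
    have himage : ∀ a : ℝ, |a| ≤ 1 → ∫⁻ φ in shifted G lam tau a '' D i, F φ =
        ∫⁻ φ in D i, ENNReal.ofReal (∏ v, (1 + a * b φ v)) * F (shifted G lam tau a φ) ∧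
        AEMeasurable (fun φ => ENNReal.ofReal (∏ v, (1 + a * b φ v)))
          (volume.restrict (D i)) := by
      intro a ha
      have hex' : ∀ φ : V → ℝ, ∃ T : (V → ℝ) →L[ℝ] (V → ℝ), φ ∈ D i →
          HasFDerivWithinAt (shifted G lam tau a) T (D i) φ ∧ T.det = ∏ v, (1 + a * b φ v) := by
        intro φ
        by_cases hφ : φ ∈ D i
        · obtain ⟨T, hT⟩ := (hb φ hφ).2 a
          exact ⟨T, fun _ => hT⟩
        · exact ⟨0, fun h => absurd h hφ⟩
      choose T hT using hex'
      have hdet : ∀ φ ∈ D i, ENNReal.ofReal |(T φ).det| =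
          ENNReal.ofReal (∏ v, (1 + a * b φ v)) := by
        intro φ hφ
        rw [(hT φ hφ).2, abs_of_nonneg]
        refine Finset.prod_nonneg fun v _ => ?_
        have h1 := (hb φ hφ).1 v
        have h2 := hlam8 v
        have h3 : |a * b φ v| ≤ 1 := by
          rw [abs_mul]
          calc |a| * |b φ v| ≤ 1 * |b φ v| := by gcongr
            _ ≤ 1 := by linarith
        linarith [(abs_le.1 h3).1]
      have hder := fun φ hφ => (hT φ hφ).1
      constructor
      · rw [lintegral_image_eq_lintegral_abs_det_fderiv_mul volume (hDm i) hder
          (shifted_injective hlam hlam8 htau ha).injOn]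
        exact setLIntegral_congr_fun (hDm i) fun φ hφ => by rw [hdet φ hφ]
      · exact (aemeasurable_ofReal_abs_det_fderivWithin volume (hDm i) hder).congr
          (ae_restrict_of_forall_mem (hDm i) hdet)
    rw [(himage 1 (by simp)).1, (himage (-1) (by simp)).1, ← lintegral_const_mul c hF]
    refine le_trans ?_ (lintegral_add_left'
      (f := fun φ => ENNReal.ofReal (∏ v, (1 + 1 * b φ v)) * F (shifted G lam tau 1 φ))
      ((himage 1 (by simp)).2.mul (hF.comp (measurable_shifted 1)).aemeasurable) _).le
    refine setLIntegral_mono' (hDm i) fun φ hφ => ?_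
    simpa [sub_eq_add_neg] using hc φ (hDA i hφ) (b φ) (hb φ hφ).1
  calc c * ∫⁻ φ in A, F φ = ∑ i, c * ∫⁻ φ in D i, F φ := by
        rw [← Finset.mul_sum, ← hDu, lintegral_iUnion hDm hDd, tsum_fintype]
    _ ≤ ∑ i, ((∫⁻ φ in shifted G lam tau 1 '' D i, F φ) +
        ∫⁻ φ in shifted G lam tau (-1) '' D i, F φ) := Finset.sum_le_sum fun i _ => hpiece i
    _ ≤ _ := by
        rw [Finset.sum_add_distrib]
        exact add_le_add (hcv 1 (by simp) B hB) (hcv (-1) (by simp) B' hB')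

end Transport

/-- A function of class `C²` on `[-1,1]` has bounded second differences. -/
lemma exists_second_difference_le {u : ℝ → ℝ} (hu : ContDiffOn ℝ 2 u (Set.Icc (-1) 1)) :
    ∃ C : ℝ, 0 ≤ C ∧ ∀ x d : ℝ, |x| + |d| ≤ 1 → u (x + d) + u (x - d) ≤ 2 * u x + C * d ^ 2 := by
  have hI : UniqueDiffOn ℝ (Set.Icc (-1 : ℝ) 1) := uniqueDiffOn_Icc (by norm_num)
  have h1 : ContDiffOn ℝ 1 (derivWithin u (Set.Icc (-1) 1)) (Set.Icc (-1) 1) :=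
    hu.derivWithin hI (by norm_num)
  have h2 : ContinuousOn (derivWithin (derivWithin u (Set.Icc (-1) 1)) (Set.Icc (-1) 1))
      (Set.Icc (-1) 1) := h1.continuousOn_derivWithin hI le_rfl
  obtain ⟨C, hC⟩ := isCompact_Icc.exists_bound_of_continuousOn h2
  have hlip : ∀ x ∈ Set.Icc (-1 : ℝ) 1, ∀ y ∈ Set.Icc (-1 : ℝ) 1,
      ‖derivWithin u (Set.Icc (-1) 1) y - derivWithin u (Set.Icc (-1) 1) x‖ ≤ C * ‖y - x‖ :=
    fun x hx y hy => (convex_Icc (-1 : ℝ) 1).norm_image_sub_le_of_norm_derivWithin_le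
      (h1.differentiableOn one_ne_zero) hC hx hy
  have hC0 : 0 ≤ C := (norm_nonneg _).trans (hC 0 (by norm_num))
  have hderiv : ∀ x ∈ Set.Ioo (-1 : ℝ) 1, HasDerivAt (fun x => u x - C / 2 * x ^ 2)
      (derivWithin u (Set.Icc (-1) 1) x - C * x) x := by
    intro x hx
    have h3 : HasDerivAt u (derivWithin u (Set.Icc (-1) 1) x) x :=
      ((hu.differentiableOn two_ne_zero x (Set.Ioo_subset_Icc_self hx)).hasDerivWithinAt).hasDerivAt
        (Icc_mem_nhds hx.1 hx.2)
    refine (h3.sub ((hasDerivAt_pow 2 x).const_mul (C / 2))).congr_deriv ?_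
    simp only [Nat.cast_ofNat, Nat.add_one_sub_one, pow_one]
    ring
  have hconc : ConcaveOn ℝ (Set.Icc (-1) 1) fun x => u x - C / 2 * x ^ 2 := by
    refine AntitoneOn.concaveOn_of_deriv (convex_Icc _ _)
      (hu.continuousOn.sub (by fun_prop)) ?_ ?_ <;> rw [interior_Icc]
    · exact fun x hx => (hderiv x hx).differentiableAt.differentiableWithinAt
    · intro x hx y hy hxy
      rw [(hderiv x hx).deriv, (hderiv y hy).deriv]
      have := hlip x (Set.Ioo_subset_Icc_self hx) y (Set.Ioo_subset_Icc_self hy)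
      rw [Real.norm_of_nonneg (sub_nonneg.2 hxy)] at this
      have := (le_abs_self _).trans this
      linarith
  refine ⟨C, hC0, fun x d hxd => ?_⟩
  have h3 : x + d ∈ Set.Icc (-1 : ℝ) 1 := abs_le.1 ((abs_add_le _ _).trans hxd)
  have h4 : x - d ∈ Set.Icc (-1 : ℝ) 1 := abs_le.1 ((abs_sub _ _).trans hxd)
  have h5 := hconc.2 h3 h4 (show (0 : ℝ) ≤ 1 / 2 by norm_num) (show (0 : ℝ) ≤ 1 / 2 by norm_num)
    (by norm_num)
  simp only [smul_eq_mul] at h5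
  rw [show 1 / 2 * (x + d) + 1 / 2 * (x - d) = x by ring] at h5
  nlinarith

lemma exp_neg_two_mul_le {x : ℝ} (hx0 : 0 ≤ x) (hx : x ≤ 1 / 2) : Real.exp (-(2 * x)) ≤ 1 - x := by
  rw [Real.exp_neg, inv_le_comm₀ (Real.exp_pos _) (by linarith)]
  refine le_trans ?_ (Real.add_one_le_exp _)
  rw [inv_le_iff_one_le_mul₀ (by linarith)]
  nlinarith

lemma exp_le_prod_mul_prod {V : Type*} [Fintype V] {lam b : V → ℝ} (hlam : ∀ v, 0 ≤ lam v)
    (hlam8 : ∀ v, lam v ≤ 1 / 8) (hb : ∀ v, |b v| ≤ 4 * lam v) :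
    Real.exp (-(32 * ∑ v, lam v ^ 2)) ≤ (∏ v, (1 + b v)) * ∏ v, (1 - b v) := by
  rw [Finset.mul_sum, ← Finset.sum_neg_distrib, Real.exp_sum, ← Finset.prod_mul_distrib]
  refine Finset.prod_le_prod (fun v _ => (Real.exp_pos _).le) fun v _ => ?_
  have h1 : b v ^ 2 ≤ 16 * lam v ^ 2 := by
    rw [← sq_abs]
    nlinarith [hb v, abs_nonneg (b v), hlam v]
  have h2 : lam v ^ 2 ≤ 1 / 64 := by nlinarith [hlam v, hlam8 v]
  calc Real.exp (-(32 * lam v ^ 2)) ≤ Real.exp (-(2 * b v ^ 2)) :=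
        Real.exp_le_exp.2 (by linarith)
    _ ≤ 1 - b v ^ 2 := exp_neg_two_mul_le (sq_nonneg _) (by linarith)
    _ = _ := by ring

lemma ofReal_mul_le_add {F F₁ F₂ : ℝ≥0∞} {a κ p q : ℝ} (h₁ : F₁ ≠ ⊤) (h₂ : F₂ ≠ ⊤)
    (hF : ENNReal.ofReal κ * F ^ 2 ≤ F₁ * F₂) (hκ : 0 < κ) (hp : 0 ≤ p) (hq : 0 ≤ q)
    (hpq : a ^ 2 ≤ p * q * κ) :
    ENNReal.ofReal (2 * a) * F ≤ ENNReal.ofReal p * F₁ + ENNReal.ofReal q * F₂ := by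
  have hFtop : F ≠ ⊤ := by
    rintro rfl
    rw [ENNReal.top_pow two_ne_zero, ENNReal.mul_top (by simpa using hκ), top_le_iff] at hF
    exact ENNReal.mul_ne_top h₁ h₂ hF
  lift F to NNReal using hFtop
  lift F₁ to NNReal using h₁
  lift F₂ to NNReal using h₂
  have hreal : κ * (F : ℝ) ^ 2 ≤ F₁ * F₂ := by
    have := ENNReal.toReal_mono (by finiteness) hF
    simpa [hκ.le] using this
  rw [← ENNReal.ofReal_coe_nnreal, ← ENNReal.ofReal_coe_nnreal (p := F₁),
    ← ENNReal.ofReal_coe_nnreal (p := F₂), ← ENNReal.ofReal_mul hp, ← ENNReal.ofReal_mul hq,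
    ← ENNReal.ofReal_add (by positivity) (by positivity),
    ← ENNReal.ofReal_mul' F.coe_nonneg]
  refine ENNReal.ofReal_le_ofReal ((le_abs_self _).trans
    (abs_le_of_sq_le_sq ?_ (by positivity)))
  have h3 : a ^ 2 * (F : ℝ) ^ 2 ≤ p * q * (F₁ * F₂) := by
    calc a ^ 2 * (F : ℝ) ^ 2 ≤ p * q * κ * (F : ℝ) ^ 2 := by gcongr
      _ = p * q * (κ * (F : ℝ) ^ 2) := by ring
      _ ≤ _ := by gcongr
  nlinarith [sq_nonneg (p * F₁ - q * F₂)]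

namespace Potential

variable {U : Potential}

lemma exists_boltzmann_mul_ge (hC2 : U.IsC2OnUnit) :
    ∃ C : ℝ, 0 ≤ C ∧ ∀ x d : ℝ, |d| ≤ 1 / 8 * profile x →
      ENNReal.ofReal (Real.exp (-(C * d ^ 2))) * U.boltzmann x ^ 2 ≤
        U.boltzmann (x + d) * U.boltzmann (x - d) := by
  obtain ⟨C, hC0, hC⟩ := exists_second_difference_le hC2.2
  refine ⟨C, hC0, fun x d hd => ?_⟩
  have hreal : ∀ x : ℝ, |x| ≤ 1 → U.boltzmann x = ENNReal.ofReal (Real.exp (-(U x).toReal)) := by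
    intro x hx
    lift U x to ℝ using ⟨hC2.1 x (abs_le.1 hx), U.ne_bot x⟩ with y hy
    rw [boltzmann, ← hy, ← EReal.coe_neg, EReal.exp_coe, EReal.toReal_coe]
  rcases le_or_gt 1 |x| with hx | hx
  · rw [profile_eq_zero hx, mul_zero, abs_nonpos_iff] at hd
    simp [hd, sq]
  · have h1 : |x| + |d| ≤ 1 := by linarith [profile_le hx.le]
    rw [hreal x hx.le, hreal _ ((abs_add_le _ _).trans h1), hreal _ ((abs_sub _ _).trans h1),
      ← ENNReal.ofReal_pow (Real.exp_pos _).le, ← ENNReal.ofReal_mul (Real.exp_pos _).le,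
      ← ENNReal.ofReal_mul (Real.exp_pos _).le, ← Real.exp_nat_mul, ← Real.exp_add,
      ← Real.exp_add]
    refine ENNReal.ofReal_le_ofReal (Real.exp_le_exp.2 ?_)
    have := hC x d h1
    push_cast
    linarith

lemma exists_weight_mul_ge (hC2 : U.IsC2OnUnit) :
    ∃ C : ℝ, 0 ≤ C ∧ ∀ (n : ℕ) [NeZero n], 2 ≤ n → ∀ lam tau : TorusVertex n → ℝ,
      (∀ v, 0 ≤ lam v) → (∀ v, lam v ≤ 1 / 8) → (∀ v, 0 ≤ tau v) → ∀ φ : TorusVertex n → ℝ,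
      ENNReal.ofReal (Real.exp (-(C * ∑ v, lam v ^ 2))) * U.weight n φ ^ 2 ≤
        U.weight n (shifted (torus n) lam tau 1 φ) *
          U.weight n (shifted (torus n) lam tau (-1) φ) := by
  obtain ⟨C, hC0, hC⟩ := exists_boltzmann_mul_ge hC2
  refine ⟨2 * C, by positivity, fun n _ hn lam tau hlam hlam8 htau φ => ?_⟩
  set s := shift (torus n) lam tau φ with hs
  have hsum : ∑ d : DirEdge n, -(C * lam d.1 ^ 2) = -(2 * C * ∑ v, lam v ^ 2) := by
    rw [Fintype.sum_prod_type]
    simp only [Fintype.sum_bool, Finset.mul_sum, ← Finset.sum_neg_distrib]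
    exact Finset.sum_congr rfl fun v _ => by ring
  rw [weight_eq_prod U hn, weight_eq_prod U hn, weight_eq_prod U hn, ← hsum, Real.exp_sum,
    ENNReal.ofReal_prod_of_nonneg fun _ _ => (Real.exp_pos _).le, ← Finset.prod_pow,
    ← Finset.prod_mul_distrib, ← Finset.prod_mul_distrib]
  refine Finset.prod_le_prod' fun d _ => ?_
  have hadj : (torus n).Adj d.1 (d.1 + dirVec n d.2) := torus_adj_iff.2 ⟨d.2, Or.inl rfl⟩
  have h1 := abs_shift_sub_le hlam htau φ hadj
  have hplus : edgeGrad (shifted (torus n) lam tau 1 φ) d =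
      edgeGrad φ d + (s d.1 - s (d.1 + dirVec n d.2)) := by
    simp only [edgeGrad, shifted]; ring
  have hminus : edgeGrad (shifted (torus n) lam tau (-1) φ) d =
      edgeGrad φ d - (s d.1 - s (d.1 + dirVec n d.2)) := by
    simp only [edgeGrad, shifted]; ring
  rw [hplus, hminus]
  have h2 : |s d.1 - s (d.1 + dirVec n d.2)| ≤ lam d.1 :=
    h1.trans ((edgeLength_le hlam φ _ _).trans (min_le_left _ _))
  refine le_trans ?_ (hC _ _ (h1.trans ?_))
  · gcongr ENNReal.ofReal (Real.exp (-(C * ?_))) * _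
    exact sq_le_sq' (by linarith [(abs_le.1 h2).1]) (abs_le.1 h2).2
  · exact mul_le_mul_of_nonneg_right ((min_le_left _ _).trans (hlam8 _)) (profile_nonneg _)

/-- The cost of shifting a set of height functions up and down. -/
lemma exists_lintegral_weight_le (hC2 : U.IsC2OnUnit) :
    ∃ K : ℝ, 0 ≤ K ∧ ∀ (n : ℕ) [NeZero n], 2 ≤ n → ∀ lam tau : TorusVertex n → ℝ,
      (∀ v, 0 ≤ lam v) → (∀ v, lam v ≤ 1 / 8) → (∀ v, 0 ≤ tau v) →
      ∀ A B B' : Set (TorusVertex n → ℝ), MeasurableSet A →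
      (∀ φ ∈ A, shifted (torus n) lam tau 1 φ ∈ B) →
      (∀ φ ∈ A, shifted (torus n) lam tau (-1) φ ∈ B') →
      ENNReal.ofReal (2 * Real.exp (-(K * ∑ v, lam v ^ 2))) * ∫⁻ φ in A, U.weight n φ ≤
        (∫⁻ φ in B, U.weight n φ) + ∫⁻ φ in B', U.weight n φ := by
  obtain ⟨C, hC0, hC⟩ := exists_weight_mul_ge hC2
  refine ⟨(C + 32) / 2, by positivity, fun n _ hn lam tau hlam hlam8 htau A B B' hA hB hB' => ?_⟩
  refine lintegral_le_of_shifted hlam hlam8 htau (measurable_weight U hn) _ hA hB hB'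
    fun φ _ b hb => ?_
  have hb1 : ∀ v, |b v| ≤ 1 / 2 := fun v => (hb v).trans (by linarith [hlam8 v])
  refine ofReal_mul_le_add (weight_ne_top U hn _) (weight_ne_top U hn _)
    (hC n hn lam tau hlam hlam8 htau φ) (Real.exp_pos _)
    (Finset.prod_nonneg fun v _ => by linarith [(abs_le.1 (hb1 v)).1])
    (Finset.prod_nonneg fun v _ => by linarith [(abs_le.1 (hb1 v)).2]) ?_
  refine le_trans (le_of_eq ?_) (mul_le_mul_of_nonneg_right
    (exp_le_prod_mul_prod hlam hlam8 hb) (Real.exp_pos _).le)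
  rw [← Real.exp_nat_mul, ← Real.exp_add]
  congr 1
  push_cast
  ring

end Potential

section TorusDist

variable {n : ℕ}

/-- The distance of a residue modulo `n` to zero. -/
def ZMod.absVal (a : ZMod n) : ℕ := a.valMinAbs.natAbs

lemma ZMod.absVal_neg (a : ZMod n) : (-a).absVal = a.absVal := ZMod.natAbs_valMinAbs_neg a

lemma ZMod.absVal_zero : (0 : ZMod n).absVal = 0 := by simp [ZMod.absVal]

lemma ZMod.absVal_add_le (a b : ZMod n) : (a + b).absVal ≤ a.absVal + b.absVal :=
  (ZMod.natAbs_valMinAbs_add_le a b).trans (Int.natAbs_add_le _ _)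

lemma ZMod.absVal_natCast {k : ℕ} (hk : k ≤ n / 2) : (k : ZMod n).absVal = k := by
  rw [ZMod.absVal, ZMod.valMinAbs_natCast_of_le_half hk, Int.natAbs_natCast]

lemma ZMod.absVal_one_le : (1 : ZMod n).absVal ≤ 1 := by
  rcases Nat.lt_or_ge n 2 with h | h
  · interval_cases n
    · decide
    · decide
  · have := ZMod.absVal_natCast (n := n) (k := 1) (by omega)
    rw [Nat.cast_one] at this
    exact this.le

lemma ZMod.eq_or_eq_neg_absVal (a : ZMod n) : a = (a.absVal : ZMod n) ∨ a = -(a.absVal : ZMod n) := by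
  have h := ZMod.coe_valMinAbs a
  rcases Int.natAbs_eq a.valMinAbs with h' | h' <;> rw [h'] at h
  · exact Or.inl (h.symm.trans (by rw [Int.cast_natCast, ZMod.absVal]))
  · exact Or.inr (h.symm.trans (by rw [Int.cast_neg, Int.cast_natCast, ZMod.absVal]))

lemma ZMod.sum_absVal_le [NeZero n] {h : ℕ → ℝ} (h0 : ∀ i, 0 ≤ h i) {R : ℕ}
    (hR : ∀ i, R ≤ i → h i = 0) : ∑ a : ZMod n, h a.absVal ≤ 2 * ∑ i ∈ Finset.range R, h i := by
  have h1 : ∑ a : ZMod n, h a.absVal =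
      ∑ a ∈ Finset.univ.filter (fun a : ZMod n => a.absVal < R), h a.absVal := by
    refine (Finset.sum_subset (Finset.filter_subset _ _) fun a _ ha => hR _ ?_).symm
    simpa using ha
  rw [h1, ← Finset.sum_fiberwise_of_maps_to (t := Finset.range R) (g := ZMod.absVal)
    (fun a ha => Finset.mem_range.2 (Finset.mem_filter.1 ha).2), Finset.mul_sum]
  refine Finset.sum_le_sum fun i _ => ?_
  rw [Finset.sum_congr rfl fun a ha => by rw [(Finset.mem_filter.1 ha).2], Finset.sum_const,
    nsmul_eq_mul]
  refine mul_le_mul_of_nonneg_right ?_ (h0 i)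
  have h2 : (Finset.univ.filter (fun a : ZMod n => a.absVal < R)).filter (fun a => a.absVal = i) ⊆
      {(i : ZMod n), -(i : ZMod n)} := by
    intro a ha
    have := (Finset.mem_filter.1 ha).2
    rw [Finset.mem_insert, Finset.mem_singleton, ← this]
    exact a.eq_or_eq_neg_absVal
  exact_mod_cast (Finset.card_le_card h2).trans Finset.card_le_two

/-- The distance of two vertices of the torus in the supremum metric. -/
def torusDist (v w : TorusVertex n) : ℕ := max (v.1 - w.1).absVal (v.2 - w.2).absVal

lemma torusDist_self (v : TorusVertex n) : torusDist v v = 0 := by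
  simp [torusDist, ZMod.absVal_zero]

lemma torusDist_triangle (u v w : TorusVertex n) :
    torusDist u w ≤ torusDist u v + torusDist v w := by
  refine max_le ?_ ?_
  · rw [← sub_add_sub_cancel u.1 v.1 w.1]
    exact (ZMod.absVal_add_le _ _).trans (add_le_add (le_max_left _ _) (le_max_left _ _))
  · rw [← sub_add_sub_cancel u.2 v.2 w.2]
    exact (ZMod.absVal_add_le _ _).trans (add_le_add (le_max_right _ _) (le_max_right _ _))

lemma torusDist_le_one {v w : TorusVertex n} (h : (torus n).Adj v w) : torusDist w v ≤ 1 := by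
  have h1 : ∀ a b : ZMod (2 * n), a - b = 1 ∨ b - a = 1 → (b - a).absVal ≤ 1 := by
    rintro a b (h | h)
    · rw [← neg_sub, h, ZMod.absVal_neg]; exact ZMod.absVal_one_le
    · rw [h]; exact ZMod.absVal_one_le
  rcases h with ⟨h2, h3⟩ | ⟨h2, h3⟩
  · exact max_le (by simp [h2, ZMod.absVal_zero]) (h1 _ _ h3)
  · exact max_le (h1 _ _ h3) (by simp [h2, ZMod.absVal_zero])

lemma le_torusDist_natCast {i j s : ℕ} (hi : i ≤ n) (hj : j ≤ n) (h : i + s ≤ j ∨ j + s ≤ i) :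
    s ≤ torusDist ((i : ZMod (2 * n)), (0 : ZMod (2 * n))) (j, 0) := by
  refine le_trans ?_ (le_max_left _ _)
  rcases h with h | h
  · simp only
    rw [← neg_sub, ZMod.absVal_neg, ← Nat.cast_sub (by omega), ZMod.absVal_natCast (by omega)]
    omega
  · simp only
    rw [← Nat.cast_sub (by omega), ZMod.absVal_natCast (by omega)]
    omega

lemma sum_sum_inv_sq_le (R : ℕ) :
    ∑ i ∈ Finset.range R, ∑ j ∈ Finset.range R, (1 / (1 + (max i j : ℕ)) : ℝ) ^ 2 ≤
      2 * (1 + Real.log R) := by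
  have h1 : ∀ i ∈ Finset.range R, ∀ j ∈ Finset.range R, (1 / (1 + (max i j : ℕ)) : ℝ) ^ 2 ≤
      (if j < i + 1 then (1 / (1 + (i : ℝ))) ^ 2 else 0) +
        if i < j + 1 then (1 / (1 + (j : ℝ))) ^ 2 else 0 := by
    intro i _ j _
    rcases le_total i j with h | h
    · rw [max_eq_right h, if_pos (Nat.lt_succ_of_le h)]
      exact le_add_of_nonneg_left (by split_ifs <;> positivity)
    · rw [max_eq_left h, if_pos (Nat.lt_succ_of_le h)]
      exact le_add_of_nonneg_right (by split_ifs <;> positivity)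
  have h2 : ∀ i ∈ Finset.range R, ∑ j ∈ Finset.range R,
      (if j < i + 1 then (1 / (1 + (i : ℝ))) ^ 2 else 0) ≤ ((i : ℝ) + 1)⁻¹ := by
    intro i _
    rw [← Finset.sum_filter, Finset.sum_const, nsmul_eq_mul]
    have : ((Finset.range R).filter fun j => j < i + 1).card ≤ i + 1 := by
      refine (Finset.card_le_card (t := Finset.range (i + 1)) fun j hj => ?_).trans
        (Finset.card_range _).le
      exact Finset.mem_range.2 (Finset.mem_filter.1 hj).2
    have h3 : (((Finset.range R).filter fun j => j < i + 1).card : ℝ) ≤ i + 1 := by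
      exact_mod_cast this
    calc _ ≤ ((i : ℝ) + 1) * (1 / (1 + (i : ℝ))) ^ 2 := by gcongr
      _ = _ := by field_simp; ring
  have h3 : ∑ i ∈ Finset.range R, ((i : ℝ) + 1)⁻¹ ≤ 1 + Real.log R := by
    refine le_trans (le_of_eq ?_) (harmonic_le_one_add_log R)
    simp [harmonic]
  calc _ ≤ ∑ i ∈ Finset.range R, ∑ j ∈ Finset.range R,
        ((if j < i + 1 then (1 / (1 + (i : ℝ))) ^ 2 else 0) +
          if i < j + 1 then (1 / (1 + (j : ℝ))) ^ 2 else 0) :=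
        Finset.sum_le_sum fun i hi => Finset.sum_le_sum fun j hj => h1 i hi j hj
    _ = ∑ i ∈ Finset.range R, ∑ j ∈ Finset.range R,
          (if j < i + 1 then (1 / (1 + (i : ℝ))) ^ 2 else 0) +
        ∑ j ∈ Finset.range R, ∑ i ∈ Finset.range R,
          (if i < j + 1 then (1 / (1 + (j : ℝ))) ^ 2 else 0) := by
        simp only [Finset.sum_add_distrib]
        congr 1
        exact Finset.sum_comm
    _ ≤ (1 + Real.log R) + (1 + Real.log R) :=
        add_le_add ((Finset.sum_le_sum h2).trans h3) ((Finset.sum_le_sum h2).trans h3)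
    _ = _ := by ring

end TorusDist

section Cone

variable {n : ℕ}

/-- The slope of the shift around `c`. -/
noncomputable def coneSlope (a : ℝ) (R : ℕ) (c v : TorusVertex n) : ℝ :=
  if torusDist v c < R then a * (1 / (1 + torusDist v c)) else 0

/-- The largest possible shift around `c`. -/
def coneBound (T : ℝ) (R : ℕ) (c v : TorusVertex n) : ℝ := if torusDist v c < R then T else 0

variable {a T : ℝ} {R : ℕ} {c : TorusVertex n}

lemma coneSlope_nonneg (ha : 0 ≤ a) (v : TorusVertex n) : 0 ≤ coneSlope a R c v := by
  unfold coneSlope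
  split_ifs <;> positivity

lemma coneSlope_le (ha : 0 ≤ a) (v : TorusVertex n) : coneSlope a R c v ≤ a := by
  unfold coneSlope
  split_ifs
  · refine mul_le_of_le_one_right ha ?_
    rw [div_le_one (by positivity)]
    exact le_add_of_nonneg_right (Nat.cast_nonneg _)
  · exact ha

lemma coneBound_nonneg (hT : 0 ≤ T) (v : TorusVertex n) : 0 ≤ coneBound T R c v := by
  unfold coneBound
  split_ifs <;> simp [hT]

lemma sum_coneSlope_sq_le [NeZero n] (c : TorusVertex n) :
    ∑ v, coneSlope a R c v ^ 2 ≤ 8 * a ^ 2 * (1 + Real.log R) := by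
  let f : ℕ → ℕ → ℝ := fun i j => if max i j < R then (1 / (1 + (max i j : ℕ)) : ℝ) ^ 2 else 0
  have hf0 : ∀ i j, 0 ≤ f i j := fun i j => by simp only [f]; split_ifs <;> positivity
  have hf1 : ∀ i j, R ≤ i ∨ R ≤ j → f i j = 0 := fun i j h => by
    simp only [f]; rw [if_neg (by omega)]
  have h1 : ∑ v, coneSlope a R c v ^ 2 = a ^ 2 * ∑ v : TorusVertex n, f v.1.absVal v.2.absVal := by
    rw [Finset.mul_sum, ← Equiv.sum_comp (Equiv.addRight c)]
    refine Finset.sum_congr rfl fun v _ => ?_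
    simp only [f, coneSlope, torusDist, Equiv.coe_addRight, Prod.fst_add, Prod.snd_add,
      add_sub_cancel_right]
    split_ifs
    · rw [mul_pow]
    · ring
  have h2 : ∑ v : TorusVertex n, f v.1.absVal v.2.absVal ≤
      4 * ∑ i ∈ Finset.range R, ∑ j ∈ Finset.range R, (1 / (1 + (max i j : ℕ)) : ℝ) ^ 2 := by
    have : NeZero (2 * n) := ⟨by have := NeZero.ne n; omega⟩
    rw [Fintype.sum_prod_type]
    calc _ ≤ ∑ x : ZMod (2 * n), 2 * ∑ j ∈ Finset.range R, f x.absVal j :=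
          Finset.sum_le_sum fun x _ => ZMod.sum_absVal_le (hf0 _) fun j hj => hf1 _ _ (Or.inr hj)
      _ = 2 * ∑ j ∈ Finset.range R, ∑ x : ZMod (2 * n), f x.absVal j := by
          rw [← Finset.mul_sum, Finset.sum_comm]
      _ ≤ 2 * ∑ j ∈ Finset.range R, 2 * ∑ i ∈ Finset.range R, f i j := by
          gcongr
          exact ZMod.sum_absVal_le (h := fun i => f i _) (fun i => hf0 _ _)
            fun i hi => hf1 _ _ (Or.inl hi)
      _ = 4 * ∑ i ∈ Finset.range R, ∑ j ∈ Finset.range R, f i j := by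
          rw [← Finset.mul_sum, Finset.sum_comm]
          ring
      _ = _ := by
          congr 1
          refine Finset.sum_congr rfl fun i hi => Finset.sum_congr rfl fun j hj => ?_
          simp only [f]
          rw [if_pos (max_lt (Finset.mem_range.1 hi) (Finset.mem_range.1 hj))]
  rw [h1]
  calc _ ≤ a ^ 2 * (4 * (2 * (1 + Real.log R))) := by
        gcongr
        exact h2.trans (by gcongr; exact sum_sum_inv_sq_le R)
    _ = _ := by ring

lemma shift_eq_zero_of_le [NeZero n] (ha : 0 ≤ a) (hT : 0 ≤ T) (φ : TorusVertex n → ℝ)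
    {v : TorusVertex n} (hv : R ≤ torusDist v c) :
    shift (torus n) (coneSlope a R c) (coneBound T R c) φ v = 0 := by
  refine le_antisymm ?_ (shift_nonneg (coneSlope_nonneg ha) (coneBound_nonneg hT) φ v)
  refine (shift_le (coneSlope_nonneg ha) (coneBound_nonneg hT) φ v).trans ?_
  rw [coneBound, if_neg (by omega)]

/-- For height functions in the good set, the shift is large at the centre. -/
lemma le_shift_center [NeZero n] {ε : ℝ} {m B : ℕ} {φ : TorusVertex n → ℝ} (ha : 0 ≤ a)
    (hT : 0 ≤ T) (hε : 0 ≤ ε) (hm : 0 < m) (hφ : φ ∈ goodSet n ε m (50 * m))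
    (hB : B * (50 * m) < R) :
    min T (ε ^ 2 * a / 51 * Real.log ((B + 1 : ℕ) : ℝ)) ≤
      shift (torus n) (coneSlope a R c) (coneBound T R c) φ c := by
  have hlam : ∀ v : TorusVertex n, 0 ≤ coneSlope a R c v := coneSlope_nonneg ha
  have htau : ∀ v : TorusVertex n, 0 ≤ coneBound T R c v := coneBound_nonneg hT
  obtain ⟨p, r, hpr, hp⟩ := exists_parent (G := torus n) hlam htau φ
  set s := shift (torus n) (coneSlope a R c) (coneBound T R c) φ with hs
  let γ : ℕ → TorusVertex n := fun i => (fun v => (p v).getD v)^[i] c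
  have hγ : ∀ i w, p (γ i) = some w → γ (i + 1) = w := by
    intro i w h
    simp only [γ, Function.iterate_succ_apply'] at h ⊢
    rw [h, Option.getD_some]
  have hdist : ∀ i, torusDist (γ i) c ≤ i := by
    intro i
    induction i with
    | zero => exact (torusDist_self c).le
    | succ i ih =>
      cases h : p (γ i) with
      | none =>
        have : γ (i + 1) = γ i := by
          simp only [γ, Function.iterate_succ_apply'] at h ⊢
          rw [h, Option.getD_none]
        rw [this]
        omega
      | some w =>
        rw [hγ i w h]
        have := torusDist_triangle w (γ i) c
        have := torusDist_le_one (hpr _ _ h).1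
        omega
  have hstep : ∀ i w, p (γ i) = some w →
      s (γ i) = s (γ (i + 1)) + edgeLength (coneSlope a R c) φ (γ i) (γ (i + 1)) := by
    intro i w h
    rw [hγ i w h, hp (γ i), h]
    rfl
  have hstep' : ∀ i w, p (γ i) = some w → s (γ (i + 1)) ≤ s (γ i) := fun i w h => by
    rw [hstep i w h]
    exact le_add_of_nonneg_right (edgeLength_nonneg hlam φ _ _)
  by_cases hall : ∀ i < B * (50 * m), ∃ w, p (γ i) = some w
  · refine (min_le_right _ _).trans ?_
    have hblock : ∀ b < B, s (γ ((b + 1) * (50 * m))) + ε ^ 2 * a / 51 * ((b : ℝ) + 1)⁻¹ ≤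
        s (γ (b * (50 * m))) := by
      intro b hb
      have hle : (b + 1) * (50 * m) ≤ B * (50 * m) := Nat.mul_le_mul_right _ hb
      have hsucc : (b + 1) * (50 * m) = b * (50 * m) + 50 * m := by ring
      have hall' : ∀ i < 50 * m, ∃ w, p (γ (b * (50 * m) + i)) = some w :=
        fun i hi => hall _ (by omega)
      have hadj : ∀ i < 50 * m, (torus n).Adj (γ (b * (50 * m) + i)) (γ (b * (50 * m) + (i + 1))) := by
        intro i hi
        obtain ⟨w, hw⟩ := hall' i hi
        rw [← add_assoc, hγ _ w hw]
        exact (hpr _ _ hw).1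
      have hr : StrictAntiOn (fun i => r (γ (b * (50 * m) + i))) (Set.Iic (50 * m)) := by
        refine strictAntiOn_Iic_of_succ_lt fun i hi => ?_
        obtain ⟨w, hw⟩ := hall' i hi
        simp only [Order.succ_eq_add_one, ← add_assoc]
        rw [hγ _ w hw]
        exact (hpr _ _ hw).2
      have hinj : Set.InjOn (fun i => γ (b * (50 * m) + i)) (Set.Iic (50 * m)) :=
        fun i hi j hj h => hr.injOn hi hj (congrArg r h)
      have hcard := lt_card_of_mem_goodSet hφ (fun i => γ (b * (50 * m) + i)) hadj hinj
      have htel : s (γ (b * (50 * m))) - s (γ ((b + 1) * (50 * m))) =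
          ∑ i ∈ Finset.range (50 * m), edgeLength (coneSlope a R c) φ (γ (b * (50 * m) + i))
            (γ (b * (50 * m) + (i + 1))) := by
        have := Finset.sum_range_sub' (fun i => s (γ (b * (50 * m) + i))) (50 * m)
        rw [add_zero] at this
        rw [hsucc, ← this]
        refine Finset.sum_congr rfl fun i hi => ?_
        obtain ⟨w, hw⟩ := hall' i (Finset.mem_range.1 hi)
        have := hstep _ w hw
        rw [add_assoc] at this
        linarith
      have hterm : ∀ i ∈ (Finset.range (50 * m)).filter
          (fun i => |φ (γ (b * (50 * m) + i)) - φ (γ (b * (50 * m) + (i + 1)))| < 1 - ε),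
          a * (1 / (1 + ((b + 1) * (50 * m) : ℕ))) * ε ^ 2 ≤
            edgeLength (coneSlope a R c) φ (γ (b * (50 * m) + i))
            (γ (b * (50 * m) + (i + 1))) := by
        intro i hi
        obtain ⟨hi1, hi2⟩ := Finset.mem_filter.1 hi
        have hi1 := Finset.mem_range.1 hi1
        have hslope : ∀ j ≤ (b + 1) * (50 * m),
            a * (1 / (1 + ((b + 1) * (50 * m) : ℕ))) ≤ coneSlope a R c (γ j) := by
          intro j hj
          have hd := hdist j
          rw [coneSlope, if_pos (by omega)]
          have : (torusDist (γ j) c : ℝ) ≤ ((b + 1) * (50 * m) : ℕ) := by exact_mod_cast hd.trans hj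
          gcongr
        exact mul_le_mul (le_min (hslope _ (by omega)) (hslope _ (by omega)))
          (sq_le_profile hε hi2.le) (sq_nonneg _) (le_min (hlam _) (hlam _))
      have hsum := Finset.card_nsmul_le_sum _ _ _ hterm
      have hsum' := hsum.trans (Finset.sum_le_sum_of_subset_of_nonneg (Finset.filter_subset _ _)
        fun i _ _ => edgeLength_nonneg hlam φ _ _)
      rw [← htel, nsmul_eq_mul] at hsum'
      have hfinal : ε ^ 2 * a / 51 * ((b : ℝ) + 1)⁻¹ ≤
          m * (a * (1 / (1 + ((b + 1) * (50 * m) : ℕ))) * ε ^ 2) := by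
        have hm1 : (1 : ℝ) ≤ m := by exact_mod_cast hm
        have h3 : ((b : ℝ) + 1)⁻¹ / 51 ≤ m * (1 / (1 + ((b + 1) * (50 * m) : ℕ))) := by
          push_cast
          rw [mul_one_div, inv_eq_one_div, div_div, div_le_div_iff₀ (by positivity) (by positivity)]
          nlinarith [(Nat.cast_nonneg b : (0 : ℝ) ≤ b)]
        calc _ = ε ^ 2 * a * (((b : ℝ) + 1)⁻¹ / 51) := by ring
          _ ≤ ε ^ 2 * a * (m * (1 / (1 + ((b + 1) * (50 * m) : ℕ)))) := by gcongr
          _ = _ := by ring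
      have hcard' : (m : ℝ) * (a * (1 / (1 + ((b + 1) * (50 * m) : ℕ))) * ε ^ 2) ≤
          ((Finset.range (50 * m)).filter (fun i => |φ (γ (b * (50 * m) + i)) -
            φ (γ (b * (50 * m) + (i + 1)))| < 1 - ε)).card *
            (a * (1 / (1 + ((b + 1) * (50 * m) : ℕ))) * ε ^ 2) :=
        mul_le_mul_of_nonneg_right (by exact_mod_cast hcard.le) (by positivity)
      linarith
    have hind : ∀ b ≤ B, ε ^ 2 * a / 51 * ∑ i ∈ Finset.range b, ((i : ℝ) + 1)⁻¹ +
        s (γ (b * (50 * m))) ≤ s c := by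
      intro b
      induction b with
      | zero => intro _; simp [γ]
      | succ b ih =>
        intro hb
        have h1 := ih (by omega)
        have h2 := hblock b hb
        rw [Finset.sum_range_succ, mul_add]
        linarith
    have h1 := hind B le_rfl
    have h2 : Real.log ((B + 1 : ℕ) : ℝ) ≤ ∑ i ∈ Finset.range B, ((i : ℝ) + 1)⁻¹ := by
      refine (log_add_one_le_harmonic B).trans (le_of_eq ?_)
      simp [harmonic]
    have h3 := shift_nonneg (G := torus n) hlam htau φ (γ (B * (50 * m)))
    have h4 : ε ^ 2 * a / 51 * Real.log ((B + 1 : ℕ) : ℝ) ≤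
        ε ^ 2 * a / 51 * ∑ i ∈ Finset.range B, ((i : ℝ) + 1)⁻¹ := by gcongr
    linarith
  · refine (min_le_left _ _).trans ?_
    push Not at hall
    have hex : ∃ i, i < B * (50 * m) ∧ p (γ i) = none := by
      obtain ⟨i, hi, h⟩ := hall
      exact ⟨i, hi, Option.eq_none_iff_forall_ne_some.2 h⟩
    have hmin : ∀ j < Nat.find hex, ∃ w, p (γ j) = some w := by
      intro j hj
      have h1 := Nat.find_min hex hj
      have h2 := (Nat.find_spec hex).1
      exact Option.ne_none_iff_exists'.1 fun h => h1 ⟨by omega, h⟩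
    have hmono : ∀ j ≤ Nat.find hex, s (γ j) ≤ s c := by
      intro j
      induction j with
      | zero => exact fun _ => le_rfl
      | succ j ih =>
        intro hj
        obtain ⟨w, hw⟩ := hmin j hj
        exact (hstep' j w hw).trans (ih (by omega))
    refine le_trans (le_of_eq ?_) (hmono _ le_rfl)
    obtain ⟨h1, h2⟩ := Nat.find_spec hex
    have h3 := hdist (Nat.find hex)
    rw [hp, h2, Option.elim_none, coneBound, if_pos (by omega)]

end Cone

/-- Height functions which differ by less than `H` from their value at `0`. -/
def flatSet (n : ℕ) (H : ℝ) : Set (TorusVertex n → ℝ) := {φ | ∀ v, |φ v - φ 0| < H}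

lemma measurableSet_flatSet (n : ℕ) [NeZero n] (H : ℝ) : MeasurableSet (flatSet n H) := by
  simp only [flatSet, Set.ofPred_forall]
  exact MeasurableSet.iInter fun v => measurableSet_lt
    (continuous_abs.measurable.comp ((measurable_pi_apply v).sub (measurable_pi_apply 0)))
    measurable_const

lemma shiftInvariant_flatSet (n : ℕ) (H : ℝ) : ShiftInvariant fun φ => φ ∈ flatSet n H := by
  intro φ t
  simp only [flatSet, Set.mem_ofPred_eq, add_sub_add_right_eq_sub]

/-- Height functions which are flat outside a box around `c`, but not at `c`. -/
def spikeSet (n : ℕ) (H : ℝ) (R : ℕ) (c : TorusVertex n) (σ : ℝ) : Set (TorusVertex n → ℝ) :=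
  {φ | φ 0 ∈ Set.Ico (0 : ℝ) 1} ∩ {φ | ∀ v, R ≤ torusDist v c → |φ v - φ 0| < H} ∩
    {φ | 2 * H ≤ σ * (φ c - φ 0)}

lemma measurableSet_spikeSet (n : ℕ) [NeZero n] (H : ℝ) (R : ℕ) (c : TorusVertex n) (σ : ℝ) :
    MeasurableSet (spikeSet n H R c σ) := by
  refine ((measurableSet_root 0).inter ?_).inter ?_
  · simp only [Set.ofPred_forall]
    exact MeasurableSet.iInter fun v => MeasurableSet.iInter fun _ => measurableSet_lt
      (continuous_abs.measurable.comp ((measurable_pi_apply v).sub (measurable_pi_apply 0)))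
      measurable_const
  · exact measurableSet_le measurable_const (by fun_prop)

lemma shifted_mem_spikeSet {n : ℕ} [NeZero n] {a T H σ : ℝ} {R : ℕ} {c : TorusVertex n}
    {φ : TorusVertex n → ℝ} (ha : 0 ≤ a) (hT : 0 ≤ T) (hσ : σ * σ = 1)
    (hσ' : |σ| ≤ 1) (hc : R ≤ torusDist 0 c)
    (hφ0 : φ 0 ∈ Set.Ico (0 : ℝ) 1) (hφ : φ ∈ flatSet n H)
    (hs : 3 * H ≤ shift (torus n) (coneSlope a R c) (coneBound T R c) φ c) :
    shifted (torus n) (coneSlope a R c) (coneBound T R c) σ φ ∈ spikeSet n H R c σ := by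
  have h0 : ∀ v, R ≤ torusDist v c →
      shifted (torus n) (coneSlope a R c) (coneBound T R c) σ φ v = φ v := fun v hv => by
    rw [shifted, shift_eq_zero_of_le ha hT φ hv, mul_zero, add_zero]
  refine ⟨⟨?_, fun v hv => ?_⟩, ?_⟩
  · rw [Set.mem_ofPred_eq, h0 0 hc]
    exact hφ0
  · rw [h0 v hv, h0 0 hc]
    exact hφ v
  · rw [Set.mem_ofPred_eq, h0 0 hc, shifted]
    have h1 : |σ * (φ c - φ 0)| < H := by
      rw [abs_mul]
      exact (mul_le_of_le_one_left (abs_nonneg _) hσ').trans_lt (hφ c)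
    have h2 := (abs_lt.1 h1).1
    linear_combination h2 + hs - shift (torus n) (coneSlope a R c) (coneBound T R c) φ c * hσ

lemma disjoint_spikeSet {n : ℕ} {H : ℝ} (hH : 0 < H) {R : ℕ} {c c' : TorusVertex n}
    (hcc : R ≤ torusDist c' c) {σ σ' : ℝ} (hσ' : |σ'| ≤ 1) :
    Disjoint (spikeSet n H R c σ) (spikeSet n H R c' σ') := by
  rw [Set.disjoint_left]
  rintro φ ⟨⟨-, h1⟩, -⟩ ⟨-, h2⟩
  have h3 := h1 c' hcc
  have h4 : |σ' * (φ c' - φ 0)| ≤ |φ c' - φ 0| := by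
    rw [abs_mul]
    exact mul_le_of_le_one_left (abs_nonneg _) hσ'
  have h5 := (le_abs_self _).trans h4
  rw [Set.mem_ofPred_eq] at h2
  linarith

lemma disjoint_spikeSet_neg {n : ℕ} {H : ℝ} (hH : 0 < H) {R : ℕ} {c : TorusVertex n} :
    Disjoint (spikeSet n H R c 1) (spikeSet n H R c (-1)) := by
  rw [Set.disjoint_left]
  rintro φ ⟨-, h1⟩ ⟨-, h2⟩
  rw [Set.mem_ofPred_eq] at h1 h2
  linarith

namespace Potential

variable {U : Potential}

lemma exists_measure_flatSet_inter_le (hC2 : U.IsC2OnUnit) :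
    ∃ a : ℝ, 0 < a ∧ ∀ (n : ℕ) [NeZero n], 2 ≤ n → ∀ (ε H : ℝ) (m B k : ℕ), 0 ≤ ε → 0 < H →
      0 < m → 0 < k → k ^ 4 ≤ n → B * (50 * m) < k ^ 2 →
      3 * H ≤ ε ^ 2 * a / 51 * Real.log ((B + 1 : ℕ) : ℝ) →
      k * U.surfaceMeasure n (flatSet n H ∩ goodSet n ε m (50 * m)) ≤ 1 := by
  obtain ⟨K, hK0, hK⟩ := exists_lintegral_weight_le hC2
  have ha : 0 < 1 / (8 + 16 * K) := by positivity
  have ha8 : 1 / (8 + 16 * K) ≤ 1 / 8 := one_div_le_one_div_of_le (by norm_num) (by linarith)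
  have haK : 16 * K * (1 / (8 + 16 * K)) ^ 2 ≤ 1 := by
    have : 16 * K * (1 / (8 + 16 * K)) ≤ 1 := by
      rw [mul_one_div, div_le_one (by positivity)]
      linarith
    nlinarith
  refine ⟨1 / (8 + 16 * K), ha, ?_⟩
  generalize 1 / (8 + 16 * K) = a at ha ha8 haK
  intro n _ hn ε H m B k hε hH hm hk hkn hB hHB
  set R := k ^ 2 with hR
  have hRR : R * R ≤ n := by rw [hR, ← pow_add]; exact hkn
  let c : ℕ → TorusVertex n := fun i => ((R * i : ℕ), 0)
  have hcn : ∀ i ≤ R, R * i ≤ n := fun i hi => (Nat.mul_le_mul_left R hi).trans hRR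
  have hc : ∀ i ≤ R, ∀ j ≤ R, i ≠ j → R ≤ torusDist (c i) (c j) := by
    intro i hi j hj hij
    refine le_torusDist_natCast (hcn i hi) (hcn j hj) ?_
    rcases Nat.lt_or_gt_of_ne hij with h | h
    · exact Or.inl (by simpa [mul_add] using Nat.mul_le_mul_left R (Nat.succ_le_of_lt h))
    · exact Or.inr (by simpa [mul_add] using Nat.mul_le_mul_left R (Nat.succ_le_of_lt h))
  have hc0 : c 0 = 0 := by simp only [c, mul_zero, Nat.cast_zero]; rfl
  set A := flatSet n H ∩ goodSet n ε m (50 * m) with hA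
  have hAm : MeasurableSet A := (measurableSet_flatSet n H).inter (measurableSet_goodSet n ε m _)
  have hAs : ShiftInvariant fun φ => φ ∈ A := fun φ t => by
    rw [hA]
    exact congrArg₂ And (shiftInvariant_flatSet n H φ t) (shiftInvariant_goodSet n ε m _ φ t)
  have hroot := measurableSet_root (0 : TorusVertex n)
  set I := ∫⁻ φ in A ∩ {φ | φ 0 ∈ Set.Ico (0 : ℝ) 1}, U.weight n φ with hI
  let D : ℕ → Set (TorusVertex n → ℝ) := fun i => spikeSet n H R (c i) 1 ∪ spikeSet n H R (c i) (-1)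
  have hDm : ∀ i, MeasurableSet (D i) := fun i =>
    (measurableSet_spikeSet n H R _ _).union (measurableSet_spikeSet n H R _ _)
  have hone : ∀ i ∈ Finset.Icc 1 R,
      ENNReal.ofReal (2 * Real.exp (-((1 + Real.log R) / 2))) * I ≤ ∫⁻ φ in D i, U.weight n φ := by
    intro i hi
    obtain ⟨hi1, hi2⟩ := Finset.mem_Icc.1 hi
    have h0c : R ≤ torusDist 0 (c i) := by
      rw [← hc0]
      exact hc 0 (Nat.zero_le _) i hi2 (by omega)
    have hs : ∀ φ ∈ A, 3 * H ≤
        shift (torus n) (coneSlope a R (c i)) (coneBound (3 * H) R (c i)) φ (c i) := fun φ hφ => by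
      refine le_trans (le_of_eq ?_)
        (le_shift_center (c := c i) ha.le (by positivity : 0 ≤ 3 * H) hε hm hφ.2 hB)
      rw [min_eq_left hHB]
    have h1 := hK n hn (coneSlope a R (c i)) (coneBound (3 * H) R (c i)) (coneSlope_nonneg ha.le)
      (fun v => (coneSlope_le ha.le v).trans ha8) (coneBound_nonneg (by positivity))
      (A ∩ {φ | φ 0 ∈ Set.Ico (0 : ℝ) 1}) (spikeSet n H R (c i) 1) (spikeSet n H R (c i) (-1))
      (hAm.inter hroot)
      (fun φ hφ => shifted_mem_spikeSet ha.le (by positivity) (by norm_num) (by norm_num) h0c hφ.2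
        hφ.1.1 (hs φ hφ.1))
      (fun φ hφ => shifted_mem_spikeSet ha.le (by positivity) (by norm_num) (by norm_num) h0c hφ.2
        hφ.1.1 (hs φ hφ.1))
    rw [← lintegral_union (measurableSet_spikeSet n H R _ _) (disjoint_spikeSet_neg hH)] at h1
    refine le_trans ?_ h1
    gcongr
    have hR1 : (1 : ℝ) ≤ R := by exact_mod_cast Nat.one_le_pow 2 k hk
    have h2 := Real.log_nonneg hR1
    calc K * ∑ v, coneSlope a R (c i) v ^ 2 ≤ K * (8 * a ^ 2 * (1 + Real.log R)) := by
          gcongr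
          exact sum_coneSlope_sq_le _
      _ = 16 * K * a ^ 2 * ((1 + Real.log R) / 2) := by ring
      _ ≤ (1 + Real.log R) / 2 := mul_le_of_le_one_left (by positivity) haK
  have hZ : U.partitionFunction n = ∫⁻ φ in {φ | φ 0 ∈ Set.Ico (0 : ℝ) 1}, U.weight n φ :=
    lintegral_pinnedLebesgue (measurable_weight U hn) (shiftInvariant_weight U hn)
  have hsum : (R : ℝ≥0∞) * (ENNReal.ofReal (2 * Real.exp (-((1 + Real.log R) / 2))) * I) ≤
      U.partitionFunction n := by
    have hdisj : ((Finset.Icc 1 R : Finset ℕ) : Set ℕ).PairwiseDisjoint D := by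
      intro i hi j hj hij
      have hi := (Finset.mem_Icc.1 (Finset.mem_coe.1 hi)).2
      have hj := (Finset.mem_Icc.1 (Finset.mem_coe.1 hj)).2
      have h1 := hc j hj i hi hij.symm
      simp only [Function.onFun, D, Set.disjoint_union_left, Set.disjoint_union_right]
      refine ⟨⟨?_, ?_⟩, ?_, ?_⟩ <;> exact disjoint_spikeSet hH h1 (by norm_num)
    calc _ = ∑ _i ∈ Finset.Icc 1 R,
          ENNReal.ofReal (2 * Real.exp (-((1 + Real.log R) / 2))) * I := by
          rw [Finset.sum_const, Nat.card_Icc, Nat.add_sub_cancel, nsmul_eq_mul]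
      _ ≤ ∑ i ∈ Finset.Icc 1 R, ∫⁻ φ in D i, U.weight n φ := Finset.sum_le_sum hone
      _ = ∫⁻ φ in ⋃ i ∈ Finset.Icc 1 R, D i, U.weight n φ :=
          (lintegral_biUnion_finset hdisj (fun i _ => hDm i) _).symm
      _ ≤ U.partitionFunction n := by
          rw [hZ]
          refine lintegral_mono_set (Set.iUnion₂_subset fun i _ => ?_)
          rintro φ (hφ | hφ) <;> exact hφ.1.1
  have hμ : U.surfaceMeasure n A = (U.partitionFunction n)⁻¹ * I := by
    rw [surfaceMeasure_apply U hn hAm hAs, rootedLebesgue, Measure.restrict_restrict hAm]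
  have hk1 : (k : ℝ≥0∞) ≤ R * ENNReal.ofReal (2 * Real.exp (-((1 + Real.log R) / 2))) := by
    rw [← ENNReal.ofReal_natCast, ← ENNReal.ofReal_natCast, ← ENNReal.ofReal_mul (by positivity)]
    refine ENNReal.ofReal_le_ofReal ?_
    have hk0 : (0 : ℝ) < k := by exact_mod_cast hk
    have h1 : Real.exp (-((1 + Real.log R) / 2)) = Real.exp (-(1 / 2)) * (k : ℝ)⁻¹ := by
      rw [hR]
      push_cast
      rw [Real.log_pow, show -((1 + ((2 : ℕ) : ℝ) * Real.log k) / 2) = -(1 / 2) + -Real.log k by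
        push_cast; ring, Real.exp_add, Real.exp_neg (Real.log k), Real.exp_log hk0]
    have h2 := Real.add_one_le_exp (-(1 / 2) : ℝ)
    rw [h1, hR]
    push_cast
    rw [show (k : ℝ) ^ 2 * (2 * (Real.exp (-(1 / 2)) * (k : ℝ)⁻¹)) =
      k * (2 * Real.exp (-(1 / 2))) by field_simp]
    exact le_mul_of_one_le_right hk0.le (by linarith)
  calc (k : ℝ≥0∞) * U.surfaceMeasure n A
      ≤ R * ENNReal.ofReal (2 * Real.exp (-((1 + Real.log R) / 2))) *
        ((U.partitionFunction n)⁻¹ * I) := by rw [hμ]; gcongr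
    _ = (U.partitionFunction n)⁻¹ *
        (R * (ENNReal.ofReal (2 * Real.exp (-((1 + Real.log R) / 2))) * I)) := by ring
    _ ≤ (U.partitionFunction n)⁻¹ * U.partitionFunction n := by gcongr
    _ ≤ 1 := ENNReal.inv_mul_le_one _

end Potential

lemma maxHeight_lt_iff {n : ℕ} [NeZero n] {φ : TorusVertex n → ℝ} {t : ℝ} :
    maxHeight n φ < t ↔ ∀ v, |φ v| < t := by
  simp [maxHeight, Finset.sup'_lt_iff]

lemma measurable_maxHeight (n : ℕ) [NeZero n] : Measurable (maxHeight n) := by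
  have := Finset.measurable_sup' (Finset.univ_nonempty (α := TorusVertex n))
    (f := fun v (φ : TorusVertex n → ℝ) => |φ v|) fun v _ => by fun_prop
  convert this using 1
  ext φ
  rw [maxHeight, Finset.sup'_apply]

lemma setOf_maxHeight_lt_subset_flatSet {n : ℕ} [NeZero n] (H : ℝ) :
    {φ | maxHeight n φ < H / 2} ⊆ flatSet n H := by
  intro φ hφ v
  have h := maxHeight_lt_iff.1 hφ
  linarith [abs_sub (φ v) (φ 0), h v, h 0]

lemma half_le_measure_le_maxHeight {n : ℕ} [NeZero n] {μ : Measure (TorusVertex n → ℝ)}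
    [IsProbabilityMeasure μ] {t : ℝ} (h : μ {φ | maxHeight n φ < t} ≤ 1 / 2) :
    1 / 2 ≤ μ {φ | t ≤ maxHeight n φ} := by
  have h1 : {φ | t ≤ maxHeight n φ} = {φ | maxHeight n φ < t}ᶜ := by
    ext φ
    simp
  rw [h1, prob_compl_eq_one_sub (measurableSet_lt (measurable_maxHeight n) measurable_const)]
  refine le_trans (le_of_eq ?_) (tsub_le_tsub_left h 1)
  rw [one_div, ENNReal.one_sub_inv_two]

lemma eventually_mul_pow_le_pow_div (C : ℝ) :
    ∃ k₀ : ℕ, ∀ k ≥ k₀, C * (k + 1) ^ 8 ≤ 10 ^ (k / 100) := by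
  obtain ⟨C', hC'0, hC'⟩ : ∃ C' : ℝ, 0 < C' ∧ C ≤ C' :=
    ⟨max 1 C, lt_max_of_lt_left one_pos, le_max_right _ _⟩
  have h := tendsto_pow_const_div_const_pow_of_one_lt 8 (r := (10 : ℝ)) (by norm_num)
  have hpos : 0 < 1 / (C' * 200 ^ 8) := by positivity
  obtain ⟨j₀, hj₀⟩ := Filter.eventually_atTop.1 (h.eventually (gt_mem_nhds hpos))
  refine ⟨100 * (j₀ + 1), fun k hk => ?_⟩
  have hj := hj₀ (k / 100) (by omega)
  have hj1 : 1 ≤ k / 100 := by omega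
  have hk1 : k + 1 ≤ 200 * (k / 100) := by omega
  rw [div_lt_div_iff₀ (by positivity) (by positivity), one_mul] at hj
  have hk2 : (k + 1 : ℝ) ≤ 200 * (k / 100 : ℕ) := by exact_mod_cast hk1
  calc C * (k + 1) ^ 8 ≤ C' * (200 * (k / 100 : ℕ)) ^ 8 := by gcongr
    _ = ((k / 100 : ℕ) : ℝ) ^ 8 * (C' * 200 ^ 8) := by ring
    _ ≤ _ := hj.le

namespace Potential

variable {U : Potential}

lemma exists_half_le_of_large (hU : U.IsAdmissible) (hC2 : U.IsC2OnUnit) :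
    ∃ c : ℝ, 0 < c ∧ ∃ N : ℕ, ∀ (n : ℕ) [NeZero n], 2 ≤ n → N ≤ n →
      (∃ ε : ℝ, 0 < ε ∧ ε ≤ 1 / 2 ∧ U.HasControlledGradients n (1 / 8) (1 - ε)) →
        1 / 2 ≤ U.surfaceMeasure n {φ | c * Real.log n ≤ maxHeight n φ} := by
  obtain ⟨ε, hε0, -, hε⟩ := exists_steep_bound hU hC2
  obtain ⟨a, ha, hA⟩ := exists_measure_flatSet_inter_le hC2
  obtain ⟨k₀, hk₀⟩ := eventually_mul_pow_le_pow_div 16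
  refine ⟨ε ^ 2 * a / 612 / 2, by positivity, (k₀ + 100) ^ 4, fun n _ hn hN hctrl => ?_⟩
  have := isProbabilityMeasure_surfaceMeasure hU hC2 hn
  obtain ⟨k, hkn, hnk⟩ : ∃ k : ℕ, k ^ 4 ≤ n ∧ n < (k + 1) ^ 4 := by
    refine ⟨Nat.sqrt (Nat.sqrt n), ?_, ?_⟩
    · calc _ = (Nat.sqrt (Nat.sqrt n) ^ 2) ^ 2 := by ring
        _ ≤ Nat.sqrt n ^ 2 := Nat.pow_le_pow_left (Nat.sqrt_le' _) 2
        _ ≤ n := Nat.sqrt_le' n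
    · calc n < (Nat.sqrt n + 1) ^ 2 := Nat.lt_succ_sqrt' n
        _ ≤ ((Nat.sqrt (Nat.sqrt n) + 1) ^ 2) ^ 2 :=
            Nat.pow_le_pow_left (Nat.lt_succ_sqrt' (Nat.sqrt n)) 2
        _ = _ := by ring
  have hk : k₀ + 100 ≤ k :=
    Nat.lt_succ_iff.1 (lt_of_pow_lt_pow_left₀ 4 (Nat.zero_le _) (hN.trans_lt hnk))
  have hn1 : (1 : ℝ) < n := by exact_mod_cast hn
  have hlog : 0 < Real.log n := Real.log_pos hn1
  have hlogk : Real.log n ≤ 4 * Real.log ((k + 1 : ℕ) : ℝ) := by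
    have := Real.log_le_log (by linarith) (show (n : ℝ) ≤ ((k + 1 : ℕ) : ℝ) ^ 4 by
      exact_mod_cast hnk.le)
    rw [Real.log_pow] at this
    exact_mod_cast this
  set H := ε ^ 2 * a / 612 * Real.log n with hH
  have h1 : U.surfaceMeasure n (flatSet n H ∩ goodSet n ε (k / 100) (50 * (k / 100))) ≤ 1 / 4 := by
    have := hA n hn ε H (k / 100) k k hε0.le (by positivity) (by omega) (by omega) hkn
      (by rw [sq]; exact Nat.mul_lt_mul_of_pos_left (by omega) (by omega))
      (by
        rw [hH]
        calc _ = ε ^ 2 * a / 204 * Real.log n := by ring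
          _ ≤ ε ^ 2 * a / 204 * (4 * Real.log ((k + 1 : ℕ) : ℝ)) := by gcongr
          _ = _ := by ring)
    have h4 : (4 : ℝ≥0∞) ≤ k := by exact_mod_cast (by omega : 4 ≤ k)
    rw [ENNReal.le_div_iff_mul_le (Or.inl (by norm_num)) (Or.inl (by norm_num)), mul_comm]
    exact le_trans (by gcongr) this
  have h2 : U.surfaceMeasure n (goodSet n ε (k / 100) (50 * (k / 100)))ᶜ ≤ 1 / 4 := by
    refine (measure_compl_goodSet_le _ (hε n hn hctrl) (k / 100)).trans ?_
    have h3 : (4 * n ^ 2 * (1 / 10) ^ (k / 100) : ℝ) ≤ 1 / 4 := by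
      have h4 := hk₀ k (by omega)
      have h5 : (n : ℝ) ≤ (k + 1) ^ 4 := by exact_mod_cast hnk.le
      have h6 : (n : ℝ) ^ 2 ≤ (k + 1) ^ 8 := by
        calc (n : ℝ) ^ 2 ≤ ((k + 1) ^ 4) ^ 2 := by gcongr
          _ = _ := by ring
      rw [one_div, inv_pow, ← div_eq_mul_inv, div_le_iff₀ (by positivity)]
      linarith
    refine (ENNReal.ofReal_le_ofReal h3).trans (le_of_eq ?_)
    rw [ENNReal.ofReal_div_of_pos (by norm_num), ENNReal.ofReal_one]
    norm_num
  refine half_le_measure_le_maxHeight ?_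
  calc U.surfaceMeasure n {φ | maxHeight n φ < ε ^ 2 * a / 612 / 2 * Real.log n}
      ≤ U.surfaceMeasure n (flatSet n H) := by
        refine measure_mono (subset_trans (le_of_eq ?_) (setOf_maxHeight_lt_subset_flatSet H))
        rw [hH]
        congr! 3
        ring
    _ ≤ U.surfaceMeasure n ((flatSet n H ∩ goodSet n ε (k / 100) (50 * (k / 100))) ∪
          (goodSet n ε (k / 100) (50 * (k / 100)))ᶜ) := measure_mono fun φ hφ => by
        by_cases h : φ ∈ goodSet n ε (k / 100) (50 * (k / 100))
        · exact Or.inl ⟨hφ, h⟩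
        · exact Or.inr h
    _ ≤ 1 / 4 + 1 / 4 := (measure_union_le _ _).trans (add_le_add h1 h2)
    _ = 1 / 2 := by
        rw [ENNReal.div_add_div_same, ENNReal.div_eq_div_iff (by norm_num) (by norm_num)
          (by norm_num) (by norm_num)]
        norm_num

lemma exists_half_le (hU : U.IsAdmissible) (hC2 : U.IsC2OnUnit) (n : ℕ) :
    ∃ t : ℝ, 0 < t ∧ ∀ [NeZero n], 2 ≤ n →
      1 / 2 ≤ U.surfaceMeasure n {φ | t ≤ maxHeight n φ} := by
  rcases Nat.lt_or_ge n 2 with hn | hn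
  · exact ⟨1, one_pos, fun h => absurd h (by omega)⟩
  have : NeZero n := ⟨by omega⟩
  have := isProbabilityMeasure_surfaceMeasure hU hC2 hn
  have hzero : U.surfaceMeasure n {0} = 0 := by
    have hsf : ∀ v : TorusVertex n,
        SigmaFinite (if v = 0 then Measure.dirac (0 : ℝ) else volume) := fun v => by
      split_ifs <;> infer_instance
    have h1 : pinnedLebesgue n {0} = 0 := by
      rw [pinnedLebesgue, Measure.pi_singleton]
      refine Finset.prod_eq_zero (Finset.mem_univ ((1, 0) : TorusVertex n)) ?_
      have h2 : (1 : ZMod (2 * n)) ≠ 0 := by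
        have : Fact (1 < 2 * n) := ⟨by omega⟩
        exact one_ne_zero
      rw [if_neg fun h => h2 (congrArg Prod.fst h)]
      simp
    rw [surfaceMeasure, Measure.smul_apply, withDensity_absolutelyContinuous _ _ h1, smul_zero]
  have hlim := tendsto_measure_iInter_atTop (μ := U.surfaceMeasure n)
    (s := fun j : ℕ => {φ | maxHeight n φ < 1 / ((j : ℝ) + 1)})
    (fun j => (measurableSet_lt (measurable_maxHeight n) measurable_const).nullMeasurableSet)
    (fun i j hij φ hφ => lt_of_lt_of_le (Set.mem_ofPred_eq ▸ hφ) (Nat.one_div_le_one_div hij)) ⟨0, measure_ne_top _ _⟩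
  have hinter : ⋂ j : ℕ, {φ | maxHeight n φ < 1 / ((j : ℝ) + 1)} ⊆ {0} := by
    intro φ hφ
    rw [Set.mem_iInter] at hφ
    rw [Set.mem_singleton_iff]
    funext v
    rw [Pi.zero_apply, ← abs_nonpos_iff]
    exact ge_of_tendsto' tendsto_one_div_add_atTop_nhds_zero_nat
      fun j => (maxHeight_lt_iff.1 (hφ j) v).le
  rw [measure_mono_null hinter hzero] at hlim
  obtain ⟨j, hj⟩ := (hlim.eventually (gt_mem_nhds (show (0 : ℝ≥0∞) < 1 / 2 by simp))).exists
  exact ⟨1 / ((j : ℝ) + 1), by positivity, fun _ => half_le_measure_le_maxHeight hj.le⟩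

end Potential

lemma exists_pos_forall_lt_le {f : ℕ → ℝ} (hf : ∀ i, 0 < f i) (N : ℕ) :
    ∃ t : ℝ, 0 < t ∧ ∀ i < N, t ≤ f i := by
  induction N with
  | zero => exact ⟨1, one_pos, fun i hi => absurd hi (Nat.not_lt_zero i)⟩
  | succ N ih =>
    obtain ⟨t, ht0, ht⟩ := ih
    refine ⟨min t (f N), lt_min ht0 (hf N), fun i hi => ?_⟩
    rcases Nat.lt_succ_iff_lt_or_eq.1 hi with h | rfl
    · exact (min_le_left _ _).trans (ht i h)
    · exact min_le_right _ _

theorem mainTheorem4 (U : Potential) (hU : U.IsAdmissible) (hC2 : U.IsC2OnUnit) :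
    ∃ c : ℝ, 0 < c ∧ ∀ (n : ℕ) [NeZero n], 2 ≤ n →
      (∃ ε : ℝ, 0 < ε ∧ ε ≤ 1 / 2 ∧ U.HasControlledGradients n (1 / 8) (1 - ε)) →
        1 / 2 ≤ U.surfaceMeasure n {φ | c * Real.log n ≤ maxHeight n φ} := by
  obtain ⟨c, hc0, N, hc⟩ := Potential.exists_half_le_of_large hU hC2
  choose t ht0 ht using Potential.exists_half_le hU hC2
  obtain ⟨s, hs0, hs⟩ := exists_pos_forall_lt_le (f := fun n => t n / (1 + |Real.log n|))
    (fun n => div_pos (ht0 n) (by positivity)) N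
  refine ⟨min c s, lt_min hc0 hs0, fun n _ hn hctrl => ?_⟩
  have hlog : 0 ≤ Real.log n := Real.log_natCast_nonneg n
  rcases Nat.lt_or_ge n N with h | h
  · refine (ht n hn).trans (measure_mono fun φ hφ => Set.mem_ofPred.2 (le_trans ?_ hφ))
    calc min c s * Real.log n ≤ s * (1 + |Real.log n|) :=
          mul_le_mul (min_le_right _ _) (by linarith [le_abs_self (Real.log n)]) hlog hs0.le
      _ ≤ t n := (le_div_iff₀ (by positivity)).1 (hs n h)
  · refine (hc n hn h hctrl).trans (measure_mono fun φ hφ => Set.mem_ofPred.2 (le_trans ?_ hφ))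
    exact mul_le_mul_of_nonneg_right (min_le_left _ _) hlog
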